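/- **Setting.** For $n\in\mathbb N$ let $V=\{x_1,\dots,x_n\}$ be the variables and $\pi\in S_n$ an order on them (put $\pi(x_i)=\pi(i)$). Write $x^1=x$, $x^0=\bar x$. A *clause* is a set of literals containing no variable together with its negation, $0$ is the empty clause, and a *CNF* is a set of clauses. A *resolution refutation* of a CNF $\tau$ is a sequence of clauses containing $0$, in which each clause is in $\tau$ or follows from two earlier ones by the rule $C\vee x^a,\ D\vee x^{1-a}\vdash C\vee D$; its size is its number of lines. It is *$\pi$-ordered* if in each application of the rule every variable $y$ of $C\vee D$ satisfies $\pi(y)<\pi(x)$. A *trail* is a list $t$ of assignments $x\stackrel{d}{=}a$ (decisions) and $x\stackrel{u}{=}a$ (unit propagations) with pairwise distinct variables; $C|_t$ is the restriction of the clause $C$, $t[\le k]$ is the prefix of length $k$, and $\Lambda$ is the empty trail. A *state* is a pair $S=(\mathbb C,t)$ of a CNF and a trail; it is *terminal* if $C|_t\equiv 1$ for all $C\in\mathbb C$ or $0\in\mathbb C$. Let $r$ be the length of $t$ and let $t$ assign $y_k=a_k$ at its $k$-th place. Let $\mathbb C_{r+1}(S)=\{D\in\mathbb C: D|_t=0\}$.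 For $k=r,\dots,1$, if the $k$-th assignment is a decision, let $\mathbb C_k(S)=\mathbb C_{k+1}(S)$; otherwise $\mathbb C_k(S)$ consists of all $D\in\mathbb C_{k+1}(S)$ not containing $y_k^{1-a_k}$, together with all resolvents on $y_k$ of some $D\in\mathbb C_{k+1}(S)$ containing $y_k^{1-a_k}$ with some $C\in\mathbb C$ such that $C|_{t[\le k-1]}=y_k^{a_k}$. Let $\mathbb C(S)=\bigcup_{k=1}^r\mathbb C_k(S)$. The basic CDCL model allows the following actions in a nonterminal state $S=(\mathbb C,t)$: (D) append $x\stackrel{d}{=}a$ to $t$, for an unassigned variable $x$; (U) append $x\stackrel{u}{=}a$ to $t$, if $C|_t=x^a$ for some $C\in\mathbb C$; (L) if $0\in\mathbb C(S)$, go to $(\mathbb C\cup\{0\},\Lambda)$; if $0\notin\mathbb C(S)$, go to $(\mathbb C\cup\{C\},t^*)$ for any $C\in\mathbb C(S)\setminus\mathbb C$ and any prefix $t^*$ of $t$ with $C|_{t^*}\ne0$. The amendment **DECISION-L** allows only clauses of $\mathbb C_1(S)$ to be learned in (L). The amendment **$\pi$-D** allows only the $\pi$-smallest unassigned variable to be chosen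 in (D). A proof in $\mathsf{CDCL}(\text{DECISION-L},\pi\text{-D})$ of the unsatisfiability of a contradictory CNF $\tau$ is a sequence of actions, none of them forbidden by these amendments, that leads from $(\tau,\Lambda)$ to a terminal state; its size is its number of actions. **Theorem 2.2.** For every order $\pi$ on the variables, $\mathsf{CDCL}(\text{DECISION-L},\pi\text{-D})$ and $\pi$-ordered resolution are polynomially equivalent, that is, they $p$-simulate each other. In detail, for each of the two directions there are one algorithm and one polynomial $q$ that work for all $n$, all $\pi\in S_n$ and all contradictory CNFs $\tau$ in $n$ variables: given $n$, $\pi$, $\tau$ and a refutation of $\tau$ of size $s$ in one system, the algorithm outputs a refutation of $\tau$ in the other system, in time at most $q$ of the length of its input, and the size of the output is at most $q(n+s)$. In particular, $\mathsf{CDCL}(\text{DECISION-L},\pi\text{-D})$ does not simulate general resolution, whatever the orders are: for every sequence of orders $\pi_n\in S_n$ $(n\in\mathbb N)$ there is no polynomial $q$ such that, for every $n$, every contradictory CNF $\tau$ in $n$ variables with a resolution refutation of size $s$ has a proof of size at most $q(n+|\tau|+s)$ in $\mathsf{CDCL}(\text{DECISION-L},\pi_n\text{-D})$, where $|\tau|$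 is the number of clauses of $\tau$. -/

import Mathlib

namespace OrderedCDCL

/-! ### Literals, clauses, CNFs -/

/-- The literal `x_var ^ sign`: the variable itself if `sign = true`, its negation otherwise.
The same data describe the assignment `x_var = sign`, which satisfies that literal. -/
@[ext]
structure Literal (n : ℕ) where
  var : Fin n
  sign : Bool
deriving DecidableEq

/-- The complementary literal. -/
def Literal.neg {n : ℕ} (l : Literal n) : Literal n := ⟨l.var, !l.sign⟩

/-- A clause is a set of literals in which no variable appears together with its negation. -/
abbrev Clause (n : ℕ) : Type := {s : Finset (Literal n) // ∀ l ∈ s, l.neg ∉ s}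

/-- The empty clause `0`. -/
def Clause.zero (n : ℕ) : Clause n := ⟨∅, by simp⟩

/-- A CNF is a (finite) set of clauses. -/
abbrev CNF (n : ℕ) : Type := Finset (Clause n)

/-- No Boolean assignment satisfies all the clauses. -/
def CNF.Contradictory {n : ℕ} (τ : CNF n) : Prop :=
  ¬ ∃ v : Fin n → Bool, ∀ C ∈ τ, ∃ l ∈ C.1, v l.var = l.sign

/-! ### Resolution and ordered resolution -/

/-- `R = Res(E, F)`, where `E = C ∨ l`, `F = D ∨ ¬l` and `R = C ∨ D`
(which has to be a clause, that is, it contains no complementary literals). -/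
def IsResolvent {n : ℕ} (E F : Clause n) (l : Literal n) (R : Clause n) : Prop :=
  l ∈ E.1 ∧ l.neg ∈ F.1 ∧ R.1 = E.1.erase l ∪ F.1.erase l.neg

/-- A sequence of clauses in which every clause belongs to `τ` or follows from two earlier
clauses by the resolution rule on a literal `l`, with conclusion `R`, such that `side l R`. -/
def IsDerivation {n : ℕ} (side : Literal n → Clause n → Prop) (τ : CNF n)
    (P : List (Clause n)) : Prop :=
  ∀ (k : ℕ) (hk : k < P.length), P[k] ∈ τ ∨
    ∃ (i j : ℕ) (hi : i < k) (hj : j < k) (l : Literal n),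
      IsResolvent P[i] P[j] l P[k] ∧ side l P[k]

/-- A resolution refutation of `τ`. -/
def IsResRefutation {n : ℕ} (τ : CNF n) (P : List (Clause n)) : Prop :=
  IsDerivation (fun _ _ => True) τ P ∧ Clause.zero n ∈ P

/-- A `π`-ordered resolution refutation of `τ`: the resolved variable is larger, with respect to
`π`, than all the variables of the conclusion. -/
def IsOrderedRefutation {n : ℕ} (π : Equiv.Perm (Fin n)) (τ : CNF n)
    (P : List (Clause n)) : Prop :=
  IsDerivation (fun l R => ∀ m ∈ R.1, π m.var < π l.var) τ P ∧ Clause.zero n ∈ P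

/-! ### Trails, states and actions of CDCL -/

/-- An annotated assignment `x = a`: a decision (`d`) or a unit propagation (`u`). -/
inductive Ann
  | d
  | u
deriving DecidableEq

@[ext]
structure AnnAssignment (n : ℕ) where
  lit : Literal n
  ann : Ann
deriving DecidableEq

/-- A trail is an ordered list of annotated assignments. The variables of a trail are
pairwise distinct in every state that can be reached from an empty trail, because
decisions and unit propagations only assign variables that are unassigned so far. -/
abbrev Trail (n : ℕ) : Type := List (AnnAssignment n)

/-- The variable `x` appears in the trail `t`. -/
def Trail.Assigns {n : ℕ} (t : Trail n) (x : Fin n) : Prop := ∃ e ∈ t, e.lit.var = x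

/-- The literals satisfied by the trail. -/
def Trail.lits {n : ℕ} (t : Trail n) : List (Literal n) := t.map AnnAssignment.lit

/-- The restriction `C|_t`: `none` stands for the constant `1` (some literal of `C` is satisfied),
otherwise the falsified literals are removed. -/
def Clause.restrict {n : ℕ} (C : Clause n) (t : Trail n) : Option (Finset (Literal n)) :=
  if ∃ l ∈ C.1, l ∈ t.lits then none else some (C.1.filter fun l => l.neg ∉ t.lits)

/-- A state `(ℂ, t)`. -/
structure State (n : ℕ) where
  clauses : CNF n
  trail : Trail n

/-- A state is terminal if all its clauses are satisfied by its trail, or if it contains `0`. -/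
def State.Terminal {n : ℕ} (S : State n) : Prop :=
  (∀ C ∈ S.clauses, C.restrict S.trail = none) ∨ Clause.zero n ∈ S.clauses

/-- One step of conflict analysis at the annotated assignment `e` that follows the prefix `p`
of the trail. -/
def backStep {n : ℕ} (K : CNF n) (p : Trail n) (e : AnnAssignment n) (X : Set (Clause n)) :
    Set (Clause n) :=
  match e.ann with
  | Ann.d => X
  | Ann.u => {D | D ∈ X ∧ e.lit.neg ∉ D.1} ∪
      {R | ∃ D ∈ X, e.lit.neg ∈ D.1 ∧
        ∃ C ∈ K, C.restrict p = some {e.lit} ∧ IsResolvent C D e.lit R}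

/-- The clauses that can be learned from `(K, p ++ s)` by backtracking up to `p`. -/
def learnableBack {n : ℕ} (K : CNF n) : Trail n → Trail n → Set (Clause n)
  | p, [] => {D | D ∈ K ∧ D.restrict p = some ∅}
  | p, e :: s => backStep K p e (learnableBack K (p ++ [e]) s)

/-- The set `ℂ_k(S)`, for `1 ≤ k ≤ r + 1`, where `r` is the length of the trail. -/
def State.learnableAt {n : ℕ} (S : State n) (k : ℕ) : Set (Clause n) :=
  learnableBack S.clauses (S.trail.take (k - 1)) (S.trail.drop (k - 1))

/-- The set `ℂ(S)`, the union of the sets `ℂ_k(S)` for `1 ≤ k ≤ r`. -/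
def State.learnable {n : ℕ} (S : State n) : Set (Clause n) :=
  {D | ∃ k, 1 ≤ k ∧ k ≤ S.trail.length ∧ D ∈ S.learnableAt k}

/-- `decide l` and `propagate l` make the assignment that satisfies `l`; `learn C t` adds `C` to
the clauses and backtracks to the trail `t`. -/
inductive Action (n : ℕ)
  | decide (l : Literal n)
  | propagate (l : Literal n)
  | learn (C : Clause n) (t : Trail n)

/-- The actions available in the state `S` in the basic model. -/
def State.actions {n : ℕ} (S : State n) : Set (Action n) :=
  {A | match A with
    | .decide l => ¬ S.trail.Assigns l.var
    | .propagate l => ∃ C ∈ S.clauses, C.restrict S.trail = some {l}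
    | .learn C t =>
        (Clause.zero n ∈ S.learnable ∧ C = Clause.zero n ∧ t = []) ∨
        (Clause.zero n ∉ S.learnable ∧ C ∈ S.learnable ∧ C ∉ S.clauses ∧
          t <+: S.trail ∧ C.restrict t ≠ some ∅)}

/-- The transition function. -/
def State.transition {n : ℕ} (S : State n) : Action n → State n
  | .decide l => ⟨S.clauses, S.trail ++ [⟨l, Ann.d⟩]⟩
  | .propagate l => ⟨S.clauses, S.trail ++ [⟨l, Ann.u⟩]⟩
  | .learn C t => ⟨insert C S.clauses, t⟩

/-- An amendment prescribes, for every state, a set of actions that are removed. -/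
abbrev Amendment (n : ℕ) : Type := State n → Set (Action n)

/-- `DECISION-L`: only the clauses in `ℂ_1(S)` may be learned. (The empty clause is in `ℂ(S)` if
and only if the trail is not empty and the empty clause is in `ℂ_1(S)`.) -/
def decisionL (n : ℕ) : Amendment n :=
  fun S => {A | ∃ C t, A = Action.learn C t ∧ C ∉ S.learnableAt 1}

/-- `π-D`: only the `π`-smallest unassigned variable may be decided. -/
def orderedD {n : ℕ} (π : Equiv.Perm (Fin n)) : Amendment n :=
  fun S => {A | ∃ l, A = Action.decide l ∧ ∃ y, ¬ S.trail.Assigns y ∧ π y < π l.var}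

/-- The sequence of actions leads from the first state to the second one, through states that
are nonterminal (except possibly the last one), by actions not removed by any amendment. -/
def IsRun {n : ℕ} (am : List (Amendment n)) : State n → List (Action n) → State n → Prop
  | S, [], T => S = T
  | S, A :: As, T =>
      ¬ S.Terminal ∧ A ∈ S.actions ∧ (∀ a ∈ am, A ∉ a S) ∧ IsRun am (S.transition A) As T

/-- A successful run on `τ`: from `(τ, Λ)` to a terminal state. -/
def IsSuccessfulRun {n : ℕ} (am : List (Amendment n)) (τ : CNF n) (R : List (Action n)) : Prop :=
  ∃ T, IsRun am ⟨τ, []⟩ R T ∧ T.Terminal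

/-! ### Algorithms and their running time -/

/-- Binary trees, the data of our algorithms. -/
inductive Data
  | nil
  | cons (a b : Data)
deriving DecidableEq

namespace Data

/-- The number of nodes and leaves. -/
def size : Data → ℕ
  | nil => 1
  | cons a b => a.size + b.size + 1

def hd : Data → Data
  | nil => nil
  | cons a _ => a

def tl : Data → Data
  | nil => nil
  | cons _ b => b

def ofBool : Bool → Data
  | false => nil
  | true => cons nil nil

/-- Natural numbers are written in unary. -/
def ofNat : ℕ → Data
  | 0 => nil
  | k + 1 => cons nil (ofNat k)

def ofList {α : Type} (f : α → Data) : List α → Data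
  | [] => nil
  | a :: l => cons (f a) (ofList f l)

end Data

/-- Programs of a WHILE language that computes with binary trees. A program maps a
tree to a tree; `eq` compares the two subtrees of its input. -/
inductive Prog
  | id
  | nil
  | hd
  | tl
  | eq
  | cons (f g : Prog)
  | comp (g f : Prog)
  | ite (b f g : Prog)
  | while (b f : Prog)

/-- `Eval p x y c`: the program `p`, started on `x`, halts with the result `y` at cost `c`.
An elementary operation costs the size of the tree that it reads and `cons` also costs the size
of the tree that it builds, so that the trees that occur in a computation are, up to an additive
constant, no larger than its cost. Hence the cost is, up to a polynomial, the running time on a Turing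
machine. The tree `nil` is the truth value false, all the others are true. -/
inductive Prog.Eval : Prog → Data → Data → ℕ → Prop
  | id (x : Data) : Eval Prog.id x x x.size
  | nil (x : Data) : Eval Prog.nil x Data.nil x.size
  | hd (x : Data) : Eval Prog.hd x x.hd x.size
  | tl (x : Data) : Eval Prog.tl x x.tl x.size
  | eq (x : Data) : Eval Prog.eq x (Data.ofBool (decide (x.hd = x.tl))) x.size
  | cons {f g : Prog} {x y z : Data} {c d : ℕ} :
      Eval f x y c → Eval g x z d → Eval (Prog.cons f g) x (Data.cons y z)
        (c + d + (Data.cons y z).size)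
  | comp {f g : Prog} {x y z : Data} {c d : ℕ} :
      Eval f x y c → Eval g y z d → Eval (Prog.comp g f) x z (c + d + 1)
  | iteTrue {b f g : Prog} {x y z : Data} {c d : ℕ} :
      Eval b x y c → y ≠ Data.nil → Eval f x z d → Eval (Prog.ite b f g) x z (c + d + 1)
  | iteFalse {b f g : Prog} {x z : Data} {c d : ℕ} :
      Eval b x Data.nil c → Eval g x z d → Eval (Prog.ite b f g) x z (c + d + 1)
  | whileTrue {b f : Prog} {x v y z : Data} {c d e : ℕ} :
      Eval b x v c → v ≠ Data.nil → Eval f x y d → Eval (Prog.while b f) y z e →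
        Eval (Prog.while b f) x z (c + d + e + 1)
  | whileFalse {b f : Prog} {x : Data} {c : ℕ} :
      Eval b x Data.nil c → Eval (Prog.while b f) x x (c + 1)

/-! ### Encodings -/

/-- A clause is the list, over all the variables, of the way in which the variable occurs:
`0` if it does not occur, `1` if it occurs negated, `2` if it occurs unnegated. -/
def Clause.encode {n : ℕ} (C : Clause n) : Data :=
  Data.ofList Data.ofNat (List.ofFn fun i : Fin n =>
    if ⟨i, true⟩ ∈ C.1 then 2 else if ⟨i, false⟩ ∈ C.1 then 1 else 0)

def Literal.encode {n : ℕ} (l : Literal n) : Data :=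
  Data.cons (Data.ofNat l.var) (Data.ofBool l.sign)

def AnnAssignment.encode {n : ℕ} (e : AnnAssignment n) : Data :=
  Data.cons e.lit.encode (Data.ofBool (decide (e.ann = Ann.u)))

def Action.encode {n : ℕ} : Action n → Data
  | .decide l => Data.cons (Data.ofNat 0) l.encode
  | .propagate l => Data.cons (Data.ofNat 1) l.encode
  | .learn C t => Data.cons (Data.ofNat 2)
      (Data.cons C.encode (Data.ofList AnnAssignment.encode t))

theorem Data.ofBool_injective : Function.Injective Data.ofBool := by
  intro a b h
  cases a <;> cases b <;> simp_all [Data.ofBool]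

theorem Data.ofNat_injective : Function.Injective Data.ofNat := by
  intro a
  induction a with
  | zero => intro b h; cases b <;> simp_all [Data.ofNat]
  | succ a ih =>
    intro b h
    cases b with
    | zero => simp [Data.ofNat] at h
    | succ b => simp only [Data.ofNat, Data.cons.injEq, true_and] at h; rw [ih h]

theorem Data.ofList_injective {α : Type} {f : α → Data} (hf : Function.Injective f) :
    Function.Injective (Data.ofList f) := by
  intro a
  induction a with
  | nil => intro b h; cases b <;> simp_all [Data.ofList]
  | cons a l ih =>
    intro b h
    cases b with
    | nil => simp [Data.ofList] at h
    | cons b m =>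
      simp only [Data.ofList, Data.cons.injEq] at h
      rw [hf h.1, ih h.2]

theorem Clause.encode_injective {n : ℕ} : Function.Injective (Clause.encode (n := n)) := by
  intro C D h
  have h1 := List.ofFn_injective (Data.ofList_injective Data.ofNat_injective h)
  apply Subtype.ext
  ext ⟨i, s⟩
  have h2 := congrFun h1 i
  have hC := C.2 ⟨i, true⟩
  have hD := D.2 ⟨i, true⟩
  simp only [Literal.neg, Bool.not_true] at hC hD
  cases s <;> split_ifs at h2 <;> simp_all

theorem Literal.encode_injective {n : ℕ} : Function.Injective (Literal.encode (n := n)) := by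
  intro a b h
  simp only [Literal.encode, Data.cons.injEq] at h
  exact Literal.ext (Fin.ext (Data.ofNat_injective h.1)) (Data.ofBool_injective h.2)

theorem AnnAssignment.encode_injective {n : ℕ} :
    Function.Injective (AnnAssignment.encode (n := n)) := by
  rintro ⟨a, s⟩ ⟨b, t⟩ h
  simp only [AnnAssignment.encode, Data.cons.injEq] at h
  have h1 := Literal.encode_injective h.1
  have h2 := Data.ofBool_injective h.2
  cases s <;> cases t <;> simp_all

theorem Action.encode_injective {n : ℕ} : Function.Injective (Action.encode (n := n)) := by
  intro A B h
  cases A <;> cases B <;> simp only [Action.encode, Data.ofNat, Data.cons.injEq] at h <;>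
    simp_all
  · exact Literal.encode_injective h
  · exact Literal.encode_injective h
  · exact ⟨Clause.encode_injective h.1,
      Data.ofList_injective AnnAssignment.encode_injective h.2⟩

/-! ### Proof systems and simulations -/

/-- A system for refuting CNFs in `n` variables: its proofs, the relation of being a refutation
of a CNF, the size of a proof, and the way in which proofs are presented to algorithms. -/
structure RefutationSystem (n : ℕ) where
  Proof : Type
  IsRefutation : CNF n → Proof → Prop
  size : Proof → ℕ
  encode : Proof → Data
  encode_injective : Function.Injective encode

/-- General resolution. The size of a proof is the number of its lines. -/
def resolution (n : ℕ) : RefutationSystem n where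
  Proof := List (Clause n)
  IsRefutation := IsResRefutation
  size := List.length
  encode := Data.ofList Clause.encode
  encode_injective := Data.ofList_injective Clause.encode_injective

/-- `π`-ordered resolution. The size of a proof is the number of its lines. -/
def orderedResolution {n : ℕ} (π : Equiv.Perm (Fin n)) : RefutationSystem n where
  Proof := List (Clause n)
  IsRefutation := IsOrderedRefutation π
  size := List.length
  encode := Data.ofList Clause.encode
  encode_injective := Data.ofList_injective Clause.encode_injective

/-- `CDCL(am)`: the proofs are the successful runs, given by their actions (which, together
with the initial CNF, determine the states). The size is the number of actions. -/
def cdcl {n : ℕ} (am : List (Amendment n)) : RefutationSystem n where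
  Proof := List (Action n)
  IsRefutation := IsSuccessfulRun am
  size := List.length
  encode := Data.ofList Action.encode
  encode_injective := Data.ofList_injective Action.encode_injective

/-- The input of a simulation: the number of variables, the order `π`, a list of the clauses
of the CNF, and an encoded proof. -/
def simulationInput {n : ℕ} (π : Equiv.Perm (Fin n)) (τ : List (Clause n)) (P : Data) : Data :=
  Data.cons (Data.ofNat n) (Data.cons (Data.ofList (fun i : Fin n => Data.ofNat i) (List.ofFn π))
    (Data.cons (Data.ofList Clause.encode τ) P))

/-- `P` `p`-simulates `Q`, where `P` and `Q` are systems for every number of variables `n`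
and every order `π`: some polynomial time algorithm transforms every `Q`-refutation of
a contradictory CNF into a `P`-refutation of the same CNF; moreover, the size of the result is
polynomial in `n` and in the size of the given refutation alone. -/
def PSimulates (P Q : ∀ n : ℕ, Equiv.Perm (Fin n) → RefutationSystem n) : Prop :=
  ∃ (M : Prog) (q : Polynomial ℕ), ∀ (n : ℕ) (π : Equiv.Perm (Fin n)) (τ : List (Clause n)),
    CNF.Contradictory τ.toFinset →
    ∀ A : (Q n π).Proof, (Q n π).IsRefutation τ.toFinset A →
      ∃ B : (P n π).Proof, (P n π).IsRefutation τ.toFinset B ∧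
        (∃ c : ℕ, M.Eval (simulationInput π τ ((Q n π).encode A)) ((P n π).encode B) c ∧
          c ≤ q.eval (simulationInput π τ ((Q n π).encode A)).size) ∧
        (P n π).size B ≤ q.eval (n + (Q n π).size A)

/-- Two systems are polynomially equivalent if they `p`-simulate each other. -/
def PolyEquivalent (P Q : ∀ n : ℕ, Equiv.Perm (Fin n) → RefutationSystem n) : Prop :=
  PSimulates P Q ∧ PSimulates Q P

/-- `P` simulates `Q` in the weakest sense: whenever a contradictory CNF has a `Q`-refutation,
it has a `P`-refutation of size polynomial in the number of variables, the number of clauses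
and the size of the `Q`-refutation. The `P`-refutation need not be found efficiently. -/
def SizeSimulates (P Q : ∀ n : ℕ, RefutationSystem n) : Prop :=
  ∃ q : Polynomial ℕ, ∀ (n : ℕ) (τ : CNF n), τ.Contradictory →
    ∀ A : (Q n).Proof, (Q n).IsRefutation τ A →
      ∃ B : (P n).Proof, (P n).IsRefutation τ B ∧
        (P n).size B ≤ q.eval (n + τ.card + (Q n).size A)

end OrderedCDCL

open OrderedCDCL

namespace OrderedCDCL

/-! ### Polynomial bounds -/

/-! From ordered resolution to CDCL the simulation is direct. Let R be an ordered resolvent on x of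
known clauses E and F. Decide the variables below x in increasing order so that R becomes false.
Then E propagates x, F is a conflict, and resolving at the only propagation gives R, which is
learned before a restart from the empty trail. If the unit clauses x and its negation are both
known, rule (L) forces 0 to be learned instead, which ends the run (`isRun_learnActions`). A line
costs at most n + 2 actions.

The converse has two stages. The resolutions behind a learned clause D follow the trail, whose
propagated variables need not respect π. What remains of the order is that a decision is smaller
than every variable assigned after it (`OrderedTrail.decision_lt`). So, for each propagated literal
l that matters, record the line consisting of l and the literals of D that negate earlier decisions;
its largest literal is l. With these lines D has a half-ordered derivation: start from one clause
and remove literals by side lines in which the complement of the removed literal is the largest,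
weakening being free (`exists_subset_marked`, `IsRun.spec`).

The second stage makes a half-ordered derivation P ordered by reading it as a search for a falsified
clause of τ. The search queries the variables in the order π and keeps a current line, starting with
the empty one at the end of P. Known to be false are the literals of the current line and those
whose complements are forced by lines before it (`levelLits`). If an answer falsifies a line before
the current one, the search moves to the first such line. After the last variable some clause of τ
consists of literals known to be false (`exists_subset_levelLits`). A state of the search is a pair
of a level and a line, so there are (n + 1)|P| states. From the last level down, each state gets a
clause made of literals known to be false there: an ordered resolvent, on the queried variable, of
the clauses of the two successors, or one of these (`nextRow_sound`). The initial state gets 0.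

For the separation, take an unsatisfiable chain of m + 1 implications between m large variables and
replace its i-th clause by two weakenings, with the i-th small variable and with its negation.
General resolution removes the small variables first and has linear size. Ordered resolution must
remove the large ones first, and this uses every clause of the chain; so for each assignment of the
small variables a clause with all m + 1 small literals falsified by it must occur
(`Hard.exists_full_clause`), which makes 2^(m+1) clauses. The simulation of CDCL transfers this
bound.

Both translations are written with list folds, for which `PT` provides closure properties of
polynomial time; the only real obligation in a fold is a bound on the size of its accumulator. -/

theorem polyEval_mono (q : Polynomial ℕ) {a b : ℕ} (h : a ≤ b) : q.eval a ≤ q.eval b := by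
  induction q using Polynomial.induction_on' with
  | add p q hp hq => simpa using add_le_add hp hq
  | monomial k c => simpa using Nat.mul_le_mul_left c (Nat.pow_le_pow_left h k)

/-- `k` is bounded by a polynomial in `s`. -/
def PolyBdd {X : Type} (s k : X → ℕ) : Prop :=
  ∃ q : Polynomial ℕ, ∀ x, k x ≤ q.eval (s x)

namespace PolyBdd

variable {X Y : Type} {s k m : X → ℕ}

theorem mono (h : PolyBdd s k) (hm : ∀ x, m x ≤ k x) : PolyBdd s m := by
  obtain ⟨q, hq⟩ := h
  exact ⟨q, fun x => (hm x).trans (hq x)⟩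

theorem self : PolyBdd s s := ⟨Polynomial.X, fun x => by simp⟩

theorem const (c : ℕ) : PolyBdd s (fun _ => c) := ⟨Polynomial.C c, fun x => by simp⟩

theorem add (h : PolyBdd s k) (h' : PolyBdd s m) : PolyBdd s (fun x => k x + m x) := by
  obtain ⟨q, hq⟩ := h
  obtain ⟨r, hr⟩ := h'
  exact ⟨q + r, fun x => by simpa using add_le_add (hq x) (hr x)⟩

theorem mul (h : PolyBdd s k) (h' : PolyBdd s m) : PolyBdd s (fun x => k x * m x) := by
  obtain ⟨q, hq⟩ := h
  obtain ⟨r, hr⟩ := h'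
  exact ⟨q * r, fun x => by simpa using Nat.mul_le_mul (hq x) (hr x)⟩

theorem trans (h : PolyBdd s k) (h' : PolyBdd k m) : PolyBdd s m := by
  obtain ⟨q, hq⟩ := h
  obtain ⟨r, hr⟩ := h'
  exact ⟨r.comp q, fun x => by
    simpa using (hr x).trans (polyEval_mono r (hq x))⟩

theorem comap (h : PolyBdd s k) (f : Y → X) :
    PolyBdd (fun y => s (f y)) (fun y => k (f y)) := by
  obtain ⟨q, hq⟩ := h
  exact ⟨q, fun y => hq (f y)⟩

end PolyBdd

/-! ### Polynomial time computability -/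

theorem Data.size_pos (x : Data) : 1 ≤ x.size := by
  cases x <;> simp [Data.size]

theorem Data.size_hd_le (x : Data) : x.hd.size ≤ x.size := by
  cases x <;> simp [Data.size, Data.hd]; omega

theorem Data.size_tl_le (x : Data) : x.tl.size ≤ x.size := by
  cases x <;> simp [Data.size, Data.tl]; omega

theorem Data.size_ofBool_le (b : Bool) : (Data.ofBool b).size ≤ 3 := by
  cases b <;> simp [Data.size, Data.ofBool]

theorem Prog.Eval.input_size_le {M : Prog} {x y : Data} {c : ℕ} (h : M.Eval x y c) :
    x.size ≤ c := by
  induction h <;> omega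

/-- The 2 is due to `eq`, which can return a tree of size 3 on an input of size 1. Bounding the
output by the cost is what makes polynomial costs compose. -/
theorem Prog.Eval.size_le {M : Prog} {x y : Data} {c : ℕ} (h : M.Eval x y c) :
    y.size ≤ c + 2 := by
  induction h with
  | id x => omega
  | nil x => have := x.size_pos; simp [Data.size]
  | hd x => have := x.size_hd_le; omega
  | tl x => have := x.size_tl_le; omega
  | eq x =>
    have := x.size_pos
    have := Data.size_ofBool_le (decide (x.hd = x.tl))
    omega
  | cons => omega
  | comp => omega
  | iteTrue => omega
  | iteFalse => omega
  | whileTrue => omega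
  | whileFalse hb => have := hb.input_size_le; omega

/-- Some program computes `g x` from `e x` in time polynomial in the size of `e x`. -/
def PT {X : Type} (e g : X → Data) : Prop :=
  ∃ (M : Prog) (c : X → ℕ), PolyBdd (fun x => (e x).size) c ∧ ∀ x, M.Eval (e x) (g x) (c x)

/-- The size of `g x` is polynomial in the size of `e x`. -/
abbrev SizeBdd {X : Type} (e : X → Data) (k : X → ℕ) : Prop := PolyBdd (fun x => (e x).size) k

namespace PT

variable {X Y : Type} {e g h : X → Data}

theorem size_bdd (hg : PT e g) : SizeBdd e (fun x => (g x).size) := by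
  obtain ⟨M, c, hc, hM⟩ := hg
  exact (hc.add (.const 2)).mono fun x => (hM x).size_le

theorem refl : PT e e := ⟨.id, _, .self, fun _ => .id _⟩

theorem comap (hg : PT e g) (f : Y → X) : PT (fun y => e (f y)) (fun y => g (f y)) := by
  obtain ⟨M, c, hc, hM⟩ := hg
  exact ⟨M, _, hc.comap f, fun y => hM (f y)⟩

theorem trans (hg : PT e g) (hh : PT g h) : PT e h := by
  obtain ⟨M, c, hc, hM⟩ := id hg
  obtain ⟨M', c', hc', hM'⟩ := hh
  exact ⟨.comp M' M, _, (hc.add (hg.size_bdd.trans hc')).add (.const 1),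
    fun x => .comp (hM x) (hM' x)⟩

/-- Changes the context: what is computable from `e` stays computable inside a loop body, whose
input `e'` carries more data, once `e` can be recovered from `e'`. -/
theorem lift (hg : PT e g) {e' : Y → Data} {f : Y → X} (he : PT e' (fun y => e (f y))) :
    PT e' (fun y => g (f y)) := he.trans (hg.comap f)

theorem nil : PT e (fun _ => Data.nil) := ⟨.nil, _, .self, fun _ => .nil _⟩

theorem hd (hg : PT e g) : PT e (fun x => (g x).hd) :=
  hg.trans ⟨.hd, _, .self, fun _ => .hd _⟩

theorem tl (hg : PT e g) : PT e (fun x => (g x).tl) :=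
  hg.trans ⟨.tl, _, .self, fun _ => .tl _⟩

theorem cons (hg : PT e g) (hh : PT e h) : PT e (fun x => Data.cons (g x) (h x)) := by
  obtain ⟨M, c, hc, hM⟩ := id hg
  obtain ⟨M', c', hc', hM'⟩ := id hh
  exact ⟨.cons M M', _, (hc.add hc').add ((hg.size_bdd.add hh.size_bdd).add (.const 1)),
    fun x => .cons (hM x) (hM' x)⟩

theorem eq (hg : PT e g) (hh : PT e h) : PT e (fun x => Data.ofBool (decide (g x = h x))) :=
  (hg.cons hh).trans ⟨.eq, _, .self, fun x => .eq (Data.cons (g x) (h x))⟩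

theorem const (d : Data) : PT e (fun _ => d) := by
  induction d with
  | nil => exact nil
  | cons a b ha hb => exact ha.cons hb

theorem iteData {p : X → Prop} [∀ x, Decidable (p x)]
    (hp : PT e (fun x => Data.ofBool (decide (p x)))) (hg : PT e g) (hh : PT e h) :
    PT e (fun x => if p x then g x else h x) := by
  obtain ⟨B, b, hb, hB⟩ := hp
  obtain ⟨M, c, hc, hM⟩ := hg
  obtain ⟨M', c', hc', hM'⟩ := hh
  refine ⟨.ite B M M', fun x => if p x then b x + c x + 1 else b x + c' x + 1,
    ((hb.add (hc.add hc')).add (.const 1)).mono fun x => ?_, fun x => ?_⟩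
  · split_ifs <;> omega
  · have := hB x
    by_cases hx : p x
    · simp only [hx, if_true, decide_true] at this ⊢
      exact .iteTrue this (by simp [Data.ofBool]) (hM x)
    · simp only [hx, if_false, decide_false] at this ⊢
      exact .iteFalse this (hM' x)

end PT

/-! ### Left folds as while loops -/

theorem Data.size_ofList_append {α : Type} (f : α → Data) (l m : List α) :
    (ofList f (l ++ m)).size + 1 = (ofList f l).size + (ofList f m).size := by
  induction l with
  | nil => simp [ofList, size]; omega
  | cons a l ih => simp only [List.cons_append, ofList, size]; omega

theorem Data.length_lt_size_ofList {α : Type} (f : α → Data) (l : List α) :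
    l.length < (ofList f l).size := by
  induction l with
  | nil => simp [ofList, size]
  | cons a l ih => simp only [ofList, size, List.length_cons]; omega

theorem Data.size_lt_size_ofList {α : Type} (f : α → Data) {l : List α} {a : α} (h : a ∈ l) :
    (f a).size < (ofList f l).size := by
  induction l with
  | nil => simp at h
  | cons b l ih =>
    have := (f a).size_pos
    have := (f b).size_pos
    rcases List.mem_cons.1 h with rfl | h
    · simp only [ofList, size]; omega
    · have := ih h
      simp only [ofList, size]; omega

theorem Data.size_ofList_le {α : Type} (f : α → Data) (l : List α) (k : ℕ)
    (h : ∀ a ∈ l, (f a).size ≤ k) : (ofList f l).size ≤ l.length * (k + 1) + 1 := by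
  induction l with
  | nil => simp [ofList, size]
  | cons a l ih =>
    have h1 := h a (by simp)
    have h2 := ih fun b hb => h b (by simp [hb])
    simp only [ofList, size, List.length_cons, Nat.add_mul]; omega

/-- The state of the loop that computes a left fold. -/
abbrev foldState (u v w : Data) : Data := Data.cons u (Data.cons v w)

theorem Prog.eval_while_foldl {α β : Type} {B M : Prog} {u : Data} {ea : α → Data} {eb : β → Data}
    {step : β → α → β} {W : ℕ} (l : List α) (b : β)
    (hB : ∀ l₁ l₂, l = l₁ ++ l₂ → ∃ c ≤ W,
      B.Eval (foldState u (eb (l₁.foldl step b)) (Data.ofList ea l₂)) (Data.ofList ea l₂) c)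
    (hM : ∀ l₁ a l₂, l = l₁ ++ a :: l₂ → ∃ c ≤ W,
      M.Eval (foldState u (eb (l₁.foldl step b)) (Data.ofList ea (a :: l₂)))
        (foldState u (eb (step (l₁.foldl step b) a)) (Data.ofList ea l₂)) c) :
    ∃ c ≤ (l.length + 1) * (2 * W + 1),
      (Prog.while B M).Eval (foldState u (eb b) (Data.ofList ea l))
        (foldState u (eb (l.foldl step b)) Data.nil) c := by
  induction l generalizing b with
  | nil =>
    obtain ⟨c, hc, h⟩ := hB [] [] rfl
    exact ⟨c + 1, by simp; omega, .whileFalse h⟩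
  | cons a l ih =>
    obtain ⟨c, hc, h⟩ := hB [] (a :: l) rfl
    obtain ⟨c', hc', h'⟩ := hM [] a l rfl
    obtain ⟨c'', hc'', h''⟩ := ih (step b a)
      (fun l₁ l₂ hl => hB (a :: l₁) l₂ (by simp [hl]))
      (fun l₁ a' l₂ hl => hM (a :: l₁) a' l₂ (by simp [hl]))
    refine ⟨c + c' + c'' + 1, ?_, .whileTrue h (by simp [Data.ofList]) h' h''⟩
    rw [List.length_cons, Nat.add_mul (l.length + 1)]
    omega

namespace PT

/-- The loop state holds the context, the accumulator and the rest of the list; the rest serves as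
its own loop test, since only the empty list is encoded by `Data.nil`. The bound `hbd` at every
prefix cannot be dropped: iterating a polynomial time step may produce trees of exponential size. -/
theorem foldl_core {X : Type} {e : X → Data} {α β : X → Type} {ea : ∀ x, α x → Data}
    {eb : ∀ x, β x → Data} {l : ∀ x, List (α x)} {b₀ : ∀ x, β x} {step : ∀ x, β x → α x → β x}
    (hl : PT e fun x => Data.ofList (ea x) (l x)) (h₀ : PT e fun x => eb x (b₀ x))
    (hs : PT (X := Σ x, β x × α x)
      (fun p => Data.cons (e p.1) (Data.cons (eb p.1 p.2.1) (ea p.1 p.2.2)))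
      (fun p => eb p.1 (step p.1 p.2.1 p.2.2)))
    {k : X → ℕ} (hk : SizeBdd e k)
    (hbd : ∀ x l₁, l₁ <+: l x → (eb x (l₁.foldl (step x) (b₀ x))).size ≤ k x) :
    PT e fun x => eb x ((l x).foldl (step x) (b₀ x)) := by
  have hB : PT (X := Σ x, β x × List (α x))
      (fun p => foldState (e p.1) (eb p.1 p.2.1) (Data.ofList (ea p.1) p.2.2))
      (fun p => Data.ofList (ea p.1) p.2.2) := PT.refl.tl.tl
  have hM : PT (X := Σ x, β x × α x × List (α x))
      (fun p => foldState (e p.1) (eb p.1 p.2.1) (Data.ofList (ea p.1) (p.2.2.1 :: p.2.2.2)))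
      (fun p => foldState (e p.1) (eb p.1 (step p.1 p.2.1 p.2.2.1))
        (Data.ofList (ea p.1) p.2.2.2)) := by
    refine PT.refl.hd.cons (PT.cons ?_ PT.refl.tl.tl.tl)
    exact hs.lift (f := fun p : Σ x, β x × α x × List (α x) => ⟨p.1, p.2.1, p.2.2.1⟩)
      (PT.refl.hd.cons (PT.refl.tl.hd.cons PT.refl.tl.tl.hd))
  obtain ⟨B, c, ⟨q, hq⟩, hB⟩ := hB
  obtain ⟨M, c', ⟨q', hq'⟩, hM⟩ := hM
  -- Bounds the size of every loop state; the 2 counts the two `cons` nodes of `foldState`.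
  let s : X → ℕ := fun x => (e x).size + k x + (Data.ofList (ea x) (l x)).size + 2
  have hs' : SizeBdd e s := ((PolyBdd.self.add hk).add hl.size_bdd).add (.const 2)
  let W : X → ℕ := fun x => q.eval (s x) + q'.eval (s x)
  have hW : SizeBdd e W := by
    refine PolyBdd.add (hs'.trans ?_) (hs'.trans ?_)
    exacts [⟨q, fun _ => le_rfl⟩, ⟨q', fun _ => le_rfl⟩]
  have hinit : PT e fun x => foldState (e x) (eb x (b₀ x)) (Data.ofList (ea x) (l x)) :=
    PT.refl.cons (h₀.cons hl)
  have hloop : ∀ x, ∃ d ≤ ((l x).length + 1) * (2 * W x + 1),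
      (Prog.while B M).Eval (foldState (e x) (eb x (b₀ x)) (Data.ofList (ea x) (l x)))
        (foldState (e x) (eb x ((l x).foldl (step x) (b₀ x))) Data.nil) d := by
    intro x
    have key : ∀ l₁ l₂, l x = l₁ ++ l₂ →
        (foldState (e x) (eb x (l₁.foldl (step x) (b₀ x))) (Data.ofList (ea x) l₂)).size ≤ s x := by
      intro l₁ l₂ h
      have h1 := hbd x l₁ ⟨l₂, h.symm⟩
      have h2 := Data.size_ofList_append (ea x) l₁ l₂
      have h3 := (Data.ofList (ea x) l₁).size_pos
      rw [← h] at h2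
      simp only [Data.size, s]; omega
    apply Prog.eval_while_foldl
    · intro l₁ l₂ h
      refine ⟨_, ?_, hB ⟨x, l₁.foldl (step x) (b₀ x), l₂⟩⟩
      refine (hq _).trans ((polyEval_mono q (key l₁ l₂ h)).trans ?_)
      exact Nat.le_add_right _ _
    · intro l₁ a l₂ h
      refine ⟨_, ?_, hM ⟨x, l₁.foldl (step x) (b₀ x), a, l₂⟩⟩
      refine (hq' _).trans ((polyEval_mono q' (key l₁ (a :: l₂) h)).trans ?_)
      exact Nat.le_add_left _ _
  choose d hd hloop using hloop
  have hloop' : PT e fun x => foldState (e x) (eb x ((l x).foldl (step x) (b₀ x))) Data.nil := by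
    obtain ⟨M₀, c₀, hc₀, hM₀⟩ := hinit
    refine ⟨.comp (.while B M) M₀, _, (hc₀.add (m := d) (PolyBdd.mono ?_ hd)).add (.const 1),
      fun x => .comp (hM₀ x) (hloop x)⟩
    refine PolyBdd.mul (hl.size_bdd.mono fun x => Data.length_lt_size_ofList _ _)
      (((PolyBdd.const 2).mul hW).add (.const 1))
  exact hloop'.tl.hd

end PT

end OrderedCDCL

namespace OrderedCDCL

/-! ### Encoded types -/

/-- Types whose elements are presented to programs as trees. -/
class Enc (α : Type) where
  enc : α → Data
  enc_injective : Function.Injective enc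

open Enc

instance : Enc Data := ⟨id, Function.injective_id⟩
instance : Enc Bool := ⟨Data.ofBool, Data.ofBool_injective⟩
instance : Enc ℕ := ⟨Data.ofNat, Data.ofNat_injective⟩
instance {n : ℕ} : Enc (Fin n) :=
  ⟨fun i => Data.ofNat i, fun _ _ h => Fin.ext (Data.ofNat_injective h)⟩
instance {n : ℕ} : Enc (Literal n) := ⟨Literal.encode, Literal.encode_injective⟩
instance {n : ℕ} : Enc (Clause n) := ⟨Clause.encode, Clause.encode_injective⟩
instance {n : ℕ} : Enc (AnnAssignment n) :=
  ⟨AnnAssignment.encode, AnnAssignment.encode_injective⟩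
instance {n : ℕ} : Enc (Action n) := ⟨Action.encode, Action.encode_injective⟩
instance {α : Type} [Enc α] : Enc (List α) :=
  ⟨Data.ofList enc, Data.ofList_injective enc_injective⟩
instance {α β : Type} [Enc α] [Enc β] : Enc (α × β) :=
  ⟨fun p => Data.cons (enc p.1) (enc p.2), fun p q h => by
    simp only [Data.cons.injEq] at h
    exact Prod.ext (enc_injective h.1) (enc_injective h.2)⟩

/-- `f x` can be computed from `e x` in polynomial time. -/
abbrev Poly {X : Type} (e : X → Data) {α : X → Type} [∀ x, Enc (α x)] (f : ∀ x, α x) : Prop :=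
  PT e (fun x => enc (f x))

/-- The step function `f` can be computed in polynomial time in every context. -/
abbrev PolyStep {X : Type} (e : X → Data) {α β : X → Type} [∀ x, Enc (α x)] [∀ x, Enc (β x)]
    (f : ∀ x, α x → β x) : Prop :=
  ∀ (Y : Type) (e' : Y → Data) (x : Y → X) (a : ∀ y, α (x y)), PT e' (fun y => e (x y)) →
    Poly e' (fun y => a y) → Poly e' (fun y => f (x y) (a y))

namespace PT

variable {X : Type} {e : X → Data}

theorem congr {g g' : X → Data} (h : PT e g) (hg : ∀ x, g x = g' x) : PT e g' :=
  funext hg ▸ h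

section Basic

variable {α β : X → Type} [∀ x, Enc (α x)] [∀ x, Enc (β x)]

theorem congrEnc {f g : ∀ x, α x} (h : Poly e f) (hg : ∀ x, f x = g x) : Poly e g :=
  funext hg ▸ h

theorem pair {f : ∀ x, α x} {g : ∀ x, β x} (hf : Poly e f) (hg : Poly e g) :
    Poly e (fun x => (f x, g x)) := hf.cons hg

theorem fst {f : ∀ x, α x × β x} (hf : Poly e f) : Poly e (fun x => (f x).1) := hf.hd

theorem snd {f : ∀ x, α x × β x} (hf : Poly e f) : Poly e (fun x => (f x).2) := hf.tl

theorem ite {p : X → Prop} [∀ x, Decidable (p x)] {f g : ∀ x, α x}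
    (hp : Poly e fun x => decide (p x)) (hf : Poly e f) (hg : Poly e g) :
    Poly e (fun x => if p x then f x else g x) := by
  have := PT.iteData hp hf hg
  simpa only [Poly, apply_ite] using this

/-- Injectivity of the encoding reduces equality to the comparison of trees. -/
theorem dec {f g : ∀ x, α x} [∀ x, Decidable (f x = g x)] (hf : Poly e f) (hg : Poly e g) :
    Poly e (fun x => decide (f x = g x)) := by
  have := PT.eq hf hg
  refine this.congr fun x => congrArg Data.ofBool ?_
  simp only [enc_injective.eq_iff]

theorem decTrue {b : X → Bool} (hb : Poly e b) : Poly e (fun x => decide (b x = true)) := by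
  simpa using hb

theorem constEnc {γ : Type} [Enc γ] (c : γ) : Poly e (fun _ => c) := PT.const _

theorem not {b : X → Bool} (hb : Poly e b) : Poly e (fun x => !b x) := by
  have := PT.ite (decTrue hb) (constEnc (e := e) false) (constEnc (e := e) true)
  refine congrEnc this fun x => ?_
  cases b x <;> rfl

theorem and {b c : X → Bool} (hb : Poly e b) (hc : Poly e c) : Poly e (fun x => b x && c x) := by
  have := PT.ite (decTrue hb) hc (constEnc (e := e) false)
  refine congrEnc this fun x => ?_
  cases b x <;> rfl

theorem or {b c : X → Bool} (hb : Poly e b) (hc : Poly e c) : Poly e (fun x => b x || c x) := by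
  have := PT.ite (decTrue hb) (constEnc (e := e) true) hc
  refine congrEnc this fun x => ?_
  cases b x <;> rfl

theorem decAnd {p q : X → Prop} [∀ x, Decidable (p x)] [∀ x, Decidable (q x)]
    (hp : Poly e fun x => decide (p x)) (hq : Poly e fun x => decide (q x)) :
    Poly e (fun x => decide (p x ∧ q x)) := by
  simpa using hp.and hq

theorem decOr {p q : X → Prop} [∀ x, Decidable (p x)] [∀ x, Decidable (q x)]
    (hp : Poly e fun x => decide (p x)) (hq : Poly e fun x => decide (q x)) :
    Poly e (fun x => decide (p x ∨ q x)) := by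
  simpa using hp.or hq

theorem listNil : Poly e (fun x => ([] : List (α x))) := PT.nil

theorem listCons {a : ∀ x, α x} {l : ∀ x, List (α x)} (ha : Poly e a) (hl : Poly e l) :
    Poly e (fun x => a x :: l x) := ha.cons hl

theorem isEmpty {l : ∀ x, List (α x)} (hl : Poly e l) : Poly e (fun x => (l x).isEmpty) := by
  refine (hl.eq PT.nil).congr fun x => ?_
  beta_reduce
  cases l x <;> rfl

theorem headD {l : ∀ x, List (α x)} {d : ∀ x, α x} (hl : Poly e l) (hd : Poly e d) :
    Poly e (fun x => (l x).headD (d x)) := by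
  have := PT.iteData (PT.decTrue (PT.isEmpty hl)) hd (PT.hd hl)
  refine this.congr fun x => ?_
  beta_reduce
  cases l x <;> rfl

end Basic

section Fold

variable {α β : X → Type} [∀ x, Enc (α x)] [∀ x, Enc (β x)]

theorem foldl {l : ∀ x, List (α x)} {b₀ : ∀ x, β x} {step : ∀ x, β x → α x → β x}
    (hl : Poly e l) (h₀ : Poly e b₀)
    (hs : ∀ (Y : Type) (e' : Y → Data) (x : Y → X) (b : ∀ y, β (x y)) (a : ∀ y, α (x y)),
      PT e' (fun y => e (x y)) → Poly e' (fun y => b y) → Poly e' (fun y => a y) →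
      Poly e' (fun y => step (x y) (b y) (a y)))
    {k : X → ℕ} (hk : SizeBdd e k)
    (hbd : ∀ x l₁, l₁ <+: l x → (enc (l₁.foldl (step x) (b₀ x))).size ≤ k x) :
    Poly e fun x => (l x).foldl (step x) (b₀ x) :=
  PT.foldl_core (ea := fun _ => enc) (eb := fun _ => enc) hl h₀
    (hs (Σ x, β x × α x) _ (fun p => p.1) (fun p => p.2.1) (fun p => p.2.2) PT.refl.hd PT.refl.tl.hd PT.refl.tl.tl)
    hk hbd

theorem length_bdd {l : ∀ x, List (α x)} (hl : Poly e l) : SizeBdd e (fun x => (l x).length) :=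
  hl.size_bdd.mono fun _ => (Data.length_lt_size_ofList _ _).le

/-- Folds in which every step adds a bounded amount to the size of the accumulator. -/
theorem foldl_additive {l : ∀ x, List (α x)} {b₀ : ∀ x, β x} {step : ∀ x, β x → α x → β x}
    (hl : Poly e l) (h₀ : Poly e b₀)
    (hs : ∀ (Y : Type) (e' : Y → Data) (x : Y → X) (b : ∀ y, β (x y)) (a : ∀ y, α (x y)),
      PT e' (fun y => e (x y)) → Poly e' (fun y => b y) → Poly e' (fun y => a y) →
      Poly e' (fun y => step (x y) (b y) (a y)))
    {k : X → ℕ} (hk : SizeBdd e k)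
    (hbd : ∀ x b, ∀ a ∈ l x, (enc (step x b a)).size ≤ (enc b).size + k x) :
    Poly e fun x => (l x).foldl (step x) (b₀ x) := by
  refine PT.foldl hl h₀ hs (h₀.size_bdd.add ((length_bdd hl).mul hk)) fun x l₁ h => ?_
  have key : (enc (l₁.foldl (step x) (b₀ x))).size ≤ (enc (b₀ x)).size + l₁.length * k x := by
    have hm : ∀ a ∈ l₁, a ∈ l x := fun a ha => h.subset ha
    clear h
    induction l₁ using List.reverseRecOn with
    | nil => simp
    | append_singleton l₁ a ih =>
      have h1 := ih fun a ha => hm a (by simp [ha])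
      have h2 := hbd x (l₁.foldl (step x) (b₀ x)) a (hm a (by simp))
      rw [List.foldl_append, List.length_append, Nat.add_mul]
      simp only [List.foldl_cons, List.foldl_nil, List.length_cons, List.length_nil]
      omega
  exact key.trans (Nat.add_le_add_left (Nat.mul_le_mul_right _ h.length_le) _)

theorem reverse {l : ∀ x, List (α x)} (hl : Poly e l) : Poly e (fun x => (l x).reverse) := by
  have := PT.foldl_additive (β := fun x => List (α x)) (b₀ := fun _ => [])
    (step := fun _ b a => a :: b) hl PT.listNil
    (fun Y e' x b a _ hb ha => PT.listCons ha hb) (hl.size_bdd.add (.const 1))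
    (fun x b a ha => by
      have : (enc a).size < (enc (l x)).size := Data.size_lt_size_ofList _ ha
      change (enc a).size + (enc b).size + 1 ≤ _
      omega)
  refine congrEnc this fun x => ?_
  simp

theorem append {l m : ∀ x, List (α x)} (hl : Poly e l) (hm : Poly e m) :
    Poly e (fun x => l x ++ m x) := by
  have := PT.foldl_additive (β := fun x => List (α x)) (b₀ := m)
    (step := fun _ b a => a :: b) (reverse hl) hm
    (fun Y e' x b a _ hb ha => PT.listCons ha hb) (hl.size_bdd.add (.const 1))
    (fun x b a ha => by
      have : (enc a).size < (enc (l x)).size := Data.size_lt_size_ofList _ (List.mem_reverse.1 ha)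
      change (enc a).size + (enc b).size + 1 ≤ _
      omega)
  refine congrEnc this fun x => ?_
  simp

/-- Running the step in the generic context of pairs (input, element) gives one polynomial for all
elements, and an element of the list has a smaller code than the list. -/
theorem step_bdd {l : ∀ x, List (α x)} {f : ∀ x, α x → β x} (hl : Poly e l) (hf : PolyStep e f) :
    ∃ k : X → ℕ, SizeBdd e k ∧ ∀ x, ∀ a ∈ l x, (enc (f x a)).size ≤ k x := by
  obtain ⟨q, hq⟩ := PT.size_bdd (hf (Σ x, α x) (fun p => Data.cons (e p.1) (enc p.2)) (fun p => p.1)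
    (fun p => p.2) PT.refl.hd PT.refl.tl)
  refine ⟨fun x => q.eval ((e x).size + (enc (l x)).size + 1),
    ((PolyBdd.self.add hl.size_bdd).add (.const 1)).trans ⟨q, fun _ => le_rfl⟩, fun x a ha => ?_⟩
  refine (hq ⟨x, a⟩).trans (polyEval_mono q ?_)
  have : (enc a).size < (enc (l x)).size := Data.size_lt_size_ofList _ ha
  simp only [Data.size]; omega

theorem flatMap {l : ∀ x, List (α x)} {f : ∀ x, α x → List (β x)} (hl : Poly e l)
    (hf : PolyStep e f) : Poly e (fun x => (l x).flatMap (f x)) := by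
  obtain ⟨k, hk, hbd⟩ := step_bdd hl hf
  have := PT.foldl_additive (β := fun x => List (β x)) (b₀ := fun _ => [])
    (step := fun x b a => b ++ f x a) hl PT.listNil
    (fun Y e' x b a he hb ha => PT.append hb (hf Y e' x a he ha)) hk
    (fun x b a ha => by
      have h1 := hbd x a ha
      have h2 : (enc (b ++ f x a)).size + 1 = (enc b).size + (enc (f x a)).size :=
        Data.size_ofList_append _ _ _
      omega)
  refine congrEnc this fun x => ?_
  rw [← List.flatMap_eq_foldl]

theorem map {l : ∀ x, List (α x)} {f : ∀ x, α x → β x} (hl : Poly e l)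
    (hf : PolyStep e f) : Poly e (fun x => (l x).map (f x)) := by
  have := PT.flatMap hl (f := fun x a => [f x a])
    (fun Y e' x a he ha => PT.listCons (hf Y e' x a he ha) PT.listNil)
  refine congrEnc this fun x => ?_
  rw [List.map_eq_flatMap]

theorem filter {l : ∀ x, List (α x)} {p : ∀ x, α x → Bool} (hl : Poly e l)
    (hp : PolyStep e p) : Poly e (fun x => (l x).filter (p x)) := by
  have := PT.flatMap hl (f := fun x a => if p x a = true then [a] else [])
    (fun Y e' x a he ha => PT.ite (PT.decTrue (hp Y e' x a he ha)) (PT.listCons ha PT.listNil)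
      PT.listNil)
  refine congrEnc this fun x => ?_
  induction l x with
  | nil => rfl
  | cons a l ih => by_cases h : p x a <;> simp [h, ih]

theorem any {l : ∀ x, List (α x)} {p : ∀ x, α x → Bool} (hl : Poly e l)
    (hp : PolyStep e p) : Poly e (fun x => (l x).any (p x)) := by
  have := PT.not (PT.isEmpty (PT.filter hl hp))
  refine congrEnc this fun x => ?_
  rw [Bool.eq_iff_iff]
  simp

theorem all {l : ∀ x, List (α x)} {p : ∀ x, α x → Bool} (hl : Poly e l)
    (hp : PolyStep e p) : Poly e (fun x => (l x).all (p x)) := by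
  have := PT.not (PT.any hl (p := fun x a => !p x a)
    (fun Y e' x a he ha => PT.not (hp Y e' x a he ha)))
  refine congrEnc this fun x => ?_
  rw [Bool.eq_iff_iff]
  simp

theorem mem {l : ∀ x, List (α x)} {a : ∀ x, α x} [∀ x, Decidable (a x ∈ l x)] (hl : Poly e l)
    (ha : Poly e a) : Poly e (fun x => decide (a x ∈ l x)) := by
  classical
  have := PT.any hl (p := fun x b => decide (b = a x))
    (fun Y e' x b he hb => PT.dec hb (ha.lift he))
  refine congrEnc this fun x => ?_
  rw [Bool.eq_iff_iff]
  simp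

end Fold

end PT

/-- The list of the pairs of a proper prefix of `l` and the element that follows it. -/
def splits {α : Type} (l : List α) : List (List α × α) :=
  (l.foldl (fun b a => (b.1 ++ [a], b.2 ++ [(b.1, a)])) (([] : List α), [])).2

theorem splits_foldl_fst {α : Type} (l : List α) :
    (l.foldl (fun b a => (b.1 ++ [a], b.2 ++ [(b.1, a)]))
      (([] : List α), ([] : List (List α × α)))).1 = l := by
  induction l using List.reverseRecOn with
  | nil => rfl
  | append_singleton l a ih => simp [ih]

@[simp]
theorem splits_nil {α : Type} : splits ([] : List α) = [] := rfl

theorem splits_append_singleton {α : Type} (l : List α) (a : α) :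
    splits (l ++ [a]) = splits l ++ [(l, a)] := by
  have := splits_foldl_fst l
  simp [splits, List.foldl_append, this]

theorem mem_splits {α : Type} {l p : List α} {a : α} :
    (p, a) ∈ splits l ↔ ∃ s, l = p ++ a :: s := by
  induction l using List.reverseRecOn generalizing p a with
  | nil => simp [splits_nil]
  | append_singleton l b ih =>
    rw [splits_append_singleton, List.mem_append, ih]
    constructor
    · rintro (⟨s, rfl⟩ | h)
      · exact ⟨s ++ [b], by simp⟩
      · simp only [List.mem_singleton, Prod.mk.injEq] at h
        exact ⟨[], by simp [h]⟩
    · rintro ⟨s, hs⟩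
      rcases List.eq_nil_or_concat s with rfl | ⟨s, c, rfl⟩
      · have := List.append_inj' hs (by simp)
        simp at this
        simp [this]
      · left
        refine ⟨s, ?_⟩
        have h2 : l ++ [b] = (p ++ a :: s) ++ [c] := by simpa using hs
        exact (List.append_inj' h2 (by simp)).1

theorem length_splits {α : Type} (l : List α) : (splits l).length = l.length := by
  induction l using List.reverseRecOn with
  | nil => rfl
  | append_singleton l b ih => simp [splits_append_singleton, ih]

/-- `foldl_additive` does not apply: it bounds a step for arbitrary accumulators, and this step
copies the first component into the second. The bound uses that the first component is always a
prefix of the list. -/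
theorem PT.splits {X : Type} {e : X → Data} {α : X → Type} [∀ x, Enc (α x)]
    {l : ∀ x, List (α x)} (hl : Poly e l) : Poly e (fun x => splits (l x)) := by
  refine PT.snd (PT.foldl (β := fun x => List (α x) × List (List (α x) × α x))
    (b₀ := fun _ => ([], [])) (k := fun x => (enc (l x)).size + 1 +
      ((l x).length * ((enc (l x)).size + (enc (l x)).size + 1 + 1) + 1))
    hl (PT.pair PT.listNil PT.listNil) ?_ ?_ ?_)
  · intro Y e' x b a he hb ha
    exact PT.pair (PT.append (PT.fst hb) (PT.listCons ha PT.listNil))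
      (PT.append (PT.snd hb) (PT.listCons (PT.pair (PT.fst hb) ha) PT.listNil))
  · have := PT.length_bdd hl
    have h2 := hl.size_bdd
    exact (h2.add (.const 1)).add ((this.mul (((h2.add h2).add (.const 1)).add (.const 1))).add
      (.const 1))
  · intro x l₁ h
    obtain ⟨l₂, h⟩ := h
    have hsz : ∀ p s : List (α x), l x = p ++ s → (enc p).size ≤ (enc (l x)).size := by
      intro p s hps
      have := Data.size_ofList_append (enc (α := α x)) p s
      have h3 := (Data.ofList (enc (α := α x)) s).size_pos
      rw [hps]
      change (Data.ofList _ _).size ≤ (Data.ofList _ _).size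
      omega
    have h1 : (enc (OrderedCDCL.splits l₁)).size ≤
        (OrderedCDCL.splits l₁).length * ((enc (l x)).size + (enc (l x)).size + 1 + 1) + 1 := by
      refine Data.size_ofList_le _ _ _ ?_
      rintro ⟨p, a⟩ hp
      obtain ⟨s, rfl⟩ := mem_splits.1 hp
      have h4 := hsz p (a :: s ++ l₂) (by rw [← h]; simp)
      have h5 : (enc a).size < (enc (l x)).size := Data.size_lt_size_ofList _ (by rw [← h]; simp)
      change (enc p).size + (enc a).size + 1 ≤ _
      omega
    rw [length_splits] at h1
    have h6 : l₁.length ≤ (l x).length := by rw [← h]; simp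
    have h7 := Nat.mul_le_mul_right ((enc (l x)).size + (enc (l x)).size + 1 + 1) h6
    have h8 := hsz l₁ l₂ h.symm
    rw [← Prod.mk.eta (p := List.foldl _ _ l₁), splits_foldl_fst]
    change (enc l₁).size + (enc (OrderedCDCL.splits l₁)).size + 1 ≤ _
    omega

end OrderedCDCL

/-! ### Numbers, variables, literals and clauses as data -/

namespace OrderedCDCL

open Enc

/-- Lets loops over lists count: a unary number is a list of trivial entries. -/
theorem Data.ofNat_eq_ofList (k : ℕ) :
    Data.ofNat k = enc (List.replicate k Data.nil) := by
  induction k with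
  | zero => rfl
  | succ k ih => rw [Data.ofNat, ih]; rfl

theorem splits_replicate {α : Type} (k : ℕ) (a : α) :
    splits (List.replicate k a) = (List.range k).map fun i => (List.replicate i a, a) := by
  induction k with
  | zero => rfl
  | succ k ih =>
    rw [List.replicate_succ', splits_append_singleton, ih, List.range_succ, List.map_append]
    rfl

theorem Data.iterate_tl_ofList_hd {α : Type} (f : α → Data) (l : List α) (i : ℕ)
    (h : i < l.length) : (Data.tl^[i] (Data.ofList f l)).hd = f l[i] := by
  induction l generalizing i with
  | nil => simp at h
  | cons a l ih =>
    cases i with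
    | zero => rfl
    | succ i =>
      rw [Function.iterate_succ_apply]
      exact ih i (by simpa using h)

theorem Data.foldl_tl_replicate (i : ℕ) (d : Data) :
    (List.replicate i Data.nil).foldl (fun b _ => b.tl) d = Data.tl^[i] d := by
  induction i generalizing d with
  | zero => rfl
  | succ i ih => exact ih d.tl

namespace PT

variable {X : Type} {e : X → Data} {n : X → ℕ}

/-- The proper prefixes of a list of `n x` trivial entries are the codes of the numbers below `n x`.
-/
theorem finRange (hn : Poly e n) : Poly e (fun x => List.finRange (n x)) := by
  have h1 : Poly e (fun x => List.replicate (n x) Data.nil) :=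
    hn.congr fun x => Data.ofNat_eq_ofList _
  have h2 := PT.map (PT.splits h1) (f := fun _ q => enc q.1) (fun Y e' x a _ ha => PT.fst ha)
  refine h2.congr fun x => ?_
  beta_reduce
  rw [splits_replicate, List.map_map]
  have h3 : ∀ l : List (Fin (n x)), enc l = enc (l.map fun i => enc i) := by
    intro l
    induction l with
    | nil => rfl
    | cons a l ih => exact congrArg (Data.cons _) ih
  rw [h3, ← List.map_coe_finRange_eq_range, List.map_map]
  congr 2
  funext i
  exact (Data.ofNat_eq_ofList i).symm

theorem nthData {d : X → Data} {i : X → ℕ} (hd : PT e d) (hi : Poly e i) :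
    PT e (fun x => (Data.tl^[i x] (d x)).hd) := by
  have h1 : Poly e (fun x => List.replicate (i x) Data.nil) :=
    hi.congr fun x => Data.ofNat_eq_ofList _
  have h2 := PT.foldl_additive (β := fun _ => Data) (b₀ := d) (step := fun _ b _ => b.tl) h1 hd
    (fun Y e' x b a _ hb _ => PT.tl hb) (.const 0) (fun x b a _ => Data.size_tl_le b)
  refine (PT.hd h2).congr fun x => ?_
  beta_reduce
  rw [Data.foldl_tl_replicate]
  rfl

theorem nth {α : X → Type} [∀ x, Enc (α x)] {f : ∀ x, Fin (n x) → α x} {i : ∀ x, Fin (n x)}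
    (hf : Poly e fun x => List.ofFn (f x)) (hi : Poly e i) : Poly e fun x => f x (i x) := by
  refine (nthData hf (i := fun x => (i x).val) hi).congr fun x => ?_
  refine (Data.iterate_tl_ofList_hd _ _ _ (by simp)).trans ?_
  simp

section Literal

variable {l : ∀ x, Literal (n x)}

theorem litVar (h : Poly e l) : Poly e fun x => (l x).var := h.hd

theorem litSign (h : Poly e l) : Poly e fun x => (l x).sign := h.tl

theorem litMk {v : ∀ x, Fin (n x)} {b : X → Bool} (hv : Poly e v) (hb : Poly e b) :
    Poly e fun x => (⟨v x, b x⟩ : Literal (n x)) := hv.cons hb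

theorem litNeg (h : Poly e l) : Poly e fun x => (l x).neg :=
  litMk (litVar h) (PT.not (litSign h))

end Literal

end PT

/-- The list of all the literals. -/
def allLits (n : ℕ) : List (Literal n) :=
  (List.finRange n).flatMap fun i => [⟨i, true⟩, ⟨i, false⟩]

theorem mem_allLits {n : ℕ} (l : Literal n) : l ∈ allLits n := by
  obtain ⟨i, b⟩ := l
  cases b <;> simp [allLits]

/-- The list of the literals of a clause. -/
def Clause.lits {n : ℕ} (C : Clause n) : List (Literal n) :=
  (allLits n).filter fun l => decide (l ∈ C.1)

@[simp]
theorem Clause.mem_lits {n : ℕ} {C : Clause n} {l : Literal n} : l ∈ C.lits ↔ l ∈ C.1 := by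
  simp [Clause.lits, mem_allLits]

/-- The clause with the given literals (if they form a clause). -/
def Clause.ofLits {n : ℕ} (L : List (Literal n)) : Clause n :=
  ⟨L.toFinset.filter fun l => l.sign = false → (⟨l.var, true⟩ : Literal n) ∉ L, by
    rintro ⟨i, b⟩ h1 h2
    cases b <;> simp_all [Literal.neg]⟩

@[simp]
theorem Literal.neg_neg {n : ℕ} (l : Literal n) : l.neg.neg = l := by
  simp [Literal.neg]

@[simp]
theorem Literal.neg_var {n : ℕ} (l : Literal n) : l.neg.var = l.var := rfl

theorem Literal.neg_ne {n : ℕ} (l : Literal n) : l.neg ≠ l := by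
  intro h
  have := congrArg Literal.sign h
  simp [Literal.neg] at this

theorem Literal.eq_or_eq_neg {n : ℕ} {l m : Literal n} (h : l.var = m.var) :
    l = m ∨ l = m.neg := by
  obtain ⟨i, a⟩ := l
  obtain ⟨j, b⟩ := m
  obtain rfl : i = j := h
  cases a <;> cases b <;> simp [Literal.neg]

theorem Clause.mem_ofLits {n : ℕ} {L : List (Literal n)} (hL : ∀ l ∈ L, l.neg ∉ L)
    {l : Literal n} : l ∈ (Clause.ofLits L).1 ↔ l ∈ L := by
  obtain ⟨i, b⟩ := l
  simp only [ofLits, Finset.mem_filter, List.mem_toFinset]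
  refine ⟨fun h => h.1, fun h => ⟨h, ?_⟩⟩
  rintro rfl
  exact hL _ h

/-- No consistency of `L` is needed: of two complementary literals both `Clause.ofLits` and the
encoding keep the positive one. -/
theorem Clause.encode_ofLits {n : ℕ} (L : List (Literal n)) :
    (Clause.ofLits L).encode = enc ((List.finRange n).map fun i =>
      if (⟨i, true⟩ : Literal n) ∈ L then 2 else if (⟨i, false⟩ : Literal n) ∈ L then 1 else 0) := by
  rw [Clause.encode, List.ofFn_eq_map]
  refine congrArg (Data.ofList Data.ofNat) (List.map_congr_left fun i _ => ?_)
  by_cases h1 : (⟨i, true⟩ : Literal n) ∈ L <;> by_cases h2 : (⟨i, false⟩ : Literal n) ∈ L <;>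
    simp [ofLits, h1, h2]

namespace PT

variable {X : Type} {e : X → Data} {n : X → ℕ}

theorem memClause {C : ∀ x, Clause (n x)} {l : ∀ x, Literal (n x)} (hC : Poly e C)
    (hl : Poly e l) : Poly e fun x => decide (l x ∈ (C x).1) := by
  -- The entry of the variable decides membership by comparison with 2 or 1, because a clause does
  -- not contain both literals of a variable.
  have h1 := PT.nthData hC (i := fun x => (l x).var.val) (litVar hl)
  have h2 : Poly e fun x => if (l x).sign = true then 2 else 1 :=
    PT.ite (PT.decTrue (litSign hl)) (constEnc 2) (constEnc 1)
  refine (PT.eq h1 h2).congr fun x => congrArg Data.ofBool ?_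
  have h3 : (Data.tl^[(l x).var.val] (enc (C x))).hd = Data.ofNat
      (if ⟨(l x).var, true⟩ ∈ (C x).1 then 2 else if ⟨(l x).var, false⟩ ∈ (C x).1 then 1 else 0) :=
    (Data.iterate_tl_ofList_hd _ _ _ (by simp)).trans (by simp)
  rw [h3, decide_eq_decide]
  change Data.ofNat _ = Data.ofNat _ ↔ _
  rw [Data.ofNat_injective.eq_iff]
  beta_reduce
  have h4 := (C x).2
  obtain ⟨i, b⟩ := l x
  have h5 := h4 ⟨i, true⟩
  simp only [Literal.neg, Bool.not_true] at h5
  cases b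
  · by_cases h : (⟨i, true⟩ : Literal (n x)) ∈ (C x).1
    · simp [h, h5 h]
    · by_cases h' : (⟨i, false⟩ : Literal (n x)) ∈ (C x).1 <;> simp [h, h']
  · by_cases h : (⟨i, true⟩ : Literal (n x)) ∈ (C x).1
    · simp [h]
    · by_cases h' : (⟨i, false⟩ : Literal (n x)) ∈ (C x).1 <;> simp [h, h']

theorem allLits (hn : Poly e n) : Poly e fun x => allLits (n x) :=
  PT.flatMap (PT.finRange hn) (fun _ _ x _ _ ha =>
    PT.listCons (PT.litMk (n := fun y => n (x y)) ha (PT.constEnc true))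
      (PT.listCons (PT.litMk (n := fun y => n (x y)) ha (PT.constEnc false)) PT.listNil))

theorem lits {C : ∀ x, Clause (n x)} (hn : Poly e n) (hC : Poly e C) :
    Poly e fun x => (C x).lits :=
  PT.filter (PT.allLits hn) (fun _ _ x _ he ha =>
    PT.memClause (n := fun y => n (x y)) (hC.lift he) ha)

theorem ofLits {L : ∀ x, List (Literal (n x))} (hn : Poly e n) (hL : Poly e L) :
    Poly e fun x => Clause.ofLits (L x) := by
  have := PT.map (PT.finRange hn) (f := fun x i => if (⟨i, true⟩ : Literal (n x)) ∈ L x then 2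
      else if (⟨i, false⟩ : Literal (n x)) ∈ L x then 1 else 0) (fun Y e' x a he ha => by
    have hL' := hL.lift he
    have key : ∀ b : Bool, Poly e' fun y => decide ((⟨a y, b⟩ : Literal (n (x y))) ∈ L (x y)) :=
      fun b => PT.mem hL' (PT.litMk (n := fun y => n (x y)) ha (PT.constEnc b))
    exact PT.ite (key true) (constEnc 2) (PT.ite (key false) (constEnc 1) (constEnc 0)))
  exact this.congr fun x => (Clause.encode_ofLits _).symm

end PT

end OrderedCDCL

namespace OrderedCDCL

/-! ### Derivations as lists of justified clauses -/

/-- `C` belongs to `τ` or is a resolvent of members of `Q`. -/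
def Justified {n : ℕ} (side : Literal n → Clause n → Prop) (τ : CNF n) (Q : List (Clause n))
    (C : Clause n) : Prop :=
  C ∈ τ ∨ ∃ E ∈ Q, ∃ F ∈ Q, ∃ l, IsResolvent E F l C ∧ side l C

section Derivation

variable {n : ℕ} {side : Literal n → Clause n → Prop} {τ : CNF n}

theorem Justified.mono {Q Q' : List (Clause n)} {C : Clause n} (h : Justified side τ Q C)
    (hQ : Q ⊆ Q') : Justified side τ Q' C := by
  rcases h with h | ⟨E, hE, F, hF, l, h⟩
  · exact .inl h
  · exact .inr ⟨E, hQ hE, F, hQ hF, l, h⟩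

theorem isDerivation_iff {P : List (Clause n)} :
    IsDerivation side τ P ↔ ∀ Q C S, P = Q ++ C :: S → Justified side τ Q C := by
  constructor
  · rintro h Q C S rfl
    have hlen : Q.length < (Q ++ C :: S).length := by simp
    have hget : ∀ (i : ℕ) (hi : i < Q.length), (Q ++ C :: S)[i]'(hi.trans hlen) = Q[i] :=
      fun i hi => List.getElem_append_left hi
    have hC : (Q ++ C :: S)[Q.length]'hlen = C := by simp
    rcases h Q.length hlen with h | ⟨i, j, hi, hj, l, h, h'⟩
    · exact .inl (by rwa [hC] at h)
    · rw [hget i hi, hget j hj, hC] at h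
      rw [hC] at h'
      exact .inr ⟨_, List.getElem_mem hi, _, List.getElem_mem hj, l, h, h'⟩
  · intro h k hk
    have hsplit : P = P.take k ++ P[k] :: P.drop (k + 1) := by
      rw [List.cons_getElem_drop_succ, List.take_append_drop]
    rcases h _ _ _ hsplit with h | ⟨E, hE, F, hF, l, h⟩
    · exact .inl h
    · obtain ⟨i, hi, rfl⟩ := List.getElem_of_mem hE
      obtain ⟨j, hj, rfl⟩ := List.getElem_of_mem hF
      rw [List.length_take] at hi hj
      refine .inr ⟨i, j, by omega, by omega, l, ?_⟩
      simpa using h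

theorem IsDerivation.justified {P : List (Clause n)} (h : IsDerivation side τ P) {C : Clause n}
    (hC : C ∈ P) : Justified side τ P C := by
  obtain ⟨Q, S, rfl⟩ := List.append_of_mem hC
  exact (isDerivation_iff.1 h Q C S rfl).mono (by simp)

theorem isDerivation_nil : IsDerivation side τ [] := by
  intro k hk
  simp at hk

theorem IsDerivation.append {P R : List (Clause n)} (h : IsDerivation side τ P)
    (hR : ∀ C ∈ R, Justified side τ P C) : IsDerivation side τ (P ++ R) := by
  rw [isDerivation_iff] at h ⊢
  intro Q C S hQ
  rcases List.append_eq_append_iff.1 hQ with ⟨A, rfl, hA⟩ | ⟨A, rfl, hA⟩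
  · exact (hR C (by simp [hA])).mono (by simp)
  · cases A with
    | nil =>
      simp only [List.nil_append] at hA
      exact (hR C (by simp [← hA])).mono (by simp)
    | cons B A =>
      simp only [List.cons_append, List.cons.injEq] at hA
      obtain ⟨rfl, -⟩ := hA
      exact h Q C A rfl

end Derivation

/-! ### The variables in increasing order -/

/-- The variables in increasing order. -/
def varOrder {n : ℕ} (π : Equiv.Perm (Fin n)) : List (Fin n) := (List.finRange n).map π.symm

section VarOrder

variable {n : ℕ} {π : Equiv.Perm (Fin n)}

theorem mem_varOrder (x : Fin n) : x ∈ varOrder π := by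
  simp only [varOrder, List.mem_map]
  exact ⟨π x, by simp, by simp⟩

theorem nodup_varOrder : (varOrder π).Nodup :=
  (List.nodup_finRange n).map π.symm.injective

theorem length_varOrder : (varOrder π).length = n := by simp [varOrder]

theorem pairwise_varOrder : (varOrder π).Pairwise fun x y => π x < π y := by
  rw [varOrder, List.pairwise_map]
  simpa using List.sortedLT_finRange n |>.pairwise

/-- Translates the side condition of ordered resolution into membership in an initial segment of
`varOrder π`. -/
theorem mem_prefix_varOrder {us ws : List (Fin n)} {w : Fin n} (h : varOrder π = us ++ w :: ws)
    {y : Fin n} : y ∈ us ↔ π y < π w := by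
  have h1 := pairwise_varOrder (π := π)
  rw [h, List.pairwise_append, List.pairwise_cons] at h1
  refine ⟨fun hy => h1.2.2 y hy w (by simp), fun hy => ?_⟩
  have h2 := mem_varOrder (π := π) y
  rw [h, List.mem_append, List.mem_cons] at h2
  rcases h2 with h2 | rfl | h2
  · exact h2
  · exact absurd hy (lt_irrefl _)
  · exact absurd hy (h1.2.1.1 y h2).not_gt

end VarOrder

/-! ### From half-ordered derivations with weakening to ordered refutations -/

/-- A sequence of literals, read as a disjunction. -/
abbrev Line (n : ℕ) : Type := List (Literal n)

/-- The line `L` follows from `τ` and the lines in `Q`: all the literals of some line can be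
removed or found in `L`, where a literal `l` is removed with the help of a line that consists
of the complement of `l` and of literals of `L` that are smaller than `l`. -/
def HalfJustified {n : ℕ} (π : Equiv.Perm (Fin n)) (τ : List (Clause n)) (Q : List (Line n))
    (L : Line n) : Prop :=
  ∃ C : Line n, (C ∈ Q ∨ ∃ D ∈ τ, C = D.lits) ∧ ∀ l ∈ C, l ∈ L ∨
    ∃ N ∈ Q, l.neg ∈ N ∧ ∀ m ∈ N, m ≠ l.neg → m ∈ L ∧ π m.var < π l.var

/-- Every line follows from `τ` and the preceding lines. -/
def IsHalfDerivation {n : ℕ} (π : Equiv.Perm (Fin n)) (τ : List (Clause n))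
    (P : List (Line n)) : Prop :=
  ∀ Q L S, P = Q ++ L :: S → HalfJustified π τ Q L

/-- The line `M` contains `l`, and its other literals are in `T`. -/
def sideLine {n : ℕ} (M : Line n) (l : Literal n) (T : Line n) : Bool :=
  decide (l ∈ M) && M.all fun m => decide (m = l) || decide (m ∈ T)

theorem sideLine_iff {n : ℕ} {M : Line n} {l : Literal n} {T : Line n} :
    sideLine M l T = true ↔ l ∈ M ∧ ∀ m ∈ M, m = l ∨ m ∈ T := by
  simp [sideLine]

/-- The literals known to be false after the variables `us` have been read, when the search for
a falsified clause looks for a reason of the line `L`, and `B` are the lines before `L`. -/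
def levelLits {n : ℕ} (B : List (Line n)) (L : Line n) (us : List (Fin n)) : Line n :=
  us.foldl (fun T w => T ++ [(⟨w, true⟩ : Literal n), ⟨w, false⟩].filter fun l =>
    decide (l ∈ L) || B.any fun M => sideLine M l.neg T) []

section LevelLits

variable {n : ℕ} {B B' : List (Line n)} {L M : Line n} {us ws : List (Fin n)} {w : Fin n}
  {l : Literal n}

theorem mem_levelLits_append_singleton :
    l ∈ levelLits B L (us ++ [w]) ↔ l ∈ levelLits B L us ∨
      l.var = w ∧ (l ∈ L ∨ ∃ M ∈ B, sideLine M l.neg (levelLits B L us) = true) := by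
  obtain ⟨v, b⟩ := l
  simp only [levelLits, List.foldl_append, List.foldl_cons, List.foldl_nil, List.mem_append,
    List.mem_filter, List.mem_cons, Literal.mk.injEq, List.not_mem_nil, or_false,
    Bool.or_eq_true, decide_eq_true_eq, List.any_eq_true]
  cases b <;> simp

theorem var_mem_of_mem_levelLits (h : l ∈ levelLits B L us) : l.var ∈ us := by
  induction us using List.reverseRecOn with
  | nil => simp [levelLits] at h
  | append_singleton us w ih =>
    rcases mem_levelLits_append_singleton.1 h with h | ⟨rfl, -⟩
    · simp [ih h]
    · simp

theorem levelLits_subset_append : levelLits B L us ⊆ levelLits B L (us ++ ws) := by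
  induction ws using List.reverseRecOn with
  | nil => simp
  | append_singleton ws w ih =>
    intro l hl
    rw [← List.append_assoc, mem_levelLits_append_singleton]
    exact .inl (ih hl)

theorem mem_levelLits_of_mem (hl : l ∈ L) (hv : l.var ∈ us) : l ∈ levelLits B L us := by
  obtain ⟨us, ws, rfl⟩ := List.append_of_mem hv
  have : l ∈ levelLits B L (us ++ [l.var]) :=
    mem_levelLits_append_singleton.2 (.inr ⟨rfl, .inl hl⟩)
  have := levelLits_subset_append (ws := ws) this
  simpa using this

theorem sideLine_mono {T T' : Line n} (h : sideLine M l T = true) (hT : T ⊆ T') :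
    sideLine M l T' = true := by
  rw [sideLine_iff] at h ⊢
  exact ⟨h.1, fun m hm => (h.2 m hm).imp_right fun h => hT h⟩

/-- Allows the search to move from `L` to an earlier line `M` that is already false: any reason
available there is also available at `L`. Since `us` has no repetitions, a literal with variable in
`us` is not added when a later variable `w` is read. -/
theorem levelLits_mono (hB : B' ⊆ B) (hus : us.Nodup)
    (hM : ∀ m ∈ M, m.var ∈ us → m ∈ levelLits B L us) :
    levelLits B' M us ⊆ levelLits B L us := by
  induction us using List.reverseRecOn with
  | nil => simp [levelLits]
  | append_singleton us w ih =>
    have hw : w ∉ us := by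
      rw [List.nodup_append] at hus
      intro h
      exact hus.2.2 w h w (by simp) rfl
    have ih := ih (List.Nodup.of_append_left hus) fun m hm hv => by
      rcases mem_levelLits_append_singleton.1 (hM m hm (by simp [hv])) with h | ⟨h, -⟩
      · exact h
      · exact absurd (h ▸ hv) hw
    intro l hl
    rcases mem_levelLits_append_singleton.1 hl with h | ⟨h, h' | ⟨N, hN, h'⟩⟩
    · exact mem_levelLits_append_singleton.2 (.inl (ih h))
    · exact hM l h' (by simp [h])
    · exact mem_levelLits_append_singleton.2
        (.inr ⟨h, .inr ⟨N, hB hN, sideLine_mono h' ih⟩⟩)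

/-- When all the variables have been read, a clause of `τ` is falsified. -/
theorem exists_subset_levelLits {π : Equiv.Perm (Fin n)} {τ : List (Clause n)} {P S : List (Line n)}
    (hP : IsHalfDerivation π τ P) (h : P = B ++ L :: S) :
    ∃ C ∈ τ, ∀ l ∈ C.1, l ∈ levelLits B L (varOrder π) := by
  induction hk : B.length using Nat.strong_induction_on generalizing B L S with
  | _ k ih =>
    obtain ⟨C, hC, hl⟩ := hP B L S h
    have key : ∀ l ∈ C, l ∈ levelLits B L (varOrder π) := by
      intro l hlC
      rcases hl l hlC with hl | ⟨N, hN, hl, hm⟩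
      · exact mem_levelLits_of_mem hl (mem_varOrder _)
      · obtain ⟨us, ws, hv⟩ := List.append_of_mem (mem_varOrder (π := π) l.var)
        -- The other literals of `N` are in `L` and smaller than `l`, so they are known to be false
        -- before `l.var` is read, and `N` then forces `l` to be false.
        have h1 : l ∈ levelLits B L (us ++ [l.var]) := by
          refine mem_levelLits_append_singleton.2 (.inr ⟨rfl, .inr ⟨N, hN, ?_⟩⟩)
          refine sideLine_iff.2 ⟨hl, fun m hmN => ?_⟩
          by_cases hml : m = l.neg
          · exact .inl hml
          · obtain ⟨h1, h2⟩ := hm m hmN hml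
            exact .inr (mem_levelLits_of_mem h1 ((mem_prefix_varOrder hv).2 h2))
        have := levelLits_subset_append (ws := ws) h1
        rw [hv]
        simpa using this
    -- If `C` is an earlier line, it is false now, and the clause of `τ` found for `C` serves for
    -- `L` as well.
    rcases hC with hC | ⟨D, hD, rfl⟩
    · obtain ⟨B₁, B₂, rfl⟩ := List.append_of_mem hC
      obtain ⟨D, hD, hD'⟩ := ih B₁.length (by simp [← hk]) (B := B₁) (L := C)
        (S := B₂ ++ L :: S) (by simp [h]) rfl
      refine ⟨D, hD, fun l hl => levelLits_mono (by simp) nodup_varOrder ?_ (hD' l hl)⟩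
      exact fun m hm _ => key m hm
    · exact ⟨D, hD, fun l hl => key l (by simpa using hl)⟩

end LevelLits

/-- The literals of the resolvent of `E` and `F` on the variable `w`. -/
def resLits {n : ℕ} (w : Fin n) (E F : Clause n) : Line n :=
  (E.lits.filter fun l => !decide (l = ⟨w, true⟩)) ++
    (F.lits.filter fun l => !decide (l = ⟨w, false⟩))

/-- A clause from which `w` has been removed: one of `E`, `F` if possible, or else their resolvent
(if it is a clause in the variables `us`). -/
def mergeClauses {n : ℕ} (us : List (Fin n)) (w : Fin n) (E F : Clause n) : Clause n :=
  if (⟨w, true⟩ : Literal n) ∈ E.1 then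
    if (⟨w, false⟩ : Literal n) ∈ F.1 then
      if (resLits w E F).all fun l => !decide (l.neg ∈ resLits w E F) && decide (l.var ∈ us) then
        Clause.ofLits (resLits w E F)
      else E
    else F
  else E

theorem mem_resLits {n : ℕ} {w : Fin n} {E F : Clause n} {l : Literal n} :
    l ∈ resLits w E F ↔ (l ∈ E.1 ∧ l ≠ ⟨w, true⟩) ∨ (l ∈ F.1 ∧ l ≠ ⟨w, false⟩) := by
  simp [resLits]

theorem isResolvent_ofLits_resLits {n : ℕ} {w : Fin n} {E F : Clause n}
    (hE : (⟨w, true⟩ : Literal n) ∈ E.1) (hF : (⟨w, false⟩ : Literal n) ∈ F.1)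
    (h : ∀ l ∈ resLits w E F, l.neg ∉ resLits w E F) :
    IsResolvent E F ⟨w, true⟩ (Clause.ofLits (resLits w E F)) := by
  refine ⟨hE, hF, ?_⟩
  ext l
  rw [Clause.mem_ofLits h, mem_resLits]
  simp [Literal.neg, and_comm]

/-- The entry of a row to which the search proceeds if the literal `l` is false. -/
def searchTarget {n : ℕ} (T : Line n) (B : List (Line n × Clause n)) (c : Line n × Clause n)
    (l : Literal n) : Line n × Clause n :=
  (B.filter fun q => sideLine q.1 l T).headD c

/-- The row of the level `us`, given the row of the level `us ++ [w]`. -/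
def nextRow {n : ℕ} (us : List (Fin n)) (w : Fin n) (row : List (Line n × Clause n)) :
    List (Line n × Clause n) :=
  (splits row).map fun q =>
    (q.2.1, mergeClauses us w
      (searchTarget (levelLits (q.1.map Prod.fst) q.2.1 us) q.1 q.2 ⟨w, true⟩).2
      (searchTarget (levelLits (q.1.map Prod.fst) q.2.1 us) q.1 q.2 ⟨w, false⟩).2)

/-- The row of the level of all the variables. -/
def initRow {n : ℕ} (vs : List (Fin n)) (τ : List (Clause n)) (P : List (Line n)) :
    List (Line n × Clause n) :=
  (splits P).map fun q => (q.2, (τ.filter fun C =>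
    C.lits.all fun l => decide (l ∈ levelLits q.1 q.2 vs)).headD (τ.headD (Clause.zero n)))

/-- The rows of all the levels, those of the initial segments of `us` on top of `rs`. -/
def allRows {n : ℕ} (us : List (Fin n)) (rs : List (List (Line n × Clause n))) :
    List (List (Line n × Clause n)) :=
  (splits us).reverse.foldl (fun rs q => nextRow q.1 q.2 (rs.headD []) :: rs) rs

/-- The clauses of the rows, from the last row to the first one. -/
def rowClauses {n : ℕ} (rs : List (List (Line n × Clause n))) : List (Clause n) :=
  rs.reverse.flatMap fun row => row.map Prod.snd

/-- The ordered refutation obtained from a half-ordered derivation `P`. -/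
def orderedOfHalf {n : ℕ} (vs : List (Fin n)) (τ : List (Clause n)) (P : List (Line n)) :
    List (Clause n) :=
  rowClauses (allRows vs [initRow vs τ P])

theorem map_splits_eq {α β : Type} {f : List α × α → β} {l : List α} {B S : List β} {c : β}
    (h : (splits l).map f = B ++ c :: S) :
    ∃ Q a R, l = Q ++ a :: R ∧ B = (splits Q).map f ∧ c = f (Q, a) := by
  induction l using List.reverseRecOn generalizing S with
  | nil => simp [splits_nil] at h
  | append_singleton l a ih =>
    rw [splits_append_singleton, List.map_append, List.map_singleton] at h
    rcases List.eq_nil_or_concat S with rfl | ⟨S, d, rfl⟩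
    · obtain ⟨h1, h2⟩ := List.append_inj' h (by simp)
      exact ⟨l, a, [], rfl, h1.symm, by simpa using h2.symm⟩
    · have h2 : (splits l).map f ++ [f (l, a)] = (B ++ c :: S) ++ [d] := by simpa using h
      obtain ⟨Q, b, R, rfl, h3, h4⟩ := ih (List.append_inj' h2 (by simp)).1
      exact ⟨Q, b, R ++ [a], by simp, h3, h4⟩

theorem map_snd_splits {α : Type} (l : List α) : (splits l).map Prod.snd = l := by
  induction l using List.reverseRecOn with
  | nil => rfl
  | append_singleton l a ih => simp [splits_append_singleton, ih]

section Rows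

variable {n : ℕ} {π : Equiv.Perm (Fin n)} {τ : List (Clause n)} {P : List (Line n)}
  {us : List (Fin n)} {w : Fin n}

/-- The clauses of the row of the level `us` contain only literals known to be false. -/
def RowSound (us : List (Fin n)) (row : List (Line n × Clause n)) : Prop :=
  ∀ B c S, row = B ++ c :: S →
    (∀ l ∈ c.1, l ∈ levelLits (B.map Prod.fst) c.1 us) →
    (∀ l ∈ levelLits (B.map Prod.fst) c.1 us, l.neg ∉ levelLits (B.map Prod.fst) c.1 us) →
    ∀ l ∈ c.2.1, l ∈ levelLits (B.map Prod.fst) c.1 us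

theorem map_fst_nextRow (row : List (Line n × Clause n)) :
    (nextRow us w row).map Prod.fst = row.map Prod.fst := by
  conv_rhs => rw [← map_snd_splits row]
  simp [nextRow, Function.comp_def]

theorem map_fst_initRow (vs : List (Fin n)) : (initRow vs τ P).map Prod.fst = P := by
  conv_rhs => rw [← map_snd_splits P]
  simp [initRow, Function.comp_def]

theorem searchTarget_mem (T : Line n) (B : List (Line n × Clause n)) (c : Line n × Clause n)
    (l : Literal n) : searchTarget T B c l ∈ B ++ [c] := by
  unfold searchTarget
  rcases h : B.filter fun q => sideLine q.1 l T with _ | ⟨q, Q⟩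
  · rw [h, List.headD_nil]
    simp
  · have : q ∈ B.filter fun q => sideLine q.1 l T := by simp [h]
    rw [h, List.headD_cons]
    exact List.mem_append_left _ (List.mem_of_mem_filter this)

theorem List.filter_eq_cons_split {α : Type} {p : α → Bool} {l : List α} {a : α} {r : List α}
    (h : l.filter p = a :: r) :
    ∃ l₁ l₂, l = l₁ ++ a :: l₂ ∧ p a = true ∧ ∀ b ∈ l₁, p b = false := by
  obtain ⟨l₁, l₂, rfl, h1, h2, -⟩ := List.filter_eq_cons_iff.1 h
  exact ⟨l₁, l₂, rfl, h2, fun b hb => by simpa using h1 b hb⟩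

/-- Splitting a row at an entry of the row that is derived from it. -/
theorem nextRow_split {row B S : List (Line n × Clause n)} {c : Line n × Clause n}
    (h : nextRow us w row = B ++ c :: S) :
    ∃ B' c' S', row = B' ++ c' :: S' ∧ B.map Prod.fst = B'.map Prod.fst ∧ c.1 = c'.1 ∧
      c.2 = mergeClauses us w
        (searchTarget (levelLits (B'.map Prod.fst) c'.1 us) B' c' ⟨w, true⟩).2
        (searchTarget (levelLits (B'.map Prod.fst) c'.1 us) B' c' ⟨w, false⟩).2 := by
  obtain ⟨B', c', S', hr, rfl, rfl⟩ := map_splits_eq h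
  exact ⟨B', c', S', hr, map_fst_nextRow (us := us) (w := w) B', rfl, rfl⟩

/-- Let `T` be false and let the query of `w` make the literal `⟨w, b⟩` false. The target is the
first line falsified by this, or the current line if there is none. No line before the target then
forces `⟨w, b⟩` to be true, so at the next level only `T` and `⟨w, b⟩` are known to be false. Hence
the two clauses found there contain, besides literals of `T`, at most opposite literals of `w`, and
merging them leaves a clause within `T`. -/
theorem nextRow_sound {row : List (Line n × Clause n)} (hus : (us ++ [w]).Nodup)
    (hrow : RowSound (us ++ [w]) row) : RowSound us (nextRow us w row) := by
  intro B c S h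
  obtain ⟨B', c', S', hr, hB, hc, hc2⟩ := nextRow_split h
  rw [hB, hc, hc2]
  clear hB hc hc2 h
  have hus' : us.Nodup := List.Nodup.of_append_left hus
  have hw : w ∉ us := by
    rw [List.nodup_append] at hus
    intro h
    exact hus.2.2 w h w (by simp) rfl
  set T := levelLits (B'.map Prod.fst) c'.1 us with hT
  intro hcT hcons
  have hTus : ∀ l ∈ T, l.var ∈ us := fun l hl => var_mem_of_mem_levelLits hl
  have key : ∀ b : Bool, ∀ l ∈ (searchTarget T B' c' ⟨w, b⟩).2.1, l ∈ T ∨ l = ⟨w, b⟩ := by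
    intro b
    -- `T` is consistent and does not mention `w`, so one literal of `w` can be added to it.
    have hcons' : ∀ T' : Line n, (∀ l ∈ T', l ∈ T ∨ l = ⟨w, b⟩) → ∀ l ∈ T', l.neg ∉ T' := by
      intro T' hT' l hl hl'
      rcases hT' l hl with h | rfl <;> rcases hT' _ hl' with h' | h'
      · exact hcons l h h'
      · exact hw (by simpa [h'] using congrArg (· ∈ us) (congrArg Literal.var h') ▸ hTus l h)
      · exact hw (hTus _ h')
      · exact Literal.neg_ne _ h'
    unfold searchTarget
    rcases hf : B'.filter fun q => sideLine q.1 ⟨w, b⟩ T with _ | ⟨q, Q⟩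
    · rw [hf, List.headD_nil]
      have hsub : ∀ l ∈ levelLits (B'.map Prod.fst) c'.1 (us ++ [w]), l ∈ T ∨ l = ⟨w, b⟩ := by
        intro l hl
        rcases mem_levelLits_append_singleton.1 hl with h | ⟨rfl, h | ⟨M, hM, h⟩⟩
        · exact .inl h
        · exact .inl (hcT l h)
        · right
          obtain ⟨q, hq, rfl⟩ := List.mem_map.1 hM
          rcases Literal.eq_or_eq_neg (l := l) (m := ⟨l.var, b⟩) rfl with h' | h'
          · exact h'
          · exfalso
            have : l.neg = ⟨l.var, b⟩ := by rw [h']; simp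
            rw [this] at h
            exact (List.filter_eq_nil_iff.1 hf q hq) h
      intro l hl
      exact hsub l (hrow B' c' S' hr
        (fun m hm => mem_levelLits_append_singleton.2 (.inl (hcT m hm))) (hcons' _ hsub) l hl)
    -- The search moves to `q`. That no entry of `B₁` passes the test is what excludes the opposite
    -- literal of `w` below.
    · obtain ⟨B₁, B₂, rfl, hq, hB₁⟩ := List.filter_eq_cons_split hf
      rw [hf, List.headD_cons]
      rw [sideLine_iff] at hq
      have hmono : levelLits (B₁.map Prod.fst) q.1 us ⊆ T := by
        refine levelLits_mono (by simp) hus' fun m hm hmv => ?_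
        rcases hq.2 m hm with rfl | h
        · exact absurd hmv hw
        · exact h
      have hsub : ∀ l ∈ levelLits (B₁.map Prod.fst) q.1 (us ++ [w]), l ∈ T ∨ l = ⟨w, b⟩ := by
        intro l hl
        rcases mem_levelLits_append_singleton.1 hl with h | ⟨rfl, h | ⟨M, hM, h⟩⟩
        · exact .inl (hmono h)
        · exact (hq.2 l h).symm
        · right
          obtain ⟨r, hr, rfl⟩ := List.mem_map.1 hM
          rcases Literal.eq_or_eq_neg (l := l) (m := ⟨l.var, b⟩) rfl with h' | h'
          · exact h'
          · exfalso
            have : l.neg = ⟨l.var, b⟩ := by rw [h']; simp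
            rw [this] at h
            have := sideLine_mono h hmono
            rw [hB₁ r hr] at this
            cases this
      intro l hl
      refine hsub l (hrow B₁ q (B₂ ++ c' :: S') (by simp [hr]) (fun m hm => ?_)
        (hcons' _ hsub) l hl)
      refine mem_levelLits_of_mem hm ?_
      rcases hq.2 m hm with rfl | h
      · simp
      · simp [hTus m h]
  have key1 := key true
  have key2 := key false
  generalize (searchTarget T B' c' ⟨w, true⟩).2 = E at *
  generalize (searchTarget T B' c' ⟨w, false⟩).2 = F at *
  intro l
  unfold mergeClauses
  by_cases hE : (⟨w, true⟩ : Literal n) ∈ E.1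
  · by_cases hF : (⟨w, false⟩ : Literal n) ∈ F.1
    · have hR : ∀ l ∈ resLits w E F, l ∈ T := by
        intro l hl
        rcases mem_resLits.1 hl with ⟨h, h'⟩ | ⟨h, h'⟩
        · exact (key1 l h).resolve_right h'
        · exact (key2 l h).resolve_right h'
      have hR' : ∀ l ∈ resLits w E F, l.neg ∉ resLits w E F :=
        fun l hl hl' => hcons l (hR l hl) (hR _ hl')
      -- The test in `mergeClauses` succeeds, so its fallback `E` is not used here.
      have hall : ((resLits w E F).all fun l =>
          !decide (l.neg ∈ resLits w E F) && decide (l.var ∈ us)) = true := by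
        simp only [List.all_eq_true, Bool.and_eq_true, Bool.not_eq_true', decide_eq_false_iff_not,
          decide_eq_true_eq]
        exact fun l hl => ⟨hR' l hl, hTus l (hR l hl)⟩
      rw [if_pos hE, if_pos hF, if_pos hall, Clause.mem_ofLits hR']
      exact hR l
    · rw [if_pos hE, if_neg hF]
      intro hl
      exact (key2 l hl).resolve_right fun h => hF (h ▸ hl)
  · rw [if_neg hE]
    intro hl
    exact (key1 l hl).resolve_right fun h => hE (h ▸ hl)

theorem initRow_sound (hP : IsHalfDerivation π τ P) :
    RowSound (varOrder π) (initRow (varOrder π) τ P) := by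
  intro B c S h _ _ l hl
  obtain ⟨Q, L, R, hT, rfl, rfl⟩ := map_splits_eq h
  have hQ := map_fst_initRow (τ := τ) (P := Q) (varOrder π)
  rw [initRow] at hQ
  rw [hQ]
  dsimp only at hl ⊢
  obtain ⟨C, hC, hC'⟩ := exists_subset_levelLits hP hT
  have hmem : C ∈ τ.filter fun C => C.lits.all fun l =>
      decide (l ∈ levelLits Q L (varOrder π)) := by
    simpa [hC] using hC'
  rcases hf : τ.filter fun C => C.lits.all fun l =>
      decide (l ∈ levelLits Q L (varOrder π)) with _ | ⟨D, Q'⟩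
  · rw [hf] at hmem
    simp at hmem
  · rw [hf, List.headD_cons] at hl
    have : D ∈ τ.filter fun C => C.lits.all fun l =>
      decide (l ∈ levelLits Q L (varOrder π)) := by simp [hf]
    rw [List.mem_filter] at this
    have h6 := this.2
    simp only [List.all_eq_true, Clause.mem_lits, decide_eq_true_eq] at h6
    exact h6 l hl

theorem rowClauses_cons (row : List (Line n × Clause n)) (rs : List (List (Line n × Clause n))) :
    rowClauses (row :: rs) = rowClauses rs ++ row.map Prod.snd := by
  simp [rowClauses]

theorem allRows_append_singleton (rs : List (List (Line n × Clause n))) :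
    allRows (us ++ [w]) rs = allRows us (nextRow us w (rs.headD []) :: rs) := by
  simp [allRows, splits_append_singleton]

/-- The side condition of ordered resolution. -/
abbrev orderedSide (π : Equiv.Perm (Fin n)) (l : Literal n) (R : Clause n) : Prop :=
  ∀ m ∈ R.1, π m.var < π l.var

/-- Thanks to the tests in `mergeClauses` this needs no soundness of the rows: a branch without a
legal resolution repeats a clause that is already derived. -/
theorem justified_mergeClauses {ws : List (Fin n)} (hv : varOrder π = us ++ w :: ws)
    {Q : List (Clause n)} (hQ : IsDerivation (orderedSide π) τ.toFinset Q) {E F : Clause n}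
    (hE : E ∈ Q) (hF : F ∈ Q) :
    Justified (orderedSide π) τ.toFinset Q (mergeClauses us w E F) := by
  unfold mergeClauses
  split_ifs with h1 h2 h3
  · simp only [List.all_eq_true, Bool.and_eq_true, Bool.not_eq_true', decide_eq_false_iff_not,
      decide_eq_true_eq] at h3
    have h4 : ∀ l ∈ resLits w E F, l.neg ∉ resLits w E F := fun l hl => (h3 l hl).1
    refine .inr ⟨E, hE, F, hF, _, isResolvent_ofLits_resLits h1 h2 h4, fun m hm => ?_⟩
    rw [Clause.mem_ofLits h4] at hm
    exact (mem_prefix_varOrder hv).1 (h3 m hm).2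
  · exact hQ.justified hE
  · exact hQ.justified hF
  · exact hQ.justified hE

/-- Rows are produced from the last level down, so removing the last variable of `us` corresponds to
adding one row on top. Every level contributes one clause per line of `P`. -/
theorem allRows_spec {ws : List (Fin n)} (hv : varOrder π = us ++ ws)
    {row : List (Line n × Clause n)} {rs : List (List (Line n × Clause n))}
    (hd : IsDerivation (orderedSide π) τ.toFinset (rowClauses (row :: rs)))
    (hs : RowSound us row) (hP : row.map Prod.fst = P) :
    ∃ row' rs', allRows us (row :: rs) = row' :: rs' ∧
      IsDerivation (orderedSide π) τ.toFinset (rowClauses (row' :: rs')) ∧ RowSound [] row' ∧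
      row'.map Prod.fst = P ∧ (rowClauses (row' :: rs')).length =
        (rowClauses (row :: rs)).length + us.length * P.length := by
  induction us using List.reverseRecOn generalizing ws row rs with
  | nil => exact ⟨row, rs, rfl, hd, hs, hP, by simp⟩
  | append_singleton us w ih =>
    rw [List.append_assoc, List.singleton_append] at hv
    have hnd : (us ++ [w]).Nodup := by
      have := nodup_varOrder (π := π)
      rw [hv, List.append_cons] at this
      exact List.Nodup.of_append_left this
    have hd' : IsDerivation (orderedSide π) τ.toFinset
        (rowClauses (nextRow us w row :: row :: rs)) := by
      rw [rowClauses_cons]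
      refine hd.append fun C hC => ?_
      simp only [nextRow, List.map_map, List.mem_map, Function.comp_apply, Prod.exists] at hC
      obtain ⟨B, L, D, h, rfl⟩ := hC
      obtain ⟨S, hS⟩ := mem_splits.1 h
      have key : ∀ T l, (searchTarget T B (L, D) l).2 ∈ rowClauses (row :: rs) := by
        intro T l
        rw [rowClauses_cons, List.mem_append, List.mem_map]
        refine .inr ⟨_, ?_, rfl⟩
        have := searchTarget_mem T B (L, D) l
        rw [hS, List.append_cons]
        exact List.mem_append_left _ this
      exact justified_mergeClauses hv hd (key _ _) (key _ _)
    obtain ⟨row', rs', h1, h2, h3, h4, h5⟩ := ih hv hd' (nextRow_sound hnd hs)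
      (by rw [map_fst_nextRow, hP])
    refine ⟨row', rs', ?_, h2, h3, h4, ?_⟩
    · rw [allRows_append_singleton, List.headD_cons, h1]
    · rw [h5, rowClauses_cons, List.length_append, List.length_append, List.length_map,
        List.length_singleton]
      have : (nextRow us w row).length = P.length := by
        rw [← List.length_map (f := Prod.fst), map_fst_nextRow, hP]
      rw [this]
      ring

theorem isOrderedRefutation_orderedOfHalf (hτ : τ ≠ []) (hP : IsHalfDerivation π τ P)
    (h0 : [] ∈ P) : IsOrderedRefutation π τ.toFinset (orderedOfHalf (varOrder π) τ P) ∧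
      (orderedOfHalf (varOrder π) τ P).length = (n + 1) * P.length := by
  have hd : IsDerivation (orderedSide π) τ.toFinset (rowClauses [initRow (varOrder π) τ P]) := by
    have : rowClauses [initRow (varOrder π) τ P] = [] ++ rowClauses [initRow (varOrder π) τ P] :=
      rfl
    rw [this]
    refine isDerivation_nil.append fun C hC => .inl ?_
    simp only [rowClauses, List.reverse_singleton, List.flatMap_singleton, initRow, List.map_map,
      List.mem_map, Function.comp_apply] at hC
    obtain ⟨q, -, rfl⟩ := hC
    -- As `τ` is not empty, the default value in `initRow` is a clause of `τ`.
    have key : ∀ l : List (Clause n), l ⊆ τ → l.headD (τ.headD (Clause.zero n)) ∈ τ := by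
      intro l hl
      cases l with
      | cons a l => exact hl (by simp)
      | nil =>
        cases τ with
        | nil => exact absurd rfl hτ
        | cons a τ => simp
    rw [List.mem_toFinset]
    exact key _ (List.filter_subset_self _)
  obtain ⟨row, rs, h1, h2, h3, h4, h5⟩ := allRows_spec (ws := []) (by simp) hd
    (initRow_sound hP) (map_fst_initRow _)
  have h6 : orderedOfHalf (varOrder π) τ P = rowClauses (row :: rs) := by rw [orderedOfHalf, h1]
  rw [h6]
  refine ⟨⟨h2, ?_⟩, ?_⟩
  · rw [← h4] at h0
    obtain ⟨c, hc, hc1⟩ := List.mem_map.1 h0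
    obtain ⟨B, S, rfl⟩ := List.append_of_mem hc
    -- Before any query, and with the empty line as current line, nothing is known to be false, so
    -- the clause of this entry is empty.
    have h7 := h3 B c S rfl (by simp [hc1]) (by simp [levelLits])
    have h8 : c.2 = Clause.zero n := by
      apply Subtype.ext
      rw [Clause.zero, Finset.eq_empty_iff_forall_notMem]
      intro l hl
      simpa [levelLits] using h7 l hl
    rw [rowClauses_cons, List.mem_append, List.mem_map]
    exact .inr ⟨c, hc, h8⟩
  · rw [h5, length_varOrder]
    simp only [rowClauses, List.reverse_singleton, List.flatMap_singleton, List.length_map]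
    rw [← List.length_map (f := Prod.fst), map_fst_initRow]
    ring

end Rows

end OrderedCDCL

/-! ### Polynomial time: from half-ordered derivations to ordered refutations -/

namespace OrderedCDCL

open Enc

/-- Inverts the permutation by searching its table; the default `j` is never returned. -/
theorem varOrder_eq {n : ℕ} (π : Equiv.Perm (Fin n)) : varOrder π =
    (List.finRange n).map fun j => ((List.finRange n).filter fun i => decide (π i = j)).headD j := by
  refine List.map_congr_left fun j _ => ?_
  have key : ∀ i ∈ (List.finRange n).filter (fun i => decide (π i = j)), i = π.symm j := by
    intro i hi
    rw [Equiv.eq_symm_apply]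
    simpa using hi
  have hmem : π.symm j ∈ (List.finRange n).filter (fun i => decide (π i = j)) := by simp
  rcases hf : (List.finRange n).filter (fun i => decide (π i = j)) with _ | ⟨i, l⟩
  · simp [hf] at hmem
  · exact (key i (by simp [hf])).symm

theorem size_enc_literal {n : ℕ} (w : Fin n) (b : Bool) :
    (enc (⟨w, b⟩ : Literal n)).size ≤ (enc w).size + 4 := by
  have : (Data.ofBool b).size ≤ 3 := Data.size_ofBool_le b
  change (enc w).size + (Data.ofBool b).size + 1 ≤ _
  omega

namespace PT

variable {X : Type} {e : X → Data} {n : X → ℕ}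

theorem varOrder {π : ∀ x, Equiv.Perm (Fin (n x))} (hn : Poly e n)
    (hπ : Poly e fun x => List.ofFn (π x)) : Poly e fun x => varOrder (π x) := by
  have := PT.map (PT.finRange hn) (f := fun x j =>
    ((List.finRange (n x)).filter fun i => decide (π x i = j)).headD j) (fun Y e' x j he hj => by
      refine PT.headD (PT.filter (PT.finRange (hn.lift he)) ?_) hj
      intro Z e'' y i he' hi
      exact PT.dec (PT.nth (n := fun z => n (x (y z))) (f := fun z => π (x (y z)))
        ((hπ.lift he).lift he') hi) (hj.lift he'))
  exact congrEnc this fun x => (varOrder_eq _).symm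

section Lines

variable {M L T us : ∀ x, List (Literal (n x))}

theorem sideLine {M : ∀ x, Line (n x)} {l : ∀ x, Literal (n x)} {T : ∀ x, Line (n x)}
    (hM : Poly e M) (hl : Poly e l) (hT : Poly e T) :
    Poly e fun x => sideLine (M x) (l x) (T x) := by
  refine PT.and (PT.mem hM hl) (PT.all hM ?_)
  intro Y e' x m he hm
  exact PT.or (PT.dec hm (hl.lift he)) (PT.mem (hT.lift he) hm)

theorem levelLits {B : ∀ x, List (Line (n x))} {L : ∀ x, Line (n x)} {us : ∀ x, List (Fin (n x))}
    (hB : Poly e B) (hL : Poly e L) (hus : Poly e us) :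
    Poly e fun x => levelLits (B x) (L x) (us x) := by
  refine PT.foldl_additive (β := fun x => Line (n x)) hus PT.listNil ?_
    (k := fun x => 2 * ((enc (us x)).size + 4 + 1) + 1) ?_ ?_
  · intro Y e' x T w he hT hw
    have hlit : ∀ b : Bool, Poly e' fun y => (⟨w y, b⟩ : Literal (n (x y))) :=
      fun b => PT.litMk (n := fun y => n (x y)) hw (PT.constEnc b)
    refine PT.append hT (PT.filter (PT.listCons (hlit true) (PT.listCons (hlit false)
      PT.listNil)) ?_)
    intro Z e'' y l he' hl
    have hL' := (hL.lift he).lift he'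
    have hB' := (hB.lift he).lift he'
    refine PT.or (PT.mem hL' hl) (PT.any hB' ?_)
    intro Z' e''' z M he'' hM
    exact PT.sideLine (n := fun z' => n (x (y (z z')))) hM
      (PT.litNeg (n := fun z' => n (x (y (z z')))) (hl.lift he'')) ((hT.lift he').lift he'')
  · exact ((PolyBdd.const 2).mul ((hus.size_bdd.add (.const 4)).add (.const 1))).add (.const 1)
  · intro x T w hw
    have h1 : (enc w).size < (enc (us x)).size := Data.size_lt_size_ofList _ hw
    have h2 := Data.size_ofList_append enc T ([(⟨w, true⟩ : Literal (n x)), ⟨w, false⟩].filter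
      fun l => decide (l ∈ L x) || (B x).any fun M => OrderedCDCL.sideLine M l.neg T)
    have h3 := Data.size_ofList_le enc ([(⟨w, true⟩ : Literal (n x)), ⟨w, false⟩].filter
      fun l => decide (l ∈ L x) || (B x).any fun M => OrderedCDCL.sideLine M l.neg T)
      ((enc (us x)).size + 4) (by
        intro l hl
        have h4 := List.mem_of_mem_filter hl
        simp only [List.mem_cons, List.not_mem_nil, or_false] at h4
        have h5 := size_enc_literal w true
        have h6 := size_enc_literal w false
        rcases h4 with rfl | rfl <;> omega)
    have h7 := List.length_filter_le (fun l => decide (l ∈ L x) ||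
      (B x).any fun M => OrderedCDCL.sideLine M l.neg T) [(⟨w, true⟩ : Literal (n x)), ⟨w, false⟩]
    have h8 := Nat.mul_le_mul_right ((enc (us x)).size + 4 + 1) h7
    simp only [List.length_cons, List.length_nil, Nat.zero_add] at h8
    change (Data.ofList enc _).size ≤ (Data.ofList enc _).size + _
    omega

end Lines

section Rows

variable {us : ∀ x, List (Fin (n x))} {w : ∀ x, Fin (n x)}

theorem resLits {E F : ∀ x, Clause (n x)} (hn : Poly e n) (hw : Poly e w) (hE : Poly e E)
    (hF : Poly e F) : Poly e fun x => resLits (w x) (E x) (F x) := by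
  have key : ∀ (b : Bool) {C : ∀ x, Clause (n x)}, Poly e C → Poly e fun x =>
      (C x).lits.filter fun l => !decide (l = ⟨w x, b⟩) := by
    intro b C hC
    refine PT.filter (PT.lits hn hC) ?_
    intro Y e' x l he hl
    exact PT.not (PT.dec hl (PT.litMk (n := fun y => n (x y)) (hw.lift he) (PT.constEnc b)))
  exact PT.append (key true hE) (key false hF)

theorem mergeClauses {E F : ∀ x, Clause (n x)} (hn : Poly e n) (hus : Poly e us) (hw : Poly e w)
    (hE : Poly e E) (hF : Poly e F) :
    Poly e fun x => mergeClauses (us x) (w x) (E x) (F x) := by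
  have hR := resLits hn hw hE hF
  refine PT.ite (PT.memClause hE (PT.litMk hw (PT.constEnc true))) (PT.ite (PT.memClause hF
    (PT.litMk hw (PT.constEnc false))) (PT.ite (PT.decTrue (PT.all hR ?_)) (PT.ofLits hn hR) hE)
    hF) hE
  intro Y e' x l he hl
  exact PT.and (PT.not (PT.mem (hR.lift he) (PT.litNeg (n := fun y => n (x y)) hl)))
    (PT.mem (hus.lift he) (PT.litVar (n := fun y => n (x y)) hl))

theorem searchTarget {T : ∀ x, Line (n x)} {B : ∀ x, List (Line (n x) × Clause (n x))}
    {c : ∀ x, Line (n x) × Clause (n x)} {l : ∀ x, Literal (n x)} (hT : Poly e T) (hB : Poly e B)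
    (hc : Poly e c) (hl : Poly e l) :
    Poly e fun x => searchTarget (T x) (B x) (c x) (l x) := by
  refine PT.headD (PT.filter hB ?_) hc
  intro Y e' x q he hq
  exact PT.sideLine (n := fun y => n (x y)) (PT.fst hq) (hl.lift he) (hT.lift he)

theorem nextRow {row : ∀ x, List (Line (n x) × Clause (n x))} (hn : Poly e n) (hus : Poly e us)
    (hw : Poly e w) (hrow : Poly e row) : Poly e fun x => nextRow (us x) (w x) (row x) := by
  refine PT.map (PT.splits hrow) ?_
  intro Y e' x q he hq
  have hn' := hn.lift he
  have hus' := hus.lift he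
  have hw' := hw.lift he
  have hT : Poly e' fun y => OrderedCDCL.levelLits ((q y).1.map Prod.fst) (q y).2.1 (us (x y)) :=
    PT.levelLits (n := fun y => n (x y)) (PT.map (PT.fst hq) fun Z e'' z p _ hp => PT.fst hp)
      (PT.fst (PT.snd hq)) hus'
  have hst : ∀ b : Bool, Poly e' fun y => (OrderedCDCL.searchTarget
      (OrderedCDCL.levelLits ((q y).1.map Prod.fst) (q y).2.1 (us (x y))) (q y).1 (q y).2
        ⟨w (x y), b⟩).2 := fun b =>
    PT.snd (PT.searchTarget (n := fun y => n (x y)) hT (PT.fst hq) (PT.snd hq)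
      (PT.litMk (n := fun y => n (x y)) hw' (PT.constEnc b)))
  exact PT.pair (PT.fst (PT.snd hq))
    (PT.mergeClauses (n := fun y => n (x y)) hn' hus' hw' (hst true) (hst false))

theorem zeroClause (hn : Poly e n) : Poly e fun x => Clause.zero (n x) := by
  refine congrEnc (PT.ofLits hn (L := fun _ => []) PT.listNil) fun x => ?_
  apply Subtype.ext
  simp [Clause.ofLits, Clause.zero]

theorem initRow {vs : ∀ x, List (Fin (n x))} {τ : ∀ x, List (Clause (n x))}
    {P : ∀ x, List (Line (n x))} (hn : Poly e n) (hvs : Poly e vs) (hτ : Poly e τ)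
    (hP : Poly e P) : Poly e fun x => initRow (vs x) (τ x) (P x) := by
  refine PT.map (PT.splits hP) ?_
  intro Y e' x q he hq
  have hτ' := hτ.lift he
  have hn' := hn.lift he
  refine PT.pair (PT.snd hq) (PT.headD (PT.filter hτ' ?_)
    (PT.headD hτ' (PT.zeroClause (n := fun y => n (x y)) hn')))
  intro Z e'' z C he' hC
  refine PT.all (PT.lits (n := fun z' => n (x (z z'))) (hn'.lift he') hC) ?_
  intro Z' e''' z' l he'' hl
  have hq'' := (hq.lift he').lift he''
  exact PT.mem (PT.levelLits (n := fun y => n (x (z (z' y)))) (PT.fst hq'') (PT.snd hq'')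
    (((hvs.lift he).lift he').lift he'')) hl

end Rows

end PT

theorem size_enc_clause {n : ℕ} (C : Clause n) : (enc C).size ≤ n * 6 + 1 := by
  have := Data.size_ofList_le Data.ofNat (List.ofFn fun i : Fin n =>
    if ⟨i, true⟩ ∈ C.1 then 2 else if ⟨i, false⟩ ∈ C.1 then 1 else 0) 5 (by
      intro a ha
      rw [List.mem_ofFn] at ha
      obtain ⟨i, rfl⟩ := ha
      split_ifs <;> simp [Data.ofNat, Data.size])
  rw [List.length_ofFn] at this
  exact this

namespace PT

variable {X : Type} {e : X → Data} {n : X → ℕ}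

theorem nat_bdd {k : X → ℕ} (hk : Poly e k) : SizeBdd e k :=
  hk.size_bdd.mono fun x => by
    change k x ≤ (Data.ofNat (k x)).size
    generalize k x = m
    induction m with
    | zero => simp
    | succ m ih => simp only [Data.ofNat, Data.size]; omega

theorem orderedOfHalf {vs : ∀ x, List (Fin (n x))} {τ : ∀ x, List (Clause (n x))}
    {P : ∀ x, List (Line (n x))} (hn : Poly e n) (hvs : Poly e vs) (hτ : Poly e τ)
    (hP : Poly e P) : Poly e fun x => orderedOfHalf (vs x) (τ x) (P x) := by
  have h0 : Poly e fun x => [OrderedCDCL.initRow (vs x) (τ x) (P x)] :=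
    PT.listCons (PT.initRow hn hvs hτ hP) PT.listNil
  -- A bound for all rows, whatever the level: their first components form `P`, and the code of a
  -- clause has size at most `n x * 6 + 1`. Composing the polynomials of the successive steps would
  -- give no such bound.
  let r : X → ℕ := fun x =>
    (P x).length * ((enc (P x)).size + ((n x * 6 + 1) + 1) + 1) + 1
  have hr : SizeBdd e r := ((PT.length_bdd hP).mul ((hP.size_bdd.add ((((PT.nat_bdd hn).mul
    (.const 6)).add (.const 1)).add (.const 1))).add (.const 1))).add (.const 1)
  have hrow : ∀ x (row : List (Line (n x) × Clause (n x))), row.map Prod.fst = P x →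
      (enc row).size ≤ r x := by
    intro x row h
    have h1 := Data.size_ofList_le enc row ((enc (P x)).size + ((n x * 6 + 1) + 1)) (by
      intro q hq
      have h2 : (enc q.1).size < (enc (P x)).size := by
        refine Data.size_lt_size_ofList _ ?_
        rw [← h]
        exact List.mem_map_of_mem hq
      have h3 := size_enc_clause q.2
      change (enc q.1).size + (enc q.2).size + 1 ≤ _
      omega)
    have h2 : row.length = (P x).length := by rw [← h, List.length_map]
    rw [h2] at h1
    exact h1
  have h1 : Poly e fun x => allRows (vs x) [OrderedCDCL.initRow (vs x) (τ x) (P x)] := by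
    refine PT.foldl (β := fun x => List (List (Line (n x) × Clause (n x))))
      (PT.reverse (PT.splits hvs)) h0 ?_
      (k := fun x => ((OrderedCDCL.splits (vs x)).reverse.length + 1) * (r x + 1) + 1) ?_ ?_
    · intro Y e' x rs q he hrs hq
      exact PT.listCons (PT.nextRow (n := fun y => n (x y)) (hn.lift he) (PT.fst hq) (PT.snd hq)
        (PT.headD hrs PT.listNil)) hrs
    · exact ((((PT.length_bdd (PT.reverse (PT.splits hvs))).add (.const 1))).mul
        (hr.add (.const 1))).add (.const 1)
    · intro x l₁ hl
      have key : ∀ l : List (List (Fin (n x)) × Fin (n x)), ∃ row rs,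
          l.foldl (fun rs q => OrderedCDCL.nextRow q.1 q.2 (rs.headD []) :: rs)
            [OrderedCDCL.initRow (vs x) (τ x) (P x)] = row :: rs ∧
          (∀ row' ∈ row :: rs, row'.map Prod.fst = P x) ∧ rs.length = l.length := by
        intro l
        induction l using List.reverseRecOn with
        | nil => exact ⟨_, _, rfl, by simp [map_fst_initRow], rfl⟩
        | append_singleton l q ih =>
          obtain ⟨row, rs, h1, h2, h3⟩ := ih
          refine ⟨_, _, by rw [List.foldl_append, h1]; rfl, ?_, by simp [h3]⟩
          intro row' h
          rcases List.mem_cons.1 h with rfl | h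
          · rw [map_fst_nextRow, List.headD_cons]
            exact h2 _ (by simp)
          · exact h2 _ h
      obtain ⟨row, rs, h2, h3, h4⟩ := key l₁
      rw [h2]
      refine (Data.size_ofList_le enc (row :: rs) (r x) fun row' h => hrow x _ (h3 _ h)).trans ?_
      rw [List.length_cons, h4]
      exact Nat.add_le_add_right
        (Nat.mul_le_mul_right _ (Nat.add_le_add_right hl.length_le 1)) 1
  exact PT.flatMap (PT.reverse h1) fun Y e' x row he hrow =>
    PT.map hrow fun Z e'' z q _ hq => PT.snd hq

end PT

end OrderedCDCL

namespace OrderedCDCL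

/-! ### From CDCL runs to half-ordered derivations -/

section Restrict

variable {n : ℕ} {C : Clause n} {t : Trail n} {S : Finset (Literal n)}

theorem restrict_eq_some_iff : C.restrict t = some S ↔
    (∀ l ∈ C.1, l ∉ t.lits) ∧ (C.1.filter fun l => l.neg ∉ t.lits) = S := by
  unfold Clause.restrict
  split_ifs with h
  · simp only [false_iff, not_and]
    obtain ⟨l, h1, h2⟩ := h
    exact fun h => absurd h2 (h l h1)
  · push Not at h
    simp only [Option.some.injEq]
    exact ⟨fun h' => ⟨h, h'⟩, fun h' => h'.2⟩

theorem restrict_eq_none_iff : C.restrict t = none ↔ ∃ l ∈ C.1, l ∈ t.lits := by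
  unfold Clause.restrict
  split_ifs with h <;> simp [h]

theorem mem_lits_iff {l : Literal n} : l ∈ t.lits ↔ ∃ e ∈ t, e.lit = l := by
  simp [Trail.lits]

theorem assigns_iff {x : Fin n} : t.Assigns x ↔ x ∈ t.map fun e => e.lit.var := by
  simp [Trail.Assigns]

theorem assigns_iff_lits {l : Literal n} : t.Assigns l.var ↔ l ∈ t.lits ∨ l.neg ∈ t.lits := by
  simp only [Trail.Assigns, mem_lits_iff, ← exists_or, ← and_or_left]
  refine exists_congr fun e => and_congr_right fun _ => ⟨fun h => Literal.eq_or_eq_neg h, ?_⟩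
  rintro (h | h) <;> simp [h]

end Restrict

/-- The clauses learned by an action. -/
def Action.learned {n : ℕ} : Action n → List (Clause n)
  | .learn C _ => [C]
  | _ => []

/-- The effect of an action on the trail. -/
def Action.stepTrail {n : ℕ} (t : Trail n) : Action n → Trail n
  | .decide l => t ++ [⟨l, Ann.d⟩]
  | .propagate l => t ++ [⟨l, Ann.u⟩]
  | .learn _ t' => t'

/-- The trail after a sequence of actions. -/
def runTrail {n : ℕ} (As : List (Action n)) : Trail n := As.foldl Action.stepTrail []

/-- The clauses after a sequence of actions. -/
def runClauses {n : ℕ} (τ : List (Clause n)) (As : List (Action n)) : List (Clause n) :=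
  τ ++ As.flatMap Action.learned

/-- The complements of the marked literals of the trail, when `D` is learned: a decision is
marked if it is falsified by `D`, a propagated literal if it has a reason in which all the
literals before it are marked. -/
def marked {n : ℕ} (K : List (Clause n)) (D : Clause n) (t : Trail n) : Line n :=
  t.foldl (fun m e =>
    if (if e.ann = Ann.u then K.any fun C => sideLine C.lits e.lit m
      else decide (e.lit.neg ∈ D.1)) = true
    then m ++ [e.lit.neg] else m) []

/-- The complements of the marked decisions of the trail. -/
def markedDecisions {n : ℕ} (D : Clause n) (t : Trail n) : Line n :=
  (t.filter fun e => !decide (e.ann = Ann.u) && decide (e.lit.neg ∈ D.1)).map fun e => e.lit.neg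

/-- The lines that say that a marked propagated literal follows from the marked decisions
before it. -/
def trailLines {n : ℕ} (K : List (Clause n)) (D : Clause n) (t : Trail n) : List (Line n) :=
  (splits t).flatMap fun q =>
    if (decide (q.2.ann = Ann.u) &&
      K.any fun C => sideLine C.lits q.2.lit (marked K D q.1)) = true
    then [q.2.lit :: markedDecisions D q.1] else []

/-- The lines that derive all the clauses learned by a sequence of actions. -/
def runLines {n : ℕ} (τ : List (Clause n)) (As : List (Action n)) : List (Line n) :=
  (splits As).flatMap fun q => q.2.learned.flatMap fun D =>
    trailLines (runClauses τ q.1) D (runTrail q.1) ++ [D.lits]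

/-- In a trail produced with the amendment `π-D` every decision is smaller than all the
variables that are unassigned when it is made. -/
def OrderedTrail {n : ℕ} (π : Equiv.Perm (Fin n)) (t : Trail n) : Prop :=
  (t.map fun e => e.lit.var).Nodup ∧ ∀ p e s, t = p ++ e :: s → e.ann = Ann.d →
    ∀ y, ¬ Trail.Assigns p y → y ≠ e.lit.var → π e.lit.var < π y

section OrderedTrail

variable {n : ℕ} {π : Equiv.Perm (Fin n)} {t : Trail n}

theorem orderedTrail_nil : OrderedTrail π [] := ⟨by simp, by simp⟩

theorem OrderedTrail.of_prefix (h : OrderedTrail π t) {p : Trail n} (hp : p <+: t) :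
    OrderedTrail π p := by
  obtain ⟨s, rfl⟩ := hp
  refine ⟨?_, fun q e r hq => h.2 q e (r ++ s) (by simp [hq])⟩
  have := h.1
  rw [List.map_append] at this
  exact List.Nodup.of_append_left this

theorem OrderedTrail.append (h : OrderedTrail π t) {e : AnnAssignment n}
    (he : ¬ t.Assigns e.lit.var)
    (hd : e.ann = Ann.d → ∀ y, ¬ t.Assigns y → ¬ π y < π e.lit.var) :
    OrderedTrail π (t ++ [e]) := by
  refine ⟨?_, fun p f s hp hf y hy hyf => ?_⟩
  · rw [List.map_append, List.map_singleton, List.nodup_append]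
    refine ⟨h.1, by simp, ?_⟩
    intro a ha b hb hab
    rw [assigns_iff] at he
    simp only [List.mem_singleton] at hb
    exact he (hb ▸ hab ▸ ha)
  · rcases List.eq_nil_or_concat s with rfl | ⟨s, g, rfl⟩
    · obtain ⟨rfl, h2⟩ := List.append_inj' hp (by simp)
      obtain rfl : e = f := by simpa using h2
      refine lt_of_le_of_ne (not_lt.1 (hd hf y hy)) ?_
      exact fun h => hyf (π.injective h).symm
    · have h2 : t ++ [e] = (p ++ f :: s) ++ [g] := by simpa using hp
      exact h.2 p f s (List.append_inj' h2 (by simp)).1 hf y hy hyf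

/-- The variable of `f` was still unassigned when the decision `e` was made, and that decision took
the smallest unassigned variable. -/
theorem OrderedTrail.decision_lt (h : OrderedTrail π t) {p s : Trail n} {e f : AnnAssignment n}
    (ht : t = p ++ f :: s) (he : e ∈ p) (hd : e.ann = Ann.d) : π e.lit.var < π f.lit.var := by
  obtain ⟨p₁, p₂, rfl⟩ := List.append_of_mem he
  have h1 := h.1
  rw [ht] at h1
  simp only [List.map_append, List.map_cons, List.append_assoc, List.cons_append] at h1
  rw [List.nodup_append, List.nodup_cons] at h1
  refine h.2 p₁ e (p₂ ++ f :: s) (by simp [ht]) hd _ ?_ ?_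
  · rw [assigns_iff]
    exact fun hp => h1.2.2 _ hp _ (by simp) rfl
  · intro hfe
    exact h1.2.1.1 (by simp [hfe])

theorem OrderedTrail.length_le (h : OrderedTrail π t) : t.length ≤ n := by
  have := h.1.length_le_card
  simpa using this

end OrderedTrail

section Marked

variable {n : ℕ} {π : Equiv.Perm (Fin n)} {K : List (Clause n)} {D : Clause n} {t p : Trail n}
  {e : AnnAssignment n} {l : Literal n}

theorem marked_append_singleton : marked K D (t ++ [e]) =
    if (if e.ann = Ann.u then K.any fun C => sideLine C.lits e.lit (marked K D t)
      else decide (e.lit.neg ∈ D.1)) = true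
    then marked K D t ++ [e.lit.neg] else marked K D t := by
  rw [marked, List.foldl_append]
  rfl

theorem marked_subset_append_singleton : marked K D t ⊆ marked K D (t ++ [e]) := by
  rw [marked_append_singleton]
  split_ifs <;> simp

theorem markedDecisions_subset_append_singleton :
    markedDecisions D t ⊆ markedDecisions D (t ++ [e]) := by
  simp [markedDecisions]

theorem mem_clause_of_mem_markedDecisions (h : l ∈ markedDecisions D t) : l ∈ D.1 := by
  simp only [markedDecisions, List.mem_map, List.mem_filter, Bool.and_eq_true,
    decide_eq_true_eq] at h
  obtain ⟨e, he, rfl⟩ := h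
  exact he.2.2

theorem trailLines_append_singleton : trailLines K D (t ++ [e]) = trailLines K D t ++
    if (decide (e.ann = Ann.u) && K.any fun C => sideLine C.lits e.lit (marked K D t)) = true
    then [e.lit :: markedDecisions D t] else [] := by
  simp only [trailLines, splits_append_singleton, List.flatMap_append, List.flatMap_singleton]

/-- The complement of a marked literal is a marked decision or has a line of its own. -/
theorem mem_marked (h : OrderedTrail π t) (hl : l ∈ marked K D t) : l ∈ markedDecisions D t ∨
    ∃ N ∈ trailLines K D t, l.neg ∈ N ∧
      ∀ m ∈ N, m ≠ l.neg → m ∈ markedDecisions D t ∧ π m.var < π l.var := by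
  induction t using List.reverseRecOn with
  | nil => simp [marked] at hl
  | append_singleton t e ih =>
    have ih' : l ∈ marked K D t → l ∈ markedDecisions D (t ++ [e]) ∨
        ∃ N ∈ trailLines K D (t ++ [e]), l.neg ∈ N ∧
          ∀ m ∈ N, m ≠ l.neg → m ∈ markedDecisions D (t ++ [e]) ∧ π m.var < π l.var := by
      intro hl
      rcases ih (h.of_prefix (by simp)) hl with h1 | ⟨N, h1, h2, h3⟩
      · exact .inl (markedDecisions_subset_append_singleton h1)
      · refine .inr ⟨N, ?_, h2, fun m hm hml => ?_⟩
        · rw [trailLines_append_singleton]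
          simp [h1]
        · exact ⟨markedDecisions_subset_append_singleton (h3 m hm hml).1, (h3 m hm hml).2⟩
    rw [marked_append_singleton] at hl
    split_ifs at hl with h1 h2
    · rcases List.mem_append.1 hl with hl | hl
      · exact ih' hl
      · obtain rfl : l = e.lit.neg := by simpa using hl
        right
        refine ⟨e.lit :: markedDecisions D t, ?_, by simp, fun m hm hml => ?_⟩
        · rw [trailLines_append_singleton, if_pos (by simpa [h1] using h2)]
          simp
        · rw [Literal.neg_neg] at hml
          have hm := (List.mem_cons.1 hm).resolve_left hml
          refine ⟨markedDecisions_subset_append_singleton hm, ?_⟩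
          simp only [markedDecisions, List.mem_map, List.mem_filter] at hm
          obtain ⟨f, ⟨hf, hf'⟩, rfl⟩ := hm
          -- This is where the order of the decisions makes the side line legal: the other literals
          -- of the line of `e` negate decisions made before `e`.
          refine h.decision_lt rfl hf ?_
          cases hfa : f.ann <;> simp_all
    · exact ih' hl
    · rename_i h3
      rcases List.mem_append.1 hl with hl | hl
      · exact ih' hl
      · obtain rfl : l = e.lit.neg := by simpa using hl
        left
        simp only [markedDecisions, List.filter_append, List.map_append, List.mem_append]
        right
        simpa [h1] using h3
    · exact ih' hl

/-- A literal of `C` outside `L` is the complement of a marked propagated literal, and the trail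
line of the latter removes it at the price of negated marked decisions, which `L` contains. -/
theorem halfJustified_of_subset_marked {τ : List (Clause n)} {Q : List (Line n)} {L : Line n}
    (h : OrderedTrail π t) (hK : ∀ C ∈ K, C ∈ τ ∨ C.lits ∈ Q) {C : Clause n} (hC : C ∈ K)
    (hCt : ∀ l ∈ C.1, l ∈ L ∨ l ∈ marked K D t) (hL : markedDecisions D t ⊆ L) :
    HalfJustified π τ (Q ++ trailLines K D t) L := by
  refine ⟨C.lits, ?_, fun l hl => ?_⟩
  · rcases hK C hC with h1 | h1
    · exact .inr ⟨C, h1, rfl⟩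
    · exact .inl (by simp [h1])
  · rcases hCt l (by simpa using hl) with h1 | h1
    · exact .inl h1
    · rcases mem_marked h h1 with h2 | ⟨N, hN, h2, h3⟩
      · exact .inl (hL h2)
      · exact .inr ⟨N, by simp [hN], h2, fun m hm hml => ⟨hL (h3 m hm hml).1, (h3 m hm hml).2⟩⟩

/-- Some clause of `K` consists of complements of marked literals. -/
theorem exists_subset_marked {s : Trail n} {D' : Clause n}
    (hnd : ((p ++ s).map fun e => e.lit.var).Nodup) (hD' : D' ∈ learnableBack K.toFinset p s)
    (h1 : ∀ l ∈ D'.1, l.neg ∈ p.lits → l ∈ marked K D p)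
    (h2 : ∀ l ∈ D'.1, ∀ e ∈ s, e.ann = Ann.d → e.lit = l.neg → l ∈ D.1) :
    ∃ C ∈ K, ∀ l ∈ C.1, l ∈ marked K D (p ++ s) := by
  -- Conflict analysis is undone, from a resolvent to its premise. The invariants on the current
  -- clause are that its literals falsified by `p` are complements of marked literals, and that
  -- those falsified by later decisions are in `D`. At the end of the trail the current clause is
  -- the conflict clause.
  induction s generalizing p D' with
  | nil =>
    obtain ⟨hK, hr⟩ := hD'
    rw [restrict_eq_some_iff] at hr
    refine ⟨D', by simpa using hK, fun l hl => ?_⟩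
    rw [List.append_nil]
    refine h1 l hl ?_
    by_contra hp
    have : l ∈ D'.1.filter fun l => l.neg ∉ p.lits := by simp [hl, hp]
    rw [hr.2] at this
    simp at this
  | cons e s ih =>
    have hp : p ++ e :: s = (p ++ [e]) ++ s := by simp
    rw [hp] at hnd ⊢
    have hlits : ∀ l : Literal n, l ∈ Trail.lits (p ++ [e]) ↔ l ∈ p.lits ∨ l = e.lit := by
      intro l
      simp [Trail.lits]
    -- The cases in which the step at `e` leaves the clause unchanged. If the clause contains the
    -- complement of `e.lit`, then `e` is a decision, and it is marked because that literal is in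
    -- `D`.
    have keep : D' ∈ learnableBack K.toFinset (p ++ [e]) s →
        (e.lit.neg ∈ D'.1 → e.ann = Ann.d) → ∃ C ∈ K, ∀ l ∈ C.1, l ∈ marked K D (p ++ [e] ++ s) := by
      intro hD' hd
      refine ih hnd hD' (fun l hl hlp => ?_) fun l hl f hf => h2 l hl f (by simp [hf])
      rcases (hlits _).1 hlp with h | h
      · exact marked_subset_append_singleton (h1 l hl h)
      · obtain rfl : l = e.lit.neg := by rw [← h, Literal.neg_neg]
        have hed := hd hl
        have := h2 _ hl e (by simp) hed (by simp)
        rw [marked_append_singleton]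
        simp [hed, this]
    rw [learnableBack, backStep] at hD'
    split at hD'
    next hd => exact keep hD' fun _ => hd
    next hu =>
      rcases hD' with ⟨hD', hne⟩ | ⟨D'', hD'', hneg, C, hC, hr, -, -, hres⟩
      · exact keep hD' fun h => absurd h hne
      · rw [restrict_eq_some_iff] at hr
        have hmem : ∀ l ∈ D''.1, l ≠ e.lit.neg → l ∈ D'.1 := fun l hl hle => by
          rw [hres]; simp [hl, hle]
        have hCe : e.lit ∈ C.1 := by
          have : e.lit ∈ C.1.filter fun l => l.neg ∉ p.lits := by rw [hr.2]; simp
          exact (Finset.mem_filter.1 this).1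
        -- The literals of the reason `C` other than `e.lit` survive in the resolvent and are
        -- falsified by `p`; hence they are marked already, and `C` marks `e`.
        have hmark : e.lit.neg ∈ marked K D (p ++ [e]) := by
          have : (K.any fun C => sideLine C.lits e.lit (marked K D p)) = true := by
            rw [List.any_eq_true]
            refine ⟨C, by simpa using hC, sideLine_iff.2 ⟨by simpa using hCe, fun l hl => ?_⟩⟩
            rw [Clause.mem_lits] at hl
            by_cases hle : l = e.lit
            · exact .inl hle
            · right
              refine h1 l (by rw [hres]; simp [hl, hle]) ?_
              by_contra hlp
              have : l ∈ C.1.filter fun l => l.neg ∉ p.lits := by simp [hl, hlp]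
              rw [hr.2, Finset.mem_singleton] at this
              exact hle this
          rw [marked_append_singleton, if_pos hu, if_pos this]
          simp
        refine ih hnd hD'' (fun l hl hlp => ?_) fun l hl f hf hfd hfl => ?_
        · by_cases hle : l = e.lit.neg
          · rw [hle]; exact hmark
          · refine marked_subset_append_singleton (h1 l (hmem l hl hle) ?_)
            refine ((hlits _).1 hlp).resolve_right fun h => hle ?_
            rw [← h, Literal.neg_neg]
        · by_cases hle : l = e.lit.neg
          -- The only new literal of the premise belongs to the variable of `e`, which is not
          -- assigned again later.
          · exfalso
            rw [hle, Literal.neg_neg] at hfl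
            rw [List.map_append, List.nodup_append] at hnd
            refine hnd.2.2 e.lit.var (by simp) f.lit.var (List.mem_map.2 ⟨f, hf, rfl⟩) ?_
            rw [hfl]
          · exact h2 l (hmem l hl hle) f (by simp [hf]) hfd hfl

end Marked

section Run

variable {n : ℕ} {π : Equiv.Perm (Fin n)} {τ : List (Clause n)}

theorem isHalfDerivation_append_singleton {P : List (Line n)} {L : Line n}
    (hP : IsHalfDerivation π τ P) (hL : HalfJustified π τ P L) :
    IsHalfDerivation π τ (P ++ [L]) := by
  intro Q M S h
  rcases List.eq_nil_or_concat S with rfl | ⟨S, N, rfl⟩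
  · obtain ⟨rfl, h2⟩ := List.append_inj' h (by simp)
    obtain rfl : L = M := by simpa using h2
    exact hL
  · have h2 : P ++ [L] = (Q ++ M :: S) ++ [N] := by simpa using h
    exact hP Q M S (List.append_inj' h2 (by simp)).1

/-- The line of a propagated literal starts from its reason; the other literals of the reason are
removed by the lines of earlier propagated literals or weakened into the negated decisions. -/
theorem isHalfDerivation_append_trailLines {K : List (Clause n)} {D : Clause n} {t : Trail n}
    {Q : List (Line n)} (hQ : IsHalfDerivation π τ Q) (hK : ∀ C ∈ K, C ∈ τ ∨ C.lits ∈ Q)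
    (ht : OrderedTrail π t) : IsHalfDerivation π τ (Q ++ trailLines K D t) := by
  induction t using List.reverseRecOn with
  | nil => simpa [trailLines, splits_nil] using hQ
  | append_singleton t e ih =>
    have ht' : OrderedTrail π t := ht.of_prefix (by simp)
    rw [trailLines_append_singleton]
    split_ifs with h
    · rw [← List.append_assoc]
      simp only [Bool.and_eq_true, decide_eq_true_eq, List.any_eq_true] at h
      obtain ⟨-, C, hC, h⟩ := h
      rw [sideLine_iff] at h
      refine isHalfDerivation_append_singleton (ih ht')
        (halfJustified_of_subset_marked ht' hK hC (fun l hl => ?_) (by simp))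
      rcases h.2 l (by simpa using hl) with rfl | h
      · exact .inl (by simp)
      · exact .inr h
    · simpa using ih ht'

theorem isRun_append_singleton {am : List (Amendment n)} {S T : State n} {As : List (Action n)}
    {A : Action n} : IsRun am S (As ++ [A]) T ↔ ∃ U, IsRun am S As U ∧ ¬ U.Terminal ∧
      A ∈ U.actions ∧ (∀ a ∈ am, A ∉ a U) ∧ U.transition A = T := by
  induction As generalizing S with
  | nil => simp [IsRun]
  | cons B As ih =>
    simp only [List.cons_append, IsRun, ih]
    constructor
    · rintro ⟨h1, h2, h3, U, h⟩
      exact ⟨U, ⟨h1, h2, h3, h.1⟩, h.2⟩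
    · rintro ⟨U, ⟨h1, h2, h3, h⟩, h'⟩
      exact ⟨h1, h2, h3, U, h, h'⟩

theorem length_trailLines_le (K : List (Clause n)) (D : Clause n) (t : Trail n) :
    (trailLines K D t).length ≤ t.length := by
  induction t using List.reverseRecOn with
  | nil => simp [trailLines, splits_nil]
  | append_singleton t e ih =>
    rw [trailLines_append_singleton]
    split_ifs <;> simp <;> omega

theorem runLines_append_singleton (As : List (Action n)) (A : Action n) :
    runLines τ (As ++ [A]) = runLines τ As ++ A.learned.flatMap fun D =>
      trailLines (runClauses τ As) D (runTrail As) ++ [D.lits] := by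
  simp [runLines, splits_append_singleton]

theorem IsRun.spec {As : List (Action n)} {T : State n}
    (h : IsRun [decisionL n, orderedD π] ⟨τ.toFinset, []⟩ As T) :
    T.clauses = (runClauses τ As).toFinset ∧ T.trail = runTrail As ∧ OrderedTrail π T.trail ∧
      IsHalfDerivation π τ (runLines τ As) ∧
      (∀ C ∈ runClauses τ As, C ∈ τ ∨ C.lits ∈ runLines τ As) ∧
      (runLines τ As).length ≤ As.length * (n + 1) := by
  induction As using List.reverseRecOn generalizing T with
  | nil =>
    obtain rfl : _ = T := h
    refine ⟨by simp [runClauses], rfl, orderedTrail_nil, ?_,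
      fun C hC => .inl (by simpa [runClauses] using hC), by
      simp [runLines, splits_nil]⟩
    intro Q L S h
    simp [runLines, splits_nil] at h
  | append_singleton As A ih =>
    obtain ⟨U, hU, -, hA, ham, rfl⟩ := isRun_append_singleton.1 h
    obtain ⟨h1, h2, h3, h4, h5, h6⟩ := ih hU
    have ham1 := ham (decisionL n) (by simp)
    have ham2 := ham (orderedD π) (by simp)
    have htrail : runTrail (As ++ [A]) = A.stepTrail (runTrail As) := by
      simp [runTrail]
    have hlen : As.length * (n + 1) ≤ (As ++ [A]).length * (n + 1) :=
      Nat.mul_le_mul_right _ (by simp)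
    rw [htrail, runLines_append_singleton, ← h2]
    have hcl : runClauses τ (As ++ [A]) = runClauses τ As ++ A.learned := by
      simp [runClauses]
    rw [hcl]
    cases A with
    | decide l =>
      refine ⟨by simp [State.transition, Action.learned, h1], rfl, ?_, by
        simpa [Action.learned] using h4, by simpa [Action.learned] using h5, by
        simpa [Action.learned] using h6.trans hlen⟩
      refine h3.append hA fun _ y hy hlt => ham2 ⟨l, rfl, y, hy, hlt⟩
    | propagate l =>
      refine ⟨by simp [State.transition, Action.learned, h1], rfl, ?_, by
        simpa [Action.learned] using h4, by simpa [Action.learned] using h5, by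
        simpa [Action.learned] using h6.trans hlen⟩
      obtain ⟨C, -, hC⟩ := hA
      rw [restrict_eq_some_iff] at hC
      refine h3.append (fun has => ?_) fun h => by cases h
      have hl : l ∈ C.1.filter fun l => l.neg ∉ U.trail.lits := by rw [hC.2]; simp
      rw [Finset.mem_filter] at hl
      rcases assigns_iff_lits.1 has with h | h
      · exact hC.1 l hl.1 h
      · exact hl.2 h
    | learn C t =>
      -- The use of DECISION-L: conflict analysis has passed the whole trail, so the invariants can
      -- be started at the empty prefix.
      have hC1 : C ∈ U.learnableAt 1 := by
        by_contra hC
        exact ham1 ⟨C, t, rfl, hC⟩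
      have hC2 : C ∈ learnableBack (runClauses τ As).toFinset [] U.trail := by
        rw [← h1]
        exact hC1
      have hpre : t <+: U.trail := by
        rcases hA with ⟨-, -, rfl⟩ | ⟨-, -, -, h, -⟩
        · simp
        · exact h
      simp only [Action.learned, List.flatMap_singleton]
      refine ⟨by simp [State.transition, h1], rfl, h3.of_prefix hpre, ?_, ?_, ?_⟩
      · rw [← List.append_assoc]
        refine isHalfDerivation_append_singleton
          (isHalfDerivation_append_trailLines h4 h5 h3) ?_
        -- At the empty prefix nothing is falsified yet, and the second invariant is trivial because
        -- the current clause is the learned clause itself.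
        obtain ⟨D, hD, hD'⟩ := exists_subset_marked (D := C) (by simpa using h3.1) hC2
          (by simp [Trail.lits]) (fun l hl _ _ _ _ => hl)
        refine halfJustified_of_subset_marked h3 h5 hD (fun l hl => .inr (hD' l hl)) ?_
        intro l hl
        simpa using mem_clause_of_mem_markedDecisions hl
      · intro E hE
        rcases List.mem_append.1 hE with hE | hE
        · exact (h5 E hE).imp_right fun h => by simp [h]
        · obtain rfl : E = C := by simpa using hE
          exact .inr (by simp)
      · have h7 := length_trailLines_le (runClauses τ As) C U.trail
        have h8 := h3.length_le
        simp only [List.length_append, List.length_singleton, Nat.add_mul]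
        omega

/-- The half-ordered refutation obtained from a successful run. -/
def halfOfRun (τ : List (Clause n)) (As : List (Action n)) : List (Line n) :=
  runLines τ As ++ [[]]

theorem Trail.exists_assignment {t : Trail n} (h : (t.map fun e => e.lit.var).Nodup) :
    ∃ v : Fin n → Bool, ∀ l ∈ t.lits, v l.var = l.sign := by
  classical
  refine ⟨fun x => decide ((⟨x, true⟩ : Literal n) ∈ t.lits), fun l hl => ?_⟩
  have key : l.neg ∉ t.lits := by
    intro hl'
    obtain ⟨e, he, rfl⟩ := mem_lits_iff.1 hl
    obtain ⟨f, hf, hfe⟩ := mem_lits_iff.1 hl'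
    have := List.inj_on_of_nodup_map h he hf (by rw [hfe]; rfl)
    rw [← this] at hfe
    exact Literal.neg_ne _ hfe.symm
  obtain ⟨x, b⟩ := l
  cases b
  · simpa [Literal.neg] using key
  · simpa using hl

theorem IsSuccessfulRun.halfOfRun (hτ : CNF.Contradictory τ.toFinset) {As : List (Action n)}
    (h : IsSuccessfulRun [decisionL n, orderedD π] τ.toFinset As) :
    IsHalfDerivation π τ (halfOfRun τ As) ∧
      (OrderedCDCL.halfOfRun τ As).length ≤ As.length * (n + 1) + 1 := by
  obtain ⟨T, hT, hterm⟩ := h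
  obtain ⟨h1, h2, h3, h4, h5, h6⟩ := hT.spec
  refine ⟨isHalfDerivation_append_singleton h4 ?_, by simpa [OrderedCDCL.halfOfRun] using h6⟩
  -- A terminal state without 0 would have a trail satisfying all the clauses, hence also the
  -- contradictory `τ`.
  have h0 : Clause.zero n ∈ runClauses τ As := by
    rcases hterm with hsat | h0
    · exfalso
      obtain ⟨v, hv⟩ := Trail.exists_assignment h3.1
      refine hτ ⟨v, fun C hC => ?_⟩
      have : C ∈ T.clauses := by
        rw [h1]
        simp only [List.mem_toFinset] at hC
        simp [runClauses, hC]
      obtain ⟨l, hl, hl'⟩ := restrict_eq_none_iff.1 (hsat C this)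
      exact ⟨l, hl, hv l hl'⟩
    · simpa [h1] using h0
  refine ⟨(Clause.zero n).lits, (h5 _ h0).symm.imp_right fun h => ⟨_, h, rfl⟩, ?_⟩
  intro l hl
  simp [Clause.zero] at hl

end Run

end OrderedCDCL

/-! ### Polynomial time: from CDCL runs to ordered refutations -/

namespace OrderedCDCL

open Enc

theorem enc_map_enc {α : Type} [Enc α] (l : List α) : enc (l.map (enc (α := α))) = enc l := by
  induction l with
  | nil => rfl
  | cons a l ih => exact congrArg (Data.cons _) ih

namespace PT

variable {X : Type} {e : X → Data} {n : X → ℕ}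

theorem learned {A : ∀ x, Action (n x)} (hA : Poly e A) : Poly e fun x => (A x).learned := by
  refine (PT.iteData (PT.eq hA.hd (PT.const (Data.ofNat 2))) (hA.tl.hd.cons PT.nil)
    PT.nil).congr fun x => ?_
  beta_reduce
  cases A x <;> rfl

/-- Works on the bare trees: the tail of the code of a decision or propagation is the code of its
literal, the tag 1 yields the annotation, and the tag 2 is followed by the clause and the new trail.
-/
theorem stepTrail {t : ∀ x, Trail (n x)} {A : ∀ x, Action (n x)} (ht : Poly e t)
    (hA : Poly e A) : Poly e fun x => Action.stepTrail (t x) (A x) := by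
  have h1 : Poly e fun x => (t x).map (enc (α := AnnAssignment (n x))) :=
    ht.congr fun x => (enc_map_enc _).symm
  have h2 : Poly e (α := fun _ => List Data) fun x =>
      [Data.cons (enc (A x)).tl (Data.ofBool (decide ((enc (A x)).hd = Data.ofNat 1)))] :=
    (hA.tl.cons (PT.eq hA.hd (PT.const (Data.ofNat 1)))).cons PT.nil
  have h3 := PT.append (α := fun _ => Data) h1 h2
  refine (PT.iteData (PT.eq hA.hd (PT.const (Data.ofNat 2))) hA.tl.tl h3).congr fun x => ?_
  beta_reduce
  have key : ∀ (a : AnnAssignment (n x)) (d : Data), d = enc a →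
      enc ((t x).map (enc (α := AnnAssignment (n x))) ++ [d]) = enc (t x ++ [a]) := by
    rintro a d rfl
    rw [← enc_map_enc (t x ++ [a]), List.map_append]
    rfl
  cases A x with
  | decide l => exact key ⟨l, Ann.d⟩ _ rfl
  | propagate l => exact key ⟨l, Ann.u⟩ _ rfl
  | learn C t => rfl

theorem isPropagated {a : ∀ x, AnnAssignment (n x)} (ha : Poly e a) :
    Poly e fun x => decide ((a x).ann = Ann.u) := ha.tl

theorem annLit {a : ∀ x, AnnAssignment (n x)} (ha : Poly e a) :
    Poly e fun x => (a x).lit := ha.hd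

theorem runTrail {As : ∀ x, List (Action (n x))} (hAs : Poly e As) :
    Poly e fun x => runTrail (As x) := by
  refine PT.foldl_additive (β := fun x => Trail (n x)) hAs PT.listNil
    (fun Y e' x t A he ht hA => PT.stepTrail (n := fun y => n (x y)) ht hA)
    (hAs.size_bdd.add (.const 10)) fun x t A hA => ?_
  have h1 : (enc A).size < (enc (As x)).size := Data.size_lt_size_ofList _ hA
  have key : ∀ (l : Literal (n x)) (a : Ann), (enc l).size ≤ (enc A).size →
      (enc (t ++ [(⟨l, a⟩ : AnnAssignment (n x))])).size ≤
        (enc t).size + ((enc (As x)).size + 10) := by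
    intro l a hl
    have h2 := Data.size_ofList_append enc t [(⟨l, a⟩ : AnnAssignment (n x))]
    have h3 := Data.size_ofBool_le (decide (a = Ann.u))
    have h4 : (Data.ofList enc [(⟨l, a⟩ : AnnAssignment (n x))]).size =
      ((enc l).size + (Data.ofBool (decide (a = Ann.u))).size + 1) + 1 + 1 := rfl
    change (Data.ofList enc _).size ≤ (Data.ofList enc _).size + _
    omega
  have h2 : ∀ d : Data, (enc A).tl = d → d.size ≤ (enc A).size := by
    rintro d rfl
    exact Data.size_tl_le _
  cases A with
  | decide l => exact key l Ann.d (h2 _ rfl)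
  | propagate l => exact key l Ann.u (h2 _ rfl)
  | learn C t' =>
    have h3 : (enc (Action.learn C t')).size = (Data.ofNat 2).size +
      ((enc C).size + (enc t').size + 1) + 1 := rfl
    change (enc t').size ≤ _
    omega

theorem runClauses {τ : ∀ x, List (Clause (n x))} {As : ∀ x, List (Action (n x))}
    (hτ : Poly e τ) (hAs : Poly e As) : Poly e fun x => runClauses (τ x) (As x) :=
  PT.append hτ (PT.flatMap hAs fun _ _ x _ _ hA => PT.learned (n := fun y => n (x y)) hA)

theorem anySideLine {K : ∀ x, List (Clause (n x))} {l : ∀ x, Literal (n x)} {m : ∀ x, Line (n x)}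
    (hn : Poly e n) (hK : Poly e K) (hl : Poly e l) (hm : Poly e m) :
    Poly e fun x => (K x).any fun C => OrderedCDCL.sideLine C.lits (l x) (m x) := by
  refine PT.any hK fun Y e' x C he hC => ?_
  exact PT.sideLine (n := fun y => n (x y)) (PT.lits (n := fun y => n (x y)) (hn.lift he) hC)
    (hl.lift he) (hm.lift he)

theorem marked {K : ∀ x, List (Clause (n x))} {D : ∀ x, Clause (n x)} {t : ∀ x, Trail (n x)}
    (hn : Poly e n) (hK : Poly e K) (hD : Poly e D) (ht : Poly e t) :
    Poly e fun x => marked (K x) (D x) (t x) := by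
  refine PT.foldl_additive (β := fun x => Line (n x)) ht PT.listNil ?_
    (ht.size_bdd.add (.const 10)) ?_
  · intro Y e' x m a he hm ha
    have hneg : Poly e' fun y => (a y).lit.neg :=
      PT.litNeg (n := fun y => n (x y)) (PT.annLit (n := fun y => n (x y)) ha)
    refine PT.ite (PT.decTrue (PT.ite (PT.isPropagated (n := fun y => n (x y)) ha) ?_ ?_))
      (PT.append hm (PT.listCons hneg PT.listNil)) hm
    · exact PT.anySideLine (n := fun y => n (x y)) (hn.lift he) (hK.lift he)
        (PT.annLit (n := fun y => n (x y)) ha) hm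
    · exact PT.memClause (n := fun y => n (x y)) (hD.lift he) hneg
  · intro x m a ha
    have h1 : (enc a).size < (enc (t x)).size := Data.size_lt_size_ofList _ ha
    have h2 : (enc a.lit.var).size ≤ (enc a).size :=
      (Data.size_hd_le (enc a.lit)).trans (Data.size_hd_le (enc a))
    have h3 : (enc a.lit.neg).size ≤ _ := size_enc_literal a.lit.var (!a.lit.sign)
    have key : (enc (m ++ [a.lit.neg])).size ≤ (enc m).size + ((enc (t x)).size + 10) := by
      have h4 := Data.size_ofList_append enc m [a.lit.neg]
      have h5 : (Data.ofList enc [a.lit.neg]).size = (enc a.lit.neg).size + 1 + 1 := rfl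
      change (Data.ofList enc _).size ≤ (Data.ofList enc _).size + _
      omega
    split_ifs <;> first | exact key | omega

theorem markedDecisions {D : ∀ x, Clause (n x)} {t : ∀ x, Trail (n x)}
    (hD : Poly e D) (ht : Poly e t) : Poly e fun x => markedDecisions (D x) (t x) := by
  refine PT.map (PT.filter ht ?_) ?_
  · intro Y e' x a he ha
    exact PT.and (PT.not (PT.isPropagated (n := fun y => n (x y)) ha))
      (PT.memClause (n := fun y => n (x y)) (hD.lift he)
        (PT.litNeg (n := fun y => n (x y)) (PT.annLit (n := fun y => n (x y)) ha)))
  · intro Y e' x a _ ha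
    exact PT.litNeg (n := fun y => n (x y)) (PT.annLit (n := fun y => n (x y)) ha)

theorem trailLines {K : ∀ x, List (Clause (n x))} {D : ∀ x, Clause (n x)} {t : ∀ x, Trail (n x)}
    (hn : Poly e n) (hK : Poly e K) (hD : Poly e D) (ht : Poly e t) :
    Poly e fun x => trailLines (K x) (D x) (t x) := by
  refine PT.flatMap (PT.splits ht) fun Y e' x q he hq => ?_
  have hlit : Poly e' fun y => (q y).2.lit := PT.annLit (n := fun y => n (x y)) (PT.snd hq)
  have hm := PT.marked (n := fun y => n (x y)) (hn.lift he) (hK.lift he) (hD.lift he) (PT.fst hq)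
  refine PT.ite (PT.decTrue (PT.and (PT.isPropagated (n := fun y => n (x y)) (PT.snd hq))
    (PT.anySideLine (n := fun y => n (x y)) (hn.lift he) (hK.lift he) hlit hm))) ?_ PT.listNil
  exact PT.listCons (PT.listCons hlit
    (PT.markedDecisions (n := fun y => n (x y)) (hD.lift he) (PT.fst hq))) PT.listNil

theorem halfOfRun {τ : ∀ x, List (Clause (n x))} {As : ∀ x, List (Action (n x))}
    (hn : Poly e n) (hτ : Poly e τ) (hAs : Poly e As) :
    Poly e fun x => halfOfRun (τ x) (As x) := by
  refine PT.append (PT.flatMap (PT.splits hAs) fun Y e' x q he hq => ?_)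
    (PT.listCons PT.listNil PT.listNil)
  refine PT.flatMap (PT.learned (n := fun y => n (x y)) (PT.snd hq)) fun Z e'' y D he' hD => ?_
  have hq' := hq.lift he'
  have hn' := (hn.lift he).lift he'
  exact PT.append (PT.trailLines (n := fun z => n (x (y z))) hn'
    (PT.runClauses (n := fun z => n (x (y z))) ((hτ.lift he).lift he') (PT.fst hq')) hD
    (PT.runTrail (n := fun z => n (x (y z))) (PT.fst hq')))
    (PT.listCons (PT.lits (n := fun z => n (x (y z))) hn' hD) PT.listNil)

end PT

/-- The inputs of a simulation of `Q`. -/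
structure SimInput (Q : ∀ n : ℕ, Equiv.Perm (Fin n) → RefutationSystem n) where
  n : ℕ
  perm : Equiv.Perm (Fin n)
  clauses : List (Clause n)
  contradictory : CNF.Contradictory clauses.toFinset
  proof : (Q n perm).Proof
  isRefutation : (Q n perm).IsRefutation clauses.toFinset proof

/-- The tree that presents an input of a simulation. -/
def SimInput.encode {Q : ∀ n : ℕ, Equiv.Perm (Fin n) → RefutationSystem n} (x : SimInput Q) :
    Data :=
  simulationInput x.perm x.clauses ((Q x.n x.perm).encode x.proof)

/-- A simulation is given by a polynomial time function on the inputs. -/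
theorem PSimulates.of_function {P Q : ∀ n : ℕ, Equiv.Perm (Fin n) → RefutationSystem n}
    (f : ∀ x : SimInput Q, (P x.n x.perm).Proof)
    (hf : ∀ x, (P x.n x.perm).IsRefutation x.clauses.toFinset (f x))
    (hpoly : PT SimInput.encode fun x => (P x.n x.perm).encode (f x)) (q : Polynomial ℕ)
    (hsize : ∀ x, (P x.n x.perm).size (f x) ≤ q.eval (x.n + (Q x.n x.perm).size x.proof)) :
    PSimulates P Q := by
  obtain ⟨M, c, ⟨r, hr⟩, hM⟩ := hpoly
  -- A single polynomial has to bound both the time (`r`) and the size (`q`).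
  refine ⟨M, q + r, fun n π τ hτ A hA => ?_⟩
  let x : SimInput Q := ⟨n, π, τ, hτ, A, hA⟩
  refine ⟨f x, hf x, ⟨c x, hM x, (hr x).trans ?_⟩, (hsize x).trans ?_⟩
  · rw [Polynomial.eval_add]
    exact Nat.le_add_left _ _
  · rw [Polynomial.eval_add]
    exact Nat.le_add_right _ _

section SimInput

variable {Q : ∀ n : ℕ, Equiv.Perm (Fin n) → RefutationSystem n}

theorem SimInput.poly_n : Poly (SimInput.encode (Q := Q)) fun x => x.n := PT.refl.hd

theorem SimInput.poly_perm :
    Poly (SimInput.encode (Q := Q)) fun x => List.ofFn x.perm := PT.refl.tl.hd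

theorem SimInput.poly_clauses : Poly (SimInput.encode (Q := Q)) fun x => x.clauses :=
  PT.refl.tl.tl.hd

theorem SimInput.poly_proof :
    PT (SimInput.encode (Q := Q)) fun x => (Q x.n x.perm).encode x.proof := PT.refl.tl.tl.tl

theorem SimInput.clauses_ne_nil (x : SimInput Q) : x.clauses ≠ [] := by
  intro h
  refine x.contradictory ⟨fun _ => true, fun C hC => ?_⟩
  simp [h] at hC

end SimInput

theorem orderedResolution_pSimulates_cdcl :
    PSimulates (fun _ π => orderedResolution π) (fun n π => cdcl [decisionL n, orderedD π]) := by
  refine PSimulates.of_function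
    (fun x => orderedOfHalf (varOrder x.perm) x.clauses (halfOfRun x.clauses x.proof)) ?_ ?_
    -- There are `n + 1` levels. The half-ordered derivation has at most `n + 1` lines per action,
    -- and the final empty line.
    ((Polynomial.X + 1) * (Polynomial.X * (Polynomial.X + 1) + 1)) ?_
  · intro x
    exact (isOrderedRefutation_orderedOfHalf x.clauses_ne_nil
      (IsSuccessfulRun.halfOfRun x.contradictory x.isRefutation).1 (by simp [halfOfRun])).1
  · let n : SimInput (fun n π => cdcl [decisionL n, orderedD π]) → ℕ := fun x => x.n
    exact PT.orderedOfHalf (n := n) SimInput.poly_n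
      (PT.varOrder (n := n) SimInput.poly_n SimInput.poly_perm) SimInput.poly_clauses
      (PT.halfOfRun (n := n) SimInput.poly_n SimInput.poly_clauses
        SimInput.poly_proof)
  · intro x
    have h := IsSuccessfulRun.halfOfRun x.contradictory x.isRefutation
    have h2 := (isOrderedRefutation_orderedOfHalf x.clauses_ne_nil h.1 (by simp [halfOfRun])).2
    refine h2.le.trans ?_
    simp only [Polynomial.eval_mul, Polynomial.eval_add, Polynomial.eval_X, Polynomial.eval_one]
    have hs : List.length x.proof =
      (cdcl [decisionL x.n, orderedD x.perm]).size x.proof := rfl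
    rw [hs] at h
    refine Nat.mul_le_mul (by omega) (h.2.trans ?_)
    exact Nat.add_le_add_right (Nat.mul_le_mul (by omega) (by omega)) 1

end OrderedCDCL

namespace OrderedCDCL

open Enc

/-! ### From ordered refutations to CDCL runs -/

/-- The assignment of `y` that falsifies the literal of `R` with this variable, if there is one. -/
def falseLit {n : ℕ} (R : Clause n) (y : Fin n) : Literal n := ⟨y, !decide (⟨y, true⟩ ∈ R.1)⟩

/-- The clause `R`, whose variables are in `us`, is a resolvent on `x` of clauses in `K`. -/
def isPivot {n : ℕ} (K : List (Clause n)) (R : Clause n) (us : List (Fin n)) (x : Fin n) : Bool :=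
  K.any fun E => K.any fun F => decide (⟨x, true⟩ ∈ E.1) && (decide (⟨x, false⟩ ∈ F.1) &&
    (((resLits x E F).all fun l => decide (l ∈ R.1)) &&
      R.lits.all fun l => decide (l ∈ resLits x E F) && decide (l.var ∈ us)))

/-- The first way of deriving `R` from `K` by ordered resolution (a list of length at most 1). -/
def pivots {n : ℕ} (vs : List (Fin n)) (K : List (Clause n)) (R : Clause n) :
    List (List (Fin n) × Fin n) :=
  ((splits vs).filter fun q => isPivot K R q.1 q.2).take 1

/-- The clause that is learned instead of `R`, if the resolved variable is `x`. -/
def learnedClause {n : ℕ} (K : List (Clause n)) (R : Clause n) (x : Fin n) : Clause n :=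
  if Clause.ofLits [⟨x, true⟩] ∈ K ∧ Clause.ofLits [⟨x, false⟩] ∈ K then Clause.zero n else R

/-- The actions that learn `R`. -/
def learnActions {n : ℕ} (K : List (Clause n)) (R : Clause n) (us : List (Fin n)) (x : Fin n) :
    List (Action n) :=
  (us.map fun y => Action.decide (falseLit R y)) ++
    [Action.propagate ⟨x, true⟩, Action.learn (learnedClause K R x) []]

/-- The clauses and actions after a further line `R` of an ordered refutation. -/
def runStep {n : ℕ} (vs : List (Fin n)) (s : List (Clause n) × List (Action n)) (R : Clause n) :
    List (Clause n) × List (Action n) :=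
  if Clause.zero n ∈ s.1 ∨ R ∈ s.1 then s else
    ((pivots vs s.1 R).map (fun q => learnedClause s.1 R q.2) ++ s.1,
      s.2 ++ (pivots vs s.1 R).flatMap fun q => learnActions s.1 R q.1 q.2)

/-- The run obtained from an ordered refutation. -/
def runOfOrdered {n : ℕ} (vs : List (Fin n)) (τ P : List (Clause n)) : List (Action n) :=
  (P.foldl (runStep vs) (τ, [])).2

section RunOfOrdered

variable {n : ℕ} {π : Equiv.Perm (Fin n)} {K : List (Clause n)} {R : Clause n}
  {us ws : List (Fin n)} {x : Fin n}

theorem falseLit_var (R : Clause n) (y : Fin n) : (falseLit R y).var = y := rfl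

theorem falseLit_eq_neg {l : Literal n} (hl : l ∈ R.1) : falseLit R l.var = l.neg := by
  obtain ⟨y, b⟩ := l
  cases b
  · have := R.2 _ hl
    simp only [Literal.neg, Bool.not_false] at this
    simp [falseLit, Literal.neg, this]
  · simp [falseLit, Literal.neg, hl]

theorem isPivot_iff : isPivot K R us x = true ↔ ∃ E ∈ K, ∃ F ∈ K,
    IsResolvent E F ⟨x, true⟩ R ∧ ∀ l ∈ R.1, l.var ∈ us := by
  simp only [isPivot, List.any_eq_true, Bool.and_eq_true, decide_eq_true_eq, List.all_eq_true,
    Clause.mem_lits]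
  refine exists_congr fun E => and_congr_right fun _ => exists_congr fun F =>
    and_congr_right fun _ => ?_
  have key : ∀ l, l ∈ E.1.erase ⟨x, true⟩ ∪ F.1.erase (Literal.neg ⟨x, true⟩) ↔
      l ∈ resLits x E F := by
    intro l
    rw [mem_resLits]
    simp [Literal.neg, and_comm]
  constructor
  · rintro ⟨h1, h2, h3, h4⟩
    refine ⟨⟨h1, h2, ?_⟩, fun l hl => (h4 l hl).2⟩
    ext l
    rw [key]
    exact ⟨fun h => (h4 l h).1, h3 l⟩
  · rintro ⟨⟨h1, h2, h3⟩, h4⟩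
    have key' : ∀ l, l ∈ R.1 ↔ l ∈ resLits x E F := fun l => by rw [h3, key]
    exact ⟨h1, h2, fun l hl => (key' l).2 hl, fun l hl => ⟨(key' l).1 hl, h4 l hl⟩⟩

/-- The trail that falsifies `R` by decisions. -/
def decisionTrail (R : Clause n) (us : List (Fin n)) : Trail n :=
  us.map fun y => ⟨falseLit R y, Ann.d⟩

theorem mem_lits_decisionTrail {l : Literal n} :
    l ∈ (decisionTrail R us).lits ↔ ∃ y ∈ us, falseLit R y = l := by
  simp [decisionTrail, Trail.lits]

theorem var_mem_of_mem_lits_decisionTrail {l : Literal n} (h : l ∈ (decisionTrail R us).lits) :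
    l.var ∈ us := by
  obtain ⟨y, hy, rfl⟩ := mem_lits_decisionTrail.1 h
  exact hy

theorem vars_decisionTrail : (decisionTrail R us).map (fun e => e.lit.var) = us := by
  simp [decisionTrail, Function.comp_def, falseLit_var]

theorem not_terminal {τ : List (Clause n)} (hτ : CNF.Contradictory τ.toFinset) (hK : τ ⊆ K)
    (h0 : Clause.zero n ∉ K) {t : Trail n} (ht : (t.map fun e => e.lit.var).Nodup) :
    ¬ (State.mk K.toFinset t).Terminal := by
  rintro (h | h)
  · obtain ⟨v, hv⟩ := Trail.exists_assignment ht
    refine hτ ⟨v, fun C hC => ?_⟩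
    have hC' : C ∈ K.toFinset := List.mem_toFinset.2 (hK (List.mem_toFinset.1 hC))
    obtain ⟨l, hl, hl'⟩ := restrict_eq_none_iff.1 (h C hC')
    exact ⟨l, hl, hv l hl'⟩
  · exact h0 (List.mem_toFinset.1 h)

theorem isRun_append {am : List (Amendment n)} {S T U : State n} {As Bs : List (Action n)}
    (h : IsRun am S As T) (h' : IsRun am T Bs U) : IsRun am S (As ++ Bs) U := by
  induction As generalizing S with
  | nil =>
    obtain rfl : S = T := h
    exact h'
  | cons A As ih => exact ⟨h.1, h.2.1, h.2.2.1, ih h.2.2.2⟩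

/-- Since `us` is an initial segment of the order, each decision concerns the smallest unassigned
variable. No conflict or unit clause matters, as the basic model never forces a propagation or a
learning step. -/
theorem isRun_decisions {τ : List (Clause n)} (hτ : CNF.Contradictory τ.toFinset) (hK : τ ⊆ K)
    (h0 : Clause.zero n ∉ K) (hv : varOrder π = us ++ ws) :
    IsRun [decisionL n, orderedD π] ⟨K.toFinset, []⟩
      (us.map fun y => Action.decide (falseLit R y)) ⟨K.toFinset, decisionTrail R us⟩ := by
  induction us using List.reverseRecOn generalizing ws with
  | nil => exact rfl
  | append_singleton us y ih =>
    rw [List.append_assoc, List.singleton_append] at hv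
    rw [List.map_append, List.map_singleton, isRun_append_singleton]
    have hnd : (us ++ y :: ws).Nodup := hv ▸ nodup_varOrder
    have hnd' := List.nodup_append.1 hnd
    refine ⟨_, ih hv, not_terminal hτ hK h0 ?_, ?_, ?_, ?_⟩
    · rw [vars_decisionTrail]
      exact hnd'.1
    · change ¬ Trail.Assigns _ _
      rw [assigns_iff, vars_decisionTrail, falseLit_var]
      exact fun h => hnd'.2.2 y h y (by simp) rfl
    · intro a ha
      simp only [List.mem_cons, List.not_mem_nil, or_false] at ha
      rcases ha with rfl | rfl
      · rintro ⟨C, t, h, -⟩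
        cases h
      · rintro ⟨l, h, z, hz, hlt⟩
        cases h
        rw [assigns_iff, vars_decisionTrail] at hz
        exact hz ((mem_prefix_varOrder hv).2 hlt)
    · simp [State.transition, decisionTrail]

theorem learnableBack_decisions (K : CNF n) (p t s : Trail n) (ht : ∀ e ∈ t, e.ann = Ann.d) :
    learnableBack K p (t ++ s) = learnableBack K (p ++ t) s := by
  induction t generalizing p with
  | nil => simp
  | cons e t ih =>
    have he := ht e (by simp)
    rw [List.cons_append, learnableBack, backStep, he]
    dsimp only
    rw [ih (p ++ [e]) fun f hf => ht f (by simp [hf])]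
    simp

/-- Decisions do not change the clauses under analysis, so a single propagation at the end makes all
the sets ℂ_k(S) with k ≤ r coincide; in particular DECISION-L forbids nothing that (L) allows. -/
theorem learnableAt_eq {S : State n} {t : Trail n} {e : AnnAssignment n}
    (hS : S.trail = t ++ [e]) (ht : ∀ e ∈ t, e.ann = Ann.d) {k : ℕ} (hk : k ≤ S.trail.length) :
    S.learnableAt k = learnableBack S.clauses t [e] := by
  have hk' : k - 1 ≤ t.length := by
    rw [hS] at hk
    simp at hk
    omega
  rw [State.learnableAt, hS, List.drop_append_of_le_length hk', List.take_append_of_le_length hk',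
    learnableBack_decisions _ _ _ _ fun f hf => ht f (List.mem_of_mem_drop hf),
    List.take_append_drop]

theorem learnable_eq {S : State n} {t : Trail n} {e : AnnAssignment n}
    (hS : S.trail = t ++ [e]) (ht : ∀ e ∈ t, e.ann = Ann.d) :
    S.learnable = learnableBack S.clauses t [e] := by
  ext D
  constructor
  · rintro ⟨k, -, hk, hD⟩
    rwa [learnableAt_eq hS ht hk] at hD
  · intro hD
    have h1 : 1 ≤ S.trail.length := by simp [hS]
    exact ⟨1, le_rfl, h1, by rwa [learnableAt_eq hS ht h1]⟩

theorem restrict_decisionTrail_reason (hx : x ∉ us) {E : Clause n}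
    (hE : (⟨x, true⟩ : Literal n) ∈ E.1) (hER : ∀ l ∈ E.1, l ≠ ⟨x, true⟩ → l ∈ R.1 ∧ l.var ∈ us) :
    E.restrict (decisionTrail R us) = some {⟨x, true⟩} := by
  rw [restrict_eq_some_iff]
  have hx' : ∀ b, (⟨x, b⟩ : Literal n) ∉ (decisionTrail R us).lits :=
    fun b h => hx (var_mem_of_mem_lits_decisionTrail h)
  constructor
  · intro l hl hlt
    by_cases hlx : l = ⟨x, true⟩
    · exact hx' _ (hlx ▸ hlt)
    · obtain ⟨y, hy, rfl⟩ := mem_lits_decisionTrail.1 hlt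
      exact Literal.neg_ne _ (falseLit_eq_neg (hER _ hl hlx).1).symm
  · ext l
    simp only [Finset.mem_filter, Finset.mem_singleton]
    constructor
    · rintro ⟨hl, hlt⟩
      by_contra hlx
      obtain ⟨h1, h2⟩ := hER l hl hlx
      exact hlt (mem_lits_decisionTrail.2 ⟨_, h2, falseLit_eq_neg h1⟩)
    · rintro rfl
      exact ⟨hE, hx' _⟩

theorem restrict_decisionTrail_conflict (hx : x ∉ us) {F : Clause n}
    (hFR : ∀ l ∈ F.1, l ≠ ⟨x, false⟩ → l ∈ R.1 ∧ l.var ∈ us) :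
    F.restrict (decisionTrail R us ++ [⟨⟨x, true⟩, Ann.u⟩]) = some ∅ := by
  have hlits : ∀ l : Literal n, l ∈ Trail.lits (decisionTrail R us ++ [⟨⟨x, true⟩, Ann.u⟩]) ↔
      l ∈ (decisionTrail R us).lits ∨ l = ⟨x, true⟩ := by
    intro l
    simp [Trail.lits]
  rw [restrict_eq_some_iff]
  constructor
  · intro l hl hlt
    rcases (hlits l).1 hlt with h | rfl
    · by_cases hlx : l = ⟨x, false⟩
      · exact hx (by simpa [hlx] using var_mem_of_mem_lits_decisionTrail h)
      · obtain ⟨y, hy, rfl⟩ := mem_lits_decisionTrail.1 h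
        exact Literal.neg_ne _ (falseLit_eq_neg (hFR _ hl hlx).1).symm
    · exact hx (hFR _ hl (by simp)).2
  · rw [Finset.eq_empty_iff_forall_notMem]
    intro l hl
    obtain ⟨hl, hlt⟩ := Finset.mem_filter.1 hl
    apply hlt
    rw [hlits]
    by_cases hlx : l = ⟨x, false⟩
    · right
      simp [hlx, Literal.neg]
    · left
      obtain ⟨h1, h2⟩ := hFR l hl hlx
      exact mem_lits_decisionTrail.2 ⟨_, h2, falseLit_eq_neg h1⟩

theorem ofLits_singleton (l : Literal n) : (Clause.ofLits [l]).1 = {l} := by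
  ext m
  rw [Clause.mem_ofLits]
  · simp
  · simpa using Literal.neg_ne l

/-- Apart from `x`, the literals of `E` and `F` are in `R`, hence falsified by the decisions; so `E`
propagates `x`, `F` becomes false, and `R` is their resolvent. The values of variables outside `R`
are irrelevant. The only obstruction is that 0 may be learnable too, in which case (L) permits
nothing else. -/
theorem isRun_learnActions {τ : List (Clause n)} (hτ : CNF.Contradictory τ.toFinset) (hK : τ ⊆ K)
    (h0 : Clause.zero n ∉ K) (hRK : R ∉ K) (hv : varOrder π = us ++ x :: ws)
    (hp : isPivot K R us x = true) :
    IsRun [decisionL n, orderedD π] ⟨K.toFinset, []⟩ (learnActions K R us x)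
      ⟨(learnedClause K R x :: K).toFinset, []⟩ := by
  obtain ⟨E, hE, F, hF, hres, hR⟩ := isPivot_iff.1 hp
  refine isRun_append (isRun_decisions hτ hK h0 hv) ?_
  have hnd : (us ++ x :: ws).Nodup := hv ▸ nodup_varOrder
  have hnd' := List.nodup_append.1 hnd
  have hx : x ∉ us := fun h => hnd'.2.2 x h x (by simp) rfl
  have hEr : E.restrict (decisionTrail R us) = some {⟨x, true⟩} := by
    refine restrict_decisionTrail_reason hx hres.1 fun l hl hlx => ?_
    have : l ∈ R.1 := by rw [hres.2.2]; simp [hl, hlx]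
    exact ⟨this, hR l this⟩
  have hFr : F.restrict (decisionTrail R us ++ [⟨⟨x, true⟩, Ann.u⟩]) = some ∅ := by
    refine restrict_decisionTrail_conflict hx fun l hl hlx => ?_
    have : l ∈ R.1 := by rw [hres.2.2]; simp [hl, hlx, Literal.neg]
    exact ⟨this, hR l this⟩
  set S : State n := ⟨K.toFinset, decisionTrail R us ++ [⟨⟨x, true⟩, Ann.u⟩]⟩ with hS
  have hann : ∀ e ∈ decisionTrail R us, e.ann = Ann.d := by simp [decisionTrail]
  have hlearn : S.learnable = learnableBack K.toFinset (decisionTrail R us) [⟨⟨x, true⟩, Ann.u⟩] :=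
    learnable_eq rfl hann
  have hlearn1 : S.learnableAt 1 = S.learnable := by
    rw [hlearn]
    exact learnableAt_eq rfl hann (by simp [hS])
  have hRl : R ∈ S.learnable := by
    rw [hlearn]
    refine Or.inr ⟨F, ⟨by simpa using hF, hFr⟩, hres.2.1, E, by simpa using hE, hEr, hres⟩
  -- As 0 is not yet known, it can only be learned as a resolvent on `x`, and then its premises are
  -- the two unit clauses.
  have hzero : Clause.zero n ∈ S.learnable ↔
      Clause.ofLits [⟨x, true⟩] ∈ K ∧ Clause.ofLits [⟨x, false⟩] ∈ K := by
    rw [hlearn]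
    constructor
    · rintro (⟨⟨h, -⟩, -⟩ | ⟨D, ⟨hD, -⟩, hxD, C, hC, -, hxC, -, h⟩)
      · exact absurd (by simpa using h) h0
      · have h1 : ∀ l, l ∉ C.1.erase ⟨x, true⟩ ∪ D.1.erase (Literal.neg ⟨x, true⟩) := by
          intro l hl
          rw [← h] at hl
          simp [Clause.zero] at hl
        simp only [Finset.mem_union, Finset.mem_erase, not_or, not_and, Literal.neg] at h1
        have hC' : C = Clause.ofLits [⟨x, true⟩] := by
          apply Subtype.ext
          rw [ofLits_singleton, Finset.eq_singleton_iff_unique_mem]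
          exact ⟨hxC, fun l hl => by_contra fun hlx => (h1 l).1 hlx hl⟩
        have hD' : D = Clause.ofLits [⟨x, false⟩] := by
          apply Subtype.ext
          rw [ofLits_singleton, Finset.eq_singleton_iff_unique_mem]
          exact ⟨hxD, fun l hl => by_contra fun hlx => (h1 l).2 hlx hl⟩
        rw [← hC', ← hD']
        exact ⟨by simpa using hC, by simpa using hD⟩
    · rintro ⟨hC, hD⟩
      refine Or.inr ⟨_, ⟨by simpa using hD, restrict_decisionTrail_conflict hx ?_⟩, ?_, _,
        by simpa using hC, restrict_decisionTrail_reason hx ?_ ?_, ?_, ?_, ?_⟩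
      all_goals simp [ofLits_singleton, Literal.neg, Clause.zero]
  have hnt : ∀ t : Trail n, (t.map fun e => e.lit.var).Nodup →
      ¬ (State.mk K.toFinset t).Terminal := fun t ht => not_terminal hτ hK h0 ht
  refine ⟨hnt _ (by rw [vars_decisionTrail]; exact hnd'.1), ⟨E, by simpa using hE, hEr⟩, ?_,
    hnt _ ?_, ?_, ?_, ?_⟩
  · intro a ha
    simp only [List.mem_cons, List.not_mem_nil, or_false] at ha
    rcases ha with rfl | rfl
    · rintro ⟨C, t, h, -⟩
      cases h
    · rintro ⟨l, h, -⟩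
      cases h
  · rw [List.map_append, vars_decisionTrail]
    exact List.Nodup.of_append_left (l₂ := ws) (by simpa using hnd)
  · change (_ ∨ _)
    by_cases hbad : Clause.ofLits [⟨x, true⟩] ∈ K ∧ Clause.ofLits [⟨x, false⟩] ∈ K
    · left
      exact ⟨hzero.2 hbad, by rw [learnedClause, if_pos hbad], rfl⟩
    · right
      rw [learnedClause, if_neg hbad]
      refine ⟨fun h => hbad (hzero.1 h), hRl, by simpa [State.transition] using hRK, by simp, ?_⟩
      intro h
      rw [restrict_eq_some_iff] at h
      -- Under the empty trail only 0 is false, and `R = 0` would fall under the exceptional case.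
      have hR0 : R = Clause.zero n := by
        apply Subtype.ext
        simpa [Trail.lits, Clause.zero] using h.2
      exact hbad (hzero.1 (hR0 ▸ hRl))
  · intro a ha
    simp only [List.mem_cons, List.not_mem_nil, or_false] at ha
    rcases ha with rfl | rfl
    · rintro ⟨C, t, h, hC⟩
      cases h
      apply hC
      change _ ∈ S.learnableAt 1
      rw [hlearn1, learnedClause]
      split_ifs with hbad
      · exact hzero.2 hbad
      · exact hRl
    · rintro ⟨l, h, -⟩
      cases h
  · simp [State.transition, IsRun]

theorem runStep_spec {τ P : List (Clause n)} (hτ : CNF.Contradictory τ.toFinset)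
    (hP : IsDerivation (orderedSide π) τ.toFinset P) :
    ∃ K As, P.foldl (runStep (varOrder π)) (τ, []) = (K, As) ∧ τ ⊆ K ∧
      IsRun [decisionL n, orderedD π] ⟨τ.toFinset, []⟩ As ⟨K.toFinset, []⟩ ∧
      (Clause.zero n ∈ K ∨ P ⊆ K) ∧ As.length ≤ P.length * (n + 2) := by
  induction P using List.reverseRecOn with
  | nil => exact ⟨τ, [], rfl, by simp, rfl, by simp, by simp⟩
  | append_singleton P R ih =>
    rw [isDerivation_iff] at hP
    have hJ := hP P R [] rfl
    obtain ⟨K, As, h1, h2, h3, h4, h5⟩ := ih (isDerivation_iff.2 fun Q C S h =>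
      hP Q C (S ++ [R]) (by simp [h]))
    have hlen : (P ++ [R]).length * (n + 2) = P.length * (n + 2) + (n + 2) := by
      rw [List.length_append, List.length_singleton]; ring
    rw [List.foldl_append, h1, List.foldl_cons, List.foldl_nil, hlen, runStep]
    by_cases h0 : Clause.zero n ∈ K
    · exact ⟨K, As, by simp [h0], h2, h3, .inl h0, by omega⟩
    have hPK := h4.resolve_left h0
    by_cases hR : R ∈ K
    · exact ⟨K, As, by simp [hR], h2, h3, .inr (by simp [hPK, hR]), by omega⟩
    rw [if_neg (by simp [h0, hR])]
    dsimp only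
    obtain ⟨us, x, hp, hv⟩ : ∃ us x, pivots (varOrder π) K R = [(us, x)] ∧
        ((us, x) ∈ splits (varOrder π) ∧ isPivot K R us x = true) := by
      have hne : ∃ q, q ∈ (splits (varOrder π)).filter fun q => isPivot K R q.1 q.2 := by
        have key : ∀ (y : Fin n), ∀ E ∈ P, ∀ F ∈ P, IsResolvent E F ⟨y, true⟩ R →
            (∀ m ∈ R.1, π m.var < π y) →
            ∃ q, q ∈ (splits (varOrder π)).filter fun q => isPivot K R q.1 q.2 := by
          intro y E hE F hF hres hside
          obtain ⟨us, ws, hv⟩ := List.append_of_mem (mem_varOrder (π := π) y)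
          refine ⟨(us, y), ?_⟩
          rw [List.mem_filter, mem_splits]
          exact ⟨⟨ws, hv⟩, isPivot_iff.2 ⟨E, hPK hE, F, hPK hF, hres, fun l hl =>
            (mem_prefix_varOrder hv).2 (hside l hl)⟩⟩
        rcases hJ with h | ⟨E, hE, F, hF, ⟨y, b⟩, hres, hside⟩
        · exact absurd (h2 (List.mem_toFinset.1 h)) hR
        · cases b
          -- `isPivot` expects the positive literal in the first premise, so the premises are
          -- exchanged.
          · refine key y F hF E hE ⟨hres.2.1, hres.1, ?_⟩ hside
            rw [hres.2.2, Finset.union_comm]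
            rfl
          · exact key y E hE F hF hres hside
      unfold pivots
      rcases hf : (splits (varOrder π)).filter fun q => isPivot K R q.1 q.2 with _ | ⟨q, Q⟩
      · simp [hf] at hne
      · have : q ∈ (splits (varOrder π)).filter fun q => isPivot K R q.1 q.2 := by simp [hf]
        rw [List.mem_filter] at this
        exact ⟨q.1, q.2, by rw [hf]; rfl, this⟩
    obtain ⟨ws, hv'⟩ := mem_splits.1 hv.1
    rw [hp]
    refine ⟨_, _, rfl, ?_, ?_, ?_, ?_⟩
    · exact fun C hC => by simp [h2 hC]
    · rw [List.flatMap_singleton]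
      exact isRun_append h3 (isRun_learnActions hτ h2 h0 hR hv' hv.2)
    · by_cases hbad : Clause.ofLits [⟨x, true⟩] ∈ K ∧ Clause.ofLits [⟨x, false⟩] ∈ K
      · left
        simp [learnedClause, hbad]
      · right
        rw [List.map_singleton, learnedClause, if_neg hbad]
        intro C hC
        rcases List.mem_append.1 hC with hC | hC
        · simp [hPK hC]
        · simp at hC
          simp [hC]
    · have h6 := congrArg List.length hv'
      rw [length_varOrder] at h6
      simp only [List.length_append, List.length_cons] at h6
      rw [List.flatMap_singleton, learnActions]
      simp only [List.length_append, List.length_map, List.length_cons, List.length_nil]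
      omega

theorem runOfOrdered_spec {τ P : List (Clause n)} (hτ : CNF.Contradictory τ.toFinset)
    (hP : IsOrderedRefutation π τ.toFinset P) :
    IsSuccessfulRun [decisionL n, orderedD π] τ.toFinset (runOfOrdered (varOrder π) τ P) ∧
      (runOfOrdered (varOrder π) τ P).length ≤ P.length * (n + 2) := by
  obtain ⟨K, As, h1, h2, h3, h4, h5⟩ := runStep_spec hτ hP.1
  rw [runOfOrdered, h1]
  refine ⟨⟨_, h3, .inr ?_⟩, h5⟩
  exact List.mem_toFinset.2 (h4.elim id fun h => h hP.2)

end RunOfOrdered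

end OrderedCDCL

/-! ### Polynomial time: from ordered refutations to CDCL runs -/

namespace OrderedCDCL

open Enc

theorem size_enc_literal_le {n : ℕ} (l : Literal n) : (enc l).size ≤ n * 2 + 5 := by
  have key : ∀ k : ℕ, (Data.ofNat k).size = k * 2 + 1 := by
    intro k
    induction k with
    | zero => rfl
    | succ k ih => simp only [Data.ofNat, Data.size, ih]; ring
  have h1 : (enc l).size ≤ (Data.ofNat l.var).size + 4 := size_enc_literal l.var l.sign
  rw [key] at h1
  have := l.var.isLt
  omega

namespace PT

variable {X : Type} {e : X → Data} {n : X → ℕ}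

theorem take_one {α : X → Type} [∀ x, Enc (α x)] {l : ∀ x, List (α x)} (hl : Poly e l) :
    Poly e fun x => (l x).take 1 := by
  have := PT.iteData (PT.decTrue (PT.isEmpty hl)) PT.nil (hl.hd.cons PT.nil)
  refine this.congr fun x => ?_
  beta_reduce
  cases l x <;> rfl

theorem falseLit {R : ∀ x, Clause (n x)} {y : ∀ x, Fin (n x)} (hR : Poly e R) (hy : Poly e y) :
    Poly e fun x => falseLit (R x) (y x) :=
  PT.litMk hy (PT.not (PT.memClause hR (PT.litMk hy (PT.constEnc true))))

theorem actDecide {l : ∀ x, Literal (n x)} (hl : Poly e l) :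
    Poly e fun x => Action.decide (l x) := (PT.const (Data.ofNat 0)).cons hl

theorem actPropagate {l : ∀ x, Literal (n x)} (hl : Poly e l) :
    Poly e fun x => Action.propagate (l x) := (PT.const (Data.ofNat 1)).cons hl

theorem actLearn {C : ∀ x, Clause (n x)} {t : ∀ x, Trail (n x)} (hC : Poly e C) (ht : Poly e t) :
    Poly e fun x => Action.learn (C x) (t x) := (PT.const (Data.ofNat 2)).cons (hC.cons ht)

theorem isPivot {K : ∀ x, List (Clause (n x))} {R : ∀ x, Clause (n x)} {us : ∀ x, List (Fin (n x))}
    {v : ∀ x, Fin (n x)} (hn : Poly e n) (hK : Poly e K) (hR : Poly e R) (hus : Poly e us)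
    (hv : Poly e v) : Poly e fun x => isPivot (K x) (R x) (us x) (v x) := by
  refine PT.any hK fun Y e' x E he hE => PT.any (hK.lift he) fun Z e'' y F he' hF => ?_
  let m : Z → ℕ := fun z => n (x (y z))
  have hn' : Poly e'' m := (hn.lift he).lift he'
  have hR' := (hR.lift he).lift he'
  have hus' := (hus.lift he).lift he'
  have hv' := (hv.lift he).lift he'
  have hE' := hE.lift he'
  have hres := PT.resLits (n := m) hn' hv' hE' hF
  refine PT.and (PT.memClause (n := m) hE' (PT.litMk (n := m) hv' (PT.constEnc true)))
    (PT.and (PT.memClause (n := m) hF (PT.litMk (n := m) hv' (PT.constEnc false)))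
      (PT.and (PT.all hres ?_) (PT.all (PT.lits (n := m) hn' hR') ?_)))
  · intro Z' d z l he'' hl
    exact PT.memClause (n := fun z' => m (z z')) (hR'.lift he'') hl
  · intro Z' d z l he'' hl
    exact PT.and (PT.mem (hres.lift he'') hl)
      (PT.mem (hus'.lift he'') (PT.litVar (n := fun z' => m (z z')) hl))

theorem pivots {vs : ∀ x, List (Fin (n x))} {K : ∀ x, List (Clause (n x))}
    {R : ∀ x, Clause (n x)} (hn : Poly e n) (hvs : Poly e vs) (hK : Poly e K) (hR : Poly e R) :
    Poly e fun x => pivots (vs x) (K x) (R x) := by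
  refine PT.take_one (PT.filter (PT.splits hvs) fun Y e' x q he hq => ?_)
  exact PT.isPivot (n := fun y => n (x y)) (hn.lift he) (hK.lift he) (hR.lift he) (PT.fst hq)
    (PT.snd hq)

theorem learnedClause {K : ∀ x, List (Clause (n x))} {R : ∀ x, Clause (n x)}
    {v : ∀ x, Fin (n x)} (hn : Poly e n) (hK : Poly e K) (hR : Poly e R) (hv : Poly e v) :
    Poly e fun x => learnedClause (K x) (R x) (v x) := by
  have key : ∀ b : Bool, Poly e fun x =>
      decide (Clause.ofLits [(⟨v x, b⟩ : Literal (n x))] ∈ K x) := fun b =>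
    PT.mem hK (PT.ofLits hn (PT.listCons (PT.litMk hv (PT.constEnc b)) PT.listNil))
  exact PT.ite (PT.decAnd (key true) (key false)) (PT.zeroClause hn) hR

theorem learnActions {K : ∀ x, List (Clause (n x))} {R : ∀ x, Clause (n x)}
    {us : ∀ x, List (Fin (n x))} {v : ∀ x, Fin (n x)} (hn : Poly e n) (hK : Poly e K)
    (hR : Poly e R) (hus : Poly e us) (hv : Poly e v) :
    Poly e fun x => learnActions (K x) (R x) (us x) (v x) := by
  refine PT.append (PT.map hus fun Y e' x y he hy => PT.actDecide (n := fun y => n (x y))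
    (PT.falseLit (n := fun y => n (x y)) (hR.lift he) hy)) ?_
  exact PT.listCons (PT.actPropagate (PT.litMk hv (PT.constEnc true)))
    (PT.listCons (PT.actLearn (PT.learnedClause hn hK hR hv) PT.listNil) PT.listNil)

end PT

theorem size_enc_learnActions_le {n : ℕ} (K : List (Clause n)) (R : Clause n) (us : List (Fin n))
    (x : Fin n) : (enc (learnActions K R us x)).size ≤ (us.length + 2) * (n * 6 + 11) + 1 := by
  refine (Data.size_ofList_le enc _ (n * 6 + 10) fun A hA => ?_).trans_eq ?_
  · simp only [learnActions, List.mem_append, List.mem_map, List.mem_cons, List.not_mem_nil,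
      or_false] at hA
    have h0 : (Data.ofNat 0).size = 1 := rfl
    have h1 : (Data.ofNat 1).size = 3 := rfl
    have h2 : (Data.ofNat 2).size = 5 := rfl
    rcases hA with ⟨y, -, rfl⟩ | rfl | rfl
    · have := size_enc_literal_le (falseLit R y)
      change (Data.ofNat 0).size + (enc (falseLit R y)).size + 1 ≤ _
      omega
    · have := size_enc_literal_le (⟨x, true⟩ : Literal n)
      change (Data.ofNat 1).size + (enc (⟨x, true⟩ : Literal n)).size + 1 ≤ _
      omega
    · have := size_enc_clause (learnedClause K R x)
      change (Data.ofNat 2).size + ((enc (learnedClause K R x)).size + 1 + 1) + 1 ≤ _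
      omega
  · rw [learnActions, List.length_append, List.length_map]
    rfl

theorem length_fst_le_of_mem_pivots {n : ℕ} {vs : List (Fin n)} {K : List (Clause n)}
    {R : Clause n} {q : List (Fin n) × Fin n} (h : q ∈ pivots vs K R) :
    q.1.length ≤ vs.length := by
  obtain ⟨s, hs⟩ := mem_splits.1 (List.mem_of_mem_filter (List.mem_of_mem_take h))
  rw [hs]
  simp

theorem pivots_eq {n : ℕ} (vs : List (Fin n)) (K : List (Clause n)) (R : Clause n) :
    pivots vs K R = [] ∨ ∃ q, pivots vs K R = [q] := by
  unfold pivots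
  cases (splits vs).filter fun q => isPivot K R q.1 q.2 with
  | nil => exact .inl rfl
  | cons q Q => exact .inr ⟨q, rfl⟩

theorem PT.runOfOrdered {X : Type} {e : X → Data} {n : X → ℕ} {vs : ∀ x, List (Fin (n x))}
    {τ P : ∀ x, List (Clause (n x))} (hn : Poly e n) (hvs : Poly e vs) (hτ : Poly e τ)
    (hP : Poly e P) : Poly e fun x => runOfOrdered (vs x) (τ x) (P x) := by
  refine PT.snd (PT.foldl_additive (β := fun x => List (Clause (n x)) × List (Action (n x)))
    (b₀ := fun x => (τ x, [])) hP (PT.pair hτ PT.listNil) ?_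
    -- A step adds at most one clause and one block of at most `(vs x).length + 2` actions.
    (k := fun x => n x * 6 + 3 + (((vs x).length + 2) * (n x * 6 + 11) + 1)) ?_ ?_)
  · intro Y e' x s R he hs hR
    let m : Y → ℕ := fun y => n (x y)
    have hn' : Poly e' m := hn.lift he
    have hp := PT.pivots (n := m) hn' (hvs.lift he) (PT.fst hs) hR
    refine PT.ite (PT.decOr (PT.mem (PT.fst hs) (PT.zeroClause (n := m) hn'))
      (PT.mem (PT.fst hs) hR)) hs (PT.pair (PT.append (PT.map hp ?_) (PT.fst hs))
        (PT.append (PT.snd hs) (PT.flatMap hp ?_)))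
    · intro Z e'' y q he' hq
      exact PT.learnedClause (n := fun z => m (y z)) (hn'.lift he') (PT.fst (hs.lift he'))
        (hR.lift he') (PT.snd hq)
    · intro Z e'' y q he' hq
      exact PT.learnActions (n := fun z => m (y z)) (hn'.lift he') (PT.fst (hs.lift he'))
        (hR.lift he') (PT.fst hq) (PT.snd hq)
  · have h6 := (PT.nat_bdd hn).mul (.const 6)
    exact (h6.add (.const 3)).add ((((PT.length_bdd hvs).add (.const 2)).mul
      (h6.add (.const 11))).add (.const 1))
  · rintro x ⟨K, As⟩ R -
    unfold runStep
    split_ifs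
    · omega
    · dsimp only
      rcases pivots_eq (vs x) K R with h | ⟨q, h⟩
      · rw [h]
        simp
      · have hq : q ∈ OrderedCDCL.pivots (vs x) K R := by simp [h]
        have h1 := length_fst_le_of_mem_pivots hq
        have h2 := size_enc_learnActions_le K R q.1 q.2
        have h3 := size_enc_clause (OrderedCDCL.learnedClause K R q.2)
        have h4 := Data.size_ofList_append enc As (OrderedCDCL.learnActions K R q.1 q.2)
        have h5 := Nat.mul_le_mul_right (n x * 6 + 11) (Nat.add_le_add_right h1 2)
        rw [h, List.map_singleton, List.flatMap_singleton]
        change (enc (OrderedCDCL.learnedClause K R q.2)).size + (enc K).size + 1 +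
          (Data.ofList enc (As ++ OrderedCDCL.learnActions K R q.1 q.2)).size + 1 ≤ (enc K).size + (Data.ofList enc As).size + 1 + _
        change (Data.ofList enc _).size ≤ _ at h2
        omega

theorem cdcl_pSimulates_orderedResolution :
    PSimulates (fun n π => cdcl [decisionL n, orderedD π]) (fun _ π => orderedResolution π) := by
  refine PSimulates.of_function
    (fun x => runOfOrdered (varOrder x.perm) x.clauses x.proof) ?_ ?_
    (Polynomial.X * (Polynomial.X + 2)) ?_
  · intro x
    exact (runOfOrdered_spec x.contradictory x.isRefutation).1
  · let n : SimInput (fun _ π => orderedResolution π) → ℕ := fun x => x.n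
    exact PT.runOfOrdered (n := n) SimInput.poly_n
      (PT.varOrder (n := n) SimInput.poly_n SimInput.poly_perm) SimInput.poly_clauses
      SimInput.poly_proof
  · intro x
    refine (runOfOrdered_spec x.contradictory x.isRefutation).2.trans ?_
    simp only [Polynomial.eval_mul, Polynomial.eval_add, Polynomial.eval_X, Polynomial.eval_ofNat]
    have hs : List.length x.proof = (orderedResolution x.perm).size x.proof := rfl
    rw [hs]
    exact Nat.mul_le_mul (by omega) (by omega)

end OrderedCDCL

namespace OrderedCDCL

/-! ### A contradictory CNF that is hard for ordered resolution -/

namespace Hard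

/-- The `k`-th variable of the order. -/
def nthVar {m : ℕ} (π : Equiv.Perm (Fin (2 * m + 1))) (k : ℕ) : Fin (2 * m + 1) :=
  π.symm (Fin.ofNat (2 * m + 1) k)

/-- The `k`-th large variable. -/
abbrev bigVar {m : ℕ} (π : Equiv.Perm (Fin (2 * m + 1))) (k : ℕ) : Fin (2 * m + 1) :=
  nthVar π (m + 1 + k)

/-- The `i`-th clause (for `i ≤ m`) of the chain of implications `1 → y_0 → ⋯ → y_{m-1} → 0`
between the large variables. -/
def chain {m : ℕ} (π : Equiv.Perm (Fin (2 * m + 1))) (i : ℕ) : Line (2 * m + 1) :=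
  (if 0 < i then [⟨bigVar π (i - 1), false⟩] else []) ++
    (if i < m then [⟨bigVar π i, true⟩] else [])

/-- The `i`-th clause of the chain, weakened by a literal of the `i`-th small variable. -/
def weak {m : ℕ} (π : Equiv.Perm (Fin (2 * m + 1))) (i : ℕ) (b : Bool) : Clause (2 * m + 1) :=
  Clause.ofLits (⟨nthVar π i, b⟩ :: chain π i)

/-- The clauses of the hard CNF. -/
def clauses {m : ℕ} (π : Equiv.Perm (Fin (2 * m + 1))) : List (Clause (2 * m + 1)) :=
  (List.range (m + 1)).flatMap fun i => [weak π i true, weak π i false]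

/-- A short refutation of the hard CNF in general resolution. -/
def refutation {m : ℕ} (π : Equiv.Perm (Fin (2 * m + 1))) : List (Clause (2 * m + 1)) :=
  ((clauses π ++ (List.range (m + 1)).map fun i => Clause.ofLits (chain π i)) ++
    (List.range m).map fun i => Clause.ofLits [⟨bigVar π i, true⟩]) ++ [Clause.zero _]

variable {m : ℕ} {π : Equiv.Perm (Fin (2 * m + 1))}

theorem perm_nthVar {k : ℕ} (hk : k < 2 * m + 1) : (π (nthVar π k) : ℕ) = k := by
  simp [nthVar, Nat.mod_eq_of_lt hk]

theorem nthVar_injOn {j k : ℕ} (hj : j < 2 * m + 1) (hk : k < 2 * m + 1)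
    (h : nthVar π j = nthVar π k) : j = k := by
  rw [← perm_nthVar (π := π) hj, ← perm_nthVar (π := π) hk, h]

theorem eq_nthVar (x : Fin (2 * m + 1)) : x = nthVar π (π x) := by
  simp [nthVar]

theorem mem_chain {i : ℕ} {l : Literal (2 * m + 1)} : l ∈ chain π i ↔
    (0 < i ∧ l = ⟨bigVar π (i - 1), false⟩) ∨ (i < m ∧ l = ⟨bigVar π i, true⟩) := by
  unfold chain
  rw [List.mem_append]
  refine or_congr ?_ ?_ <;> split_ifs with h <;> simp [h]

theorem lt_perm_of_mem_chain {i : ℕ} (hi : i ≤ m) {l : Literal (2 * m + 1)} (hl : l ∈ chain π i) :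
    m < (π l.var : ℕ) := by
  rcases mem_chain.1 hl with ⟨h, rfl⟩ | ⟨h, rfl⟩
  · rw [perm_nthVar (by omega)]; omega
  · rw [perm_nthVar (by omega)]; omega

theorem chain_consistent {i : ℕ} : ∀ l ∈ chain π i, l.neg ∉ chain π i := by
  intro l hl hl'
  rcases mem_chain.1 hl with ⟨h, rfl⟩ | ⟨h, rfl⟩ <;>
    rcases mem_chain.1 hl' with ⟨h', h''⟩ | ⟨h', h''⟩ <;>
    simp only [Literal.neg, Literal.mk.injEq, Bool.not_false, Bool.not_true, reduceCtorEq,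
      and_false, and_true] at h'' <;>
    · have := nthVar_injOn (by omega) (by omega) h''
      omega

theorem weak_consistent {i : ℕ} (hi : i ≤ m) (b : Bool) :
    ∀ l ∈ (⟨nthVar π i, b⟩ :: chain π i : Line (2 * m + 1)),
      l.neg ∉ (⟨nthVar π i, b⟩ :: chain π i : Line (2 * m + 1)) := by
  have key : ∀ l ∈ chain π i, l.var ≠ nthVar π i := by
    intro l hl h
    have := lt_perm_of_mem_chain hi hl
    rw [h, perm_nthVar (by omega)] at this
    omega
  intro l hl hl'
  rcases List.mem_cons.1 hl with rfl | hl <;> rcases List.mem_cons.1 hl' with h | hl'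
  · exact Literal.neg_ne _ h
  · exact key _ hl' rfl
  · exact key _ hl (by rw [← Literal.neg_var, h])
  · exact chain_consistent l hl hl'

theorem mem_weak {i : ℕ} (hi : i ≤ m) {b : Bool} {l : Literal (2 * m + 1)} :
    l ∈ (weak π i b).1 ↔ l = ⟨nthVar π i, b⟩ ∨ l ∈ chain π i := by
  rw [weak, Clause.mem_ofLits (weak_consistent hi b), List.mem_cons]

theorem mem_ofLits_chain {i : ℕ} {l : Literal (2 * m + 1)} :
    l ∈ (Clause.ofLits (chain π i)).1 ↔ l ∈ chain π i :=
  Clause.mem_ofLits chain_consistent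

theorem mem_clauses {C : Clause (2 * m + 1)} :
    C ∈ clauses π ↔ ∃ i ≤ m, ∃ b, C = weak π i b := by
  simp only [clauses, List.mem_flatMap, List.mem_range, List.mem_cons, List.not_mem_nil, or_false,
    Nat.lt_succ_iff]
  refine exists_congr fun i => and_congr_right fun _ => ?_
  constructor
  · rintro (rfl | rfl)
    exacts [⟨true, rfl⟩, ⟨false, rfl⟩]
  · rintro ⟨b, rfl⟩
    cases b <;> simp

/-- Some literal of the chain clause is true. -/
def Sat (π : Equiv.Perm (Fin (2 * m + 1))) (v : Fin (2 * m + 1) → Bool) (i : ℕ) : Prop :=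
  ∃ l ∈ chain π i, v l.var = l.sign

/-- Truth propagates along the chain up to the last large variable, which the last clause negates.
-/
theorem not_all_sat (v : Fin (2 * m + 1) → Bool) : ¬ ∀ i ≤ m, Sat π v i := by
  intro h
  have key : ∀ i < m, v (bigVar π i) = true := by
    intro i
    induction i with
    | zero =>
      intro hi
      obtain ⟨l, hl, hv⟩ := h 0 (by omega)
      rcases mem_chain.1 hl with ⟨h', -⟩ | ⟨-, rfl⟩
      · omega
      · exact hv
    | succ i ih =>
      intro hi
      obtain ⟨l, hl, hv⟩ := h (i + 1) (by omega)
      rcases mem_chain.1 hl with ⟨h', rfl⟩ | ⟨-, rfl⟩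
      · rw [Nat.add_sub_cancel, ih (by omega)] at hv
        cases hv
      · exact hv
  obtain ⟨l, hl, hv⟩ := h m le_rfl
  rcases mem_chain.1 hl with ⟨h', rfl⟩ | ⟨h', -⟩
  · rw [key (m - 1) (by omega)] at hv
    cases hv
  · omega

/-- The chain is minimally unsatisfiable: make the large variables before the omitted implication
true and those after it false. -/
theorem exists_sat {i : ℕ} (hi : i ≤ m) :
    ∃ v : Fin (2 * m + 1) → Bool, ∀ k ≤ m, k ≠ i → Sat π v k := by
  refine ⟨fun x => decide ((π x : ℕ) < m + 1 + i), fun k hk hki => ?_⟩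
  rcases lt_or_gt_of_ne hki with h | h
  · refine ⟨_, mem_chain.2 (.inr ⟨by omega, rfl⟩), ?_⟩
    simp only [decide_eq_true_eq]
    rw [perm_nthVar (by omega)]
    omega
  · refine ⟨_, mem_chain.2 (.inl ⟨by omega, rfl⟩), ?_⟩
    simp only [decide_eq_false_iff_not]
    rw [perm_nthVar (by omega)]
    omega

theorem contradictory : CNF.Contradictory (clauses π).toFinset := by
  rintro ⟨v, hv⟩
  refine not_all_sat (π := π) v fun i hi => ?_
  obtain ⟨l, hl, hl'⟩ := hv (weak π i (!v (nthVar π i)))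
    (List.mem_toFinset.2 (mem_clauses.2 ⟨i, hi, _, rfl⟩))
  rcases (mem_weak hi).1 hl with rfl | hl
  · simp at hl'
  · exact ⟨l, hl, hl'⟩

theorem length_refutation : (refutation π).length = 4 * m + 4 := by
  simp [refutation, clauses]
  ring

/-- Each pair of weakenings is resolved on its small variable, the smallest one in the two clauses,
which the order forbids. Unit resolution along the chain does the rest. -/
theorem isResRefutation_refutation (hm : 0 < m) :
    IsResRefutation (clauses π).toFinset (refutation π) := by
  refine ⟨?_, by simp [refutation]⟩
  have h1 : IsDerivation (fun _ _ => True) (clauses π).toFinset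
      (clauses π ++ (List.range (m + 1)).map fun i => Clause.ofLits (chain π i)) := by
    refine IsDerivation.append ?_ fun C hC => ?_
    · have := isDerivation_nil (side := fun _ _ => True) (τ := (clauses π).toFinset)
      exact this.append fun C hC => .inl (List.mem_toFinset.2 hC)
    · obtain ⟨i, hi, rfl⟩ := List.mem_map.1 hC
      have hi : i ≤ m := by simpa [Nat.lt_succ_iff] using hi
      refine .inr ⟨weak π i true, mem_clauses.2 ⟨i, hi, _, rfl⟩, weak π i false,
        mem_clauses.2 ⟨i, hi, _, rfl⟩, ⟨nthVar π i, true⟩, ⟨?_, ?_, ?_⟩, trivial⟩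
      · exact (mem_weak hi).2 (.inl rfl)
      · exact (mem_weak hi).2 (.inl rfl)
      · have key : ∀ l ∈ chain π i, l.var ≠ nthVar π i := by
          intro l hl h
          have := lt_perm_of_mem_chain hi hl
          rw [h, perm_nthVar (by omega)] at this
          omega
        ext l
        simp only [mem_ofLits_chain, Finset.mem_union, Finset.mem_erase, mem_weak hi]
        constructor
        · intro hl
          left
          exact ⟨fun h => key l hl (by rw [h]), .inr hl⟩
        · rintro (⟨h, h' | h'⟩ | ⟨h, h' | h'⟩)
          · exact absurd h' h
          · exact h'
          · exact absurd h' h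
          · exact h'
  have hunit : ∀ (b : Bool) (l : Literal (2 * m + 1)) (k : ℕ),
      l ∈ (Clause.ofLits [(⟨bigVar π k, b⟩ : Literal (2 * m + 1))]).1 ↔ l = ⟨bigVar π k, b⟩ := by
    intro b l k
    rw [ofLits_singleton, Finset.mem_singleton]
  have hchain : ∀ (k : ℕ) (Q : List (Clause (2 * m + 1))), k ≤ m → Clause.ofLits (chain π k) ∈
      (clauses π ++ (List.range (m + 1)).map fun i => Clause.ofLits (chain π i)) ++ Q := by
    intro k Q hk
    simp only [List.mem_append, List.mem_map, List.mem_range]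
    exact .inl (.inr ⟨k, by omega, rfl⟩)
  have h2 : ∀ k ≤ m, IsDerivation (fun _ _ => True) (clauses π).toFinset
      ((clauses π ++ (List.range (m + 1)).map fun i => Clause.ofLits (chain π i)) ++
        (List.range k).map fun i => Clause.ofLits [⟨bigVar π i, true⟩]) := by
    intro k
    induction k with
    | zero =>
      intro _
      simpa using h1
    | succ k ih =>
      intro hk
      have hsucc : ((List.range (k + 1)).map fun i =>
          Clause.ofLits [(⟨bigVar π i, true⟩ : Literal (2 * m + 1))]) =
          ((List.range k).map fun i => Clause.ofLits [⟨bigVar π i, true⟩]) ++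
            [Clause.ofLits [⟨bigVar π k, true⟩]] := by
        rw [List.range_succ, List.map_append, List.map_singleton]
      rw [hsucc, ← List.append_assoc]
      refine (ih (by omega)).append fun C hC => ?_
      obtain rfl : C = Clause.ofLits [⟨bigVar π k, true⟩] := by simpa using hC
      -- The first unit clause is the first clause of the chain, so that line repeats an earlier
      -- one.
      cases k with
      | zero =>
        have : Clause.ofLits [(⟨bigVar π 0, true⟩ : Literal (2 * m + 1))] =
            Clause.ofLits (chain π 0) := by simp [chain, hm]
        rw [this]
        exact (ih (by omega)).justified (hchain 0 _ (by omega))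
      | succ k =>
        refine .inr ⟨Clause.ofLits [⟨bigVar π k, true⟩], ?_, Clause.ofLits (chain π (k + 1)),
          hchain _ _ (by omega), ⟨bigVar π k, true⟩, ⟨?_, ?_, ?_⟩, trivial⟩
        · simp only [List.mem_append, List.mem_map, List.mem_range]
          exact .inr ⟨k, by omega, rfl⟩
        · exact (hunit _ _ _).2 rfl
        · exact mem_ofLits_chain.2 (mem_chain.2 (.inl ⟨by omega, rfl⟩))
        · ext l
          rw [Finset.mem_union, Finset.mem_erase, Finset.mem_erase,
            mem_ofLits_chain, mem_chain, hunit, hunit, Nat.add_sub_cancel]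
          constructor
          · rintro rfl
            exact .inr ⟨by simp [Literal.neg], .inr ⟨by omega, rfl⟩⟩
          · rintro (⟨h, h'⟩ | ⟨h, h' | h'⟩)
            · exact absurd h' h
            · exact absurd h'.2 h
            · exact h'.2
  refine (h2 m le_rfl).append fun C hC => ?_
  obtain rfl : C = Clause.zero _ := by simpa using hC
  refine .inr ⟨Clause.ofLits [⟨bigVar π (m - 1), true⟩], ?_, Clause.ofLits (chain π m),
    hchain _ _ le_rfl, ⟨bigVar π (m - 1), true⟩, ⟨?_, ?_, ?_⟩, trivial⟩
  · simp only [List.mem_append, List.mem_map, List.mem_range]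
    exact .inr ⟨m - 1, by omega, rfl⟩
  · exact (hunit _ _ _).2 rfl
  · exact mem_ofLits_chain.2 (mem_chain.2 (.inl ⟨hm, rfl⟩))
  · ext l
    rw [Finset.mem_union, Finset.mem_erase, Finset.mem_erase, mem_ofLits_chain, mem_chain,
      hunit]
    constructor
    · intro h
      simp [Clause.zero] at h
    · rintro (⟨h, h'⟩ | ⟨h, h' | h'⟩)
      · exact absurd h' h
      · exact absurd h'.2 h
      · omega

/-- The large literals of `E` follow from the clauses of the chain whose small variables occur
in `E`. -/
def BigSound (π : Equiv.Perm (Fin (2 * m + 1))) (E : Clause (2 * m + 1)) : Prop :=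
  ∀ v : Fin (2 * m + 1) → Bool, (∀ i ≤ m, (∃ b, ⟨nthVar π i, b⟩ ∈ E.1) → Sat π v i) →
    ∃ l ∈ E.1, m < (π l.var : ℕ) ∧ v l.var = l.sign

/-- Resolving on a large variable keeps all the small literals of both premises, so the resolvent
may use every chain clause that the premises use. -/
theorem BigSound.resolvent {E F R : Clause (2 * m + 1)} {l : Literal (2 * m + 1)}
    (hl : m < (π l.var : ℕ)) (h : IsResolvent E F l R) (hE : BigSound π E) (hF : BigSound π F) :
    BigSound π R := by
  intro v hv
  have hne : ∀ i ≤ m, ∀ b, (⟨nthVar π i, b⟩ : Literal (2 * m + 1)) ≠ l ∧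
      (⟨nthVar π i, b⟩ : Literal (2 * m + 1)) ≠ l.neg := by
    intro i hi b
    constructor <;>
    · intro h
      have := congrArg Literal.var h
      simp only [Literal.neg_var] at this
      rw [← this, perm_nthVar (by omega)] at hl
      omega
  have hmem : ∀ k, k ∈ R.1 ↔ (k ≠ l ∧ k ∈ E.1) ∨ (k ≠ l.neg ∧ k ∈ F.1) := by
    intro k
    rw [h.2.2, Finset.mem_union, Finset.mem_erase, Finset.mem_erase]
  obtain ⟨k, hk, hk1, hk2⟩ := hE v fun i hi ⟨b, hb⟩ =>
    hv i hi ⟨b, (hmem _).2 (.inl ⟨(hne i hi b).1, hb⟩)⟩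
  by_cases hkl : k = l
  · obtain ⟨k', hk', hk1', hk2'⟩ := hF v fun i hi ⟨b, hb⟩ =>
      hv i hi ⟨b, (hmem _).2 (.inr ⟨(hne i hi b).2, hb⟩)⟩
    refine ⟨k', (hmem _).2 (.inr ⟨?_, hk'⟩), hk1', hk2'⟩
    rintro rfl
    rw [hkl] at hk2
    rw [Literal.neg_var, hk2] at hk2'
    simp [Literal.neg] at hk2'
  · exact ⟨k, (hmem _).2 (.inl ⟨hkl, hk⟩), hk1, hk2⟩

/-- In an ordered derivation a clause with a large literal can only come from a resolution on a
still larger variable, so both premises contain a large literal as well. No small variable has been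
resolved on up to this point. -/
theorem bigSound_of_mem {P : List (Clause (2 * m + 1))}
    (hP : IsDerivation (orderedSide π) (clauses π).toFinset P) {E : Clause (2 * m + 1)}
    (hE : E ∈ P) {l : Literal (2 * m + 1)} (hl : l ∈ E.1) (hlm : m < (π l.var : ℕ)) :
    BigSound π E := by
  induction P using List.reverseRecOn generalizing E l with
  | nil => simp at hE
  | append_singleton P C ih =>
    rw [isDerivation_iff] at hP
    have hP' : IsDerivation (orderedSide π) (clauses π).toFinset P :=
      isDerivation_iff.2 fun Q C' S h => hP Q C' (S ++ [C]) (by simp [h])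
    rcases List.mem_append.1 hE with hE | hE
    · exact ih hP' hE hl hlm
    · obtain rfl : E = C := by simpa using hE
      rcases hP P E [] rfl with h | ⟨F, hF, G, hG, k, hres, hside⟩
      · obtain ⟨i, hi, b, rfl⟩ := mem_clauses.1 (List.mem_toFinset.1 h)
        intro v hv
        obtain ⟨k, hk, hk'⟩ := hv i hi ⟨b, (mem_weak hi).2 (.inl rfl)⟩
        exact ⟨k, (mem_weak hi).2 (.inr hk), lt_perm_of_mem_chain hi hk, hk'⟩
      · have hk : m < (π k.var : ℕ) := hlm.trans (hside l hl)
        exact BigSound.resolvent hk hres (ih hP' hF hres.1 hk)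
          (ih hP' hG hres.2.1 (by simpa using hk))

/-- An ordered refutation contains, for every assignment of the small variables, a clause that
contains all the literals falsified by it. -/
theorem exists_full_clause (hm : 0 < m) {P : List (Clause (2 * m + 1))}
    (hP : IsOrderedRefutation π (clauses π).toFinset P) (α : Fin (m + 1) → Bool) :
    ∃ E ∈ P, ∀ i : Fin (m + 1), ⟨nthVar π i, !α i⟩ ∈ E.1 := by
  classical
  let p : Clause (2 * m + 1) → Bool := fun E => decide (∀ l ∈ E.1, ∃ i : Fin (m + 1),
    l = ⟨nthVar π i, !α i⟩)
  -- The first clause made only of small literals falsified by `α`; one exists because 0 qualifies.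
  obtain ⟨Q, E, S, rfl, hE, hQ⟩ : ∃ Q E S, P = Q ++ E :: S ∧ p E = true ∧
      ∀ F ∈ Q, p F = false := by
    have h0 : Clause.zero _ ∈ P.filter p :=
      List.mem_filter.2 ⟨hP.2, by simp [p, Clause.zero]⟩
    rcases hf : P.filter p with _ | ⟨E, R⟩
    · simp [hf] at h0
    · obtain ⟨Q, S, h⟩ := List.filter_eq_cons_split hf
      exact ⟨Q, E, S, h⟩
  have hE : ∀ l ∈ E.1, ∃ i : Fin (m + 1), l = ⟨nthVar π i, !α i⟩ := by simpa [p] using hE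
  have hsmall : ∀ l ∈ E.1, ¬ m < (π l.var : ℕ) := by
    intro l hl
    obtain ⟨i, rfl⟩ := hE l hl
    rw [perm_nthVar (by omega)]
    omega
  have hnotall : ∀ F ∈ Q, (∀ l ∈ F.1, ∃ i : Fin (m + 1), l = ⟨nthVar π i, !α i⟩) → False := by
    intro F hF h
    have := hQ F hF
    simp only [p, decide_eq_false_iff_not] at this
    exact this h
  refine ⟨E, by simp, ?_⟩
  rcases isDerivation_iff.1 hP.1 Q E S rfl with h | ⟨F, hF, G, hG, k, hres, -⟩
  · exfalso
    obtain ⟨i, hi, b, rfl⟩ := mem_clauses.1 (List.mem_toFinset.1 h)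
    -- As `m > 0`, every chain clause has a literal, so initial clauses contain large literals and
    -- do not qualify.
    obtain ⟨l, hl⟩ : ∃ l, l ∈ chain π i := by
      by_cases h0 : 0 < i
      · exact ⟨_, mem_chain.2 (.inl ⟨h0, rfl⟩)⟩
      · exact ⟨_, mem_chain.2 (.inr ⟨by omega, rfl⟩)⟩
    exact hsmall l ((mem_weak hi).2 (.inr hl)) (lt_perm_of_mem_chain hi hl)
  · have hmem : ∀ l, l ∈ E.1 ↔ (l ≠ k ∧ l ∈ F.1) ∨ (l ≠ k.neg ∧ l ∈ G.1) := by
      intro l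
      rw [hres.2.2, Finset.mem_union, Finset.mem_erase, Finset.mem_erase]
    by_cases hk : m < (π k.var : ℕ)
    · have hsound : BigSound π E := BigSound.resolvent hk hres
        (bigSound_of_mem hP.1 (by simp [hF]) hres.1 hk)
        (bigSound_of_mem hP.1 (by simp [hG]) hres.2.1 (by simpa using hk))
      intro i
      by_contra hi
      -- If the `i`-th small variable is missing in `E`, then all the chain clauses that `E` may use
      -- are satisfied by `v`, which yields a large literal in `E`.
      obtain ⟨v, hv⟩ := exists_sat (π := π) (i := i) (by omega)
      obtain ⟨l, hl, hlm, -⟩ := hsound v fun j hj ⟨b, hb⟩ => hv j hj (by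
        rintro rfl
        obtain ⟨j, hj'⟩ := hE _ hb
        have h1 := nthVar_injOn (by omega) (by omega) (congrArg Literal.var hj')
        obtain rfl : i = j := Fin.ext h1
        rw [hj'] at hb
        exact hi hb)
      exact hsmall l hl hlm
    -- With a small pivot, the premise containing the pivot literal that is false under `α` would be
    -- an earlier clause of the same kind.
    · exfalso
      obtain ⟨i, hi⟩ : ∃ i : Fin (m + 1), k.var = nthVar π i :=
        ⟨⟨π k.var, by omega⟩, eq_nthVar _⟩
      rcases Literal.eq_or_eq_neg (l := k) (m := ⟨nthVar π i, !α i⟩) hi with h | h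
      · refine hnotall F hF fun l hl => ?_
        by_cases hlk : l = k
        · exact ⟨i, hlk.trans h⟩
        · exact hE l ((hmem l).2 (.inl ⟨hlk, hl⟩))
      · refine hnotall G hG fun l hl => ?_
        by_cases hlk : l = k.neg
        · exact ⟨i, by rw [hlk, h, Literal.neg_neg]⟩
        · exact hE l ((hmem l).2 (.inr ⟨hlk, hl⟩))

/-- The clauses for two different assignments differ, since a common clause would contain
complementary literals of a variable on which the assignments disagree. -/
theorem pow_le_length (hm : 0 < m) {P : List (Clause (2 * m + 1))}
    (hP : IsOrderedRefutation π (clauses π).toFinset P) : 2 ^ (m + 1) ≤ P.length := by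
  choose f hf hf' using exists_full_clause hm hP
  have hinj : Function.Injective f := by
    intro α β h
    funext i
    by_contra hne
    have h1 := hf' α i
    have h2 := hf' β i
    rw [← h] at h2
    refine (f α).2 _ h1 ?_
    have : Literal.neg ⟨nthVar π i, !α i⟩ = ⟨nthVar π i, !β i⟩ := by
      revert hne
      cases α i <;> cases β i <;> simp [Literal.neg]
    rwa [this]
  have h1 : Finset.univ.image f ⊆ P.toFinset := by
    intro C hC
    obtain ⟨α, -, rfl⟩ := Finset.mem_image.1 hC
    exact List.mem_toFinset.2 (hf α)
  have h2 := Finset.card_le_card h1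
  rw [Finset.card_image_of_injective _ hinj] at h2
  simp only [Finset.card_univ, Fintype.card_pi, Fintype.card_bool, Finset.prod_const,
    Fintype.card_fin] at h2
  exact h2.trans P.toFinset_card_le

end Hard

/-! ### Growth rates and the conclusion -/

theorem exists_polyEval_lt_two_pow (q : Polynomial ℕ) : ∃ m, 0 < m ∧ q.eval m < 2 ^ (m + 1) := by
  -- The coefficients are natural numbers with sum `q.eval 1`.
  have h1 : ∀ m, 0 < m → q.eval m ≤ q.eval 1 * m ^ q.natDegree := by
    intro m hm
    rw [Polynomial.eval_eq_sum_range, Polynomial.eval_eq_sum_range, Finset.sum_mul]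
    refine Finset.sum_le_sum fun i hi => ?_
    rw [one_pow, mul_one]
    refine Nat.mul_le_mul_left _ (Nat.pow_le_pow_right hm ?_)
    simpa [Nat.lt_succ_iff] using hi
  have h2 := tendsto_pow_const_div_const_pow_of_one_lt q.natDegree (r := (2 : ℝ)) (by norm_num)
  have h3 : (0 : ℝ) < 1 / (q.eval 1 + 1 : ℕ) := by positivity
  obtain ⟨m, hm, hm0⟩ := ((h2.eventually_lt_const h3).and (Filter.eventually_gt_atTop 0)).exists
  refine ⟨m, hm0, (h1 m hm0).trans_lt ?_⟩
  rw [div_lt_div_iff₀ (by positivity) (by positivity), one_mul] at hm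
  have h4 : m ^ q.natDegree * (q.eval 1 + 1) < 2 ^ m := by exact_mod_cast hm
  have h5 : 2 ^ m ≤ 2 ^ (m + 1) := Nat.pow_le_pow_right (by norm_num) (by omega)
  nlinarith [Nat.zero_le (m ^ q.natDegree)]

theorem not_sizeSimulates (π : ∀ n : ℕ, Equiv.Perm (Fin n)) :
    ¬ SizeSimulates (fun n => cdcl [decisionL n, orderedD (π n)]) resolution := by
  rintro ⟨q, hq⟩
  obtain ⟨M, r, hr⟩ := orderedResolution_pSimulates_cdcl
  let X : Polynomial ℕ := Polynomial.X
  -- The hard CNF has 2m + 1 variables, at most 2m + 2 clauses and a refutation with 4m + 4 lines,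
  -- in sum at most 8m + 7; `q` then bounds the CDCL proof, and `r` the ordered refutation obtained
  -- from it.
  obtain ⟨m, hm, hlt⟩ := exists_polyEval_lt_two_pow (r.comp (2 * X + 1 + q.comp (8 * X + 7)))
  let ρ := π (2 * m + 1)
  obtain ⟨B, hB, hBs⟩ := hq (2 * m + 1) (Hard.clauses ρ).toFinset Hard.contradictory
    (Hard.refutation ρ) (Hard.isResRefutation_refutation hm)
  obtain ⟨D, hD, -, hDs⟩ := hr (2 * m + 1) ρ (Hard.clauses ρ) Hard.contradictory B hB
  have h1 : 2 ^ (m + 1) ≤ (orderedResolution ρ).size D := Hard.pow_le_length hm hD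
  have h2 : (Hard.clauses ρ).toFinset.card ≤ 2 * m + 2 := by
    refine (List.toFinset_card_le _).trans_eq ?_
    simp [Hard.clauses]
    ring
  have h3 : (resolution (2 * m + 1)).size (Hard.refutation ρ) = 4 * m + 4 :=
    Hard.length_refutation
  rw [h3] at hBs
  have h4 := hBs.trans (polyEval_mono q (b := 8 * m + 7) (by omega))
  have h5 := hDs.trans (polyEval_mono r (Nat.add_le_add_left h4 (2 * m + 1)))
  simp only [X, Polynomial.eval_comp, Polynomial.eval_add, Polynomial.eval_mul, Polynomial.eval_X,
    Polynomial.eval_ofNat, Polynomial.eval_one] at hlt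
  exact absurd (h1.trans h5) (not_le.2 hlt)

end OrderedCDCL

theorem theorem2p2 :
    PolyEquivalent (fun n π => cdcl [decisionL n, orderedD π]) (fun _ π => orderedResolution π) ∧
      ∀ π : ∀ n : ℕ, Equiv.Perm (Fin n),
        ¬ SizeSimulates (fun n => cdcl [decisionL n, orderedD (π n)]) resolution :=
  ⟨⟨cdcl_pSimulates_orderedResolution, orderedResolution_pSimulates_cdcl⟩, not_sizeSimulates⟩
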